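/- Consider spatial type theory: dependent type theory whose contexts $\Delta \mid \Gamma$ have a crisp zone $\Delta$ (the type of a crisp variable contains only crisp variables) followed by a cohesive zone $\Gamma$. It has the usual rules, acting on the cohesive zone only and with variables of either zone usable as terms, for a cumulative hierarchy of universes $\mathcal U_0 : \mathcal U_1 : \cdots$, $\Pi$-types (with $\beta$ and $\eta$), $\Sigma$-types, the unit type, $\mathbb N$ and identity types, together with function extensionality, and the following rules for a type former $\sharp$ (where $\uparrow$-weakenings are suppressed): $$\frac{\Delta,\Gamma\mid\cdot\vdash A:\mathcal U_i}{\Delta\mid\Gamma\vdash \sharp A:\mathcal U_i}\qquad \frac{\Delta,\Gamma\mid\cdot\vdash M:A}{\Delta\mid\Gamma\vdash M^\sharp:\sharp A}\qquad \frac{\Delta\mid\cdot\vdash M:\sharp A}{\Delta\mid\Gamma\vdash M_\sharp:A}$$ $$\frac{\Delta\mid\cdot\vdash M:A}{\Delta\mid\Gamma\vdash (M^\sharp)_\sharp\equiv M:A}\qquad \frac{\Delta\mid\Gamma\vdash M:\sharp A}{\Delta\mid\Gamma\vdash (M_\sharp)^\sharp\equiv M:\sharp A}$$ For $f:A\to B$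 let $\sharp f:\sharp A\to\sharp B$ be $\sharp f(u):= f(u_\sharp)^\sharp$, and let $A\times_C B:=\sum_{x:A}\sum_{y:B}(f(x)=g(y))$ be the pullback of $f:A\to C$ and $g:B\to C$. **Theorem.** For every universe $\mathcal U=\mathcal U_i$, closed terms of the types expressing the following four statements are derivable in this theory (without univalence). 1. $\sharp$ is a (monadic) modality: with $\eta_A:=(-)^\sharp:A\to\sharp A$, for all $A:\mathcal U$ and $B:\sharp A\to\mathcal U$ there is a function $\mathsf{ind}:\big(\prod_{a:A}\sharp B(a^\sharp)\big)\to\prod_{z:\sharp A}\sharp B(z)$ with $\mathsf{ind}(f)(a^\sharp)=f(a)$ for all $f$ and $a$; and for all $A:\mathcal U$ and $z,z':\sharp A$ the map $(-)^\sharp:(z=z')\to\sharp(z=z')$ is an equivalence. 2. $\sharp$ preserves pullbacks (so it is a left exact modality): for all $A,B,C:\mathcal U$, $f:A\to C$ and $g:B\to C$, there is a map $$c:\sharp(A\times_C B)\to \sharp A\times_{\sharp C}\sharp B$$ (the pullback on the right being that of $\sharp f$ and $\sharp g$) which is the comparison map, i.e. $c\big((a,b,p)^\sharp\big)=\big(a^\sharp,b^\sharp,\mathsf{ap}_{(-)^\sharp}(p)\big)$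 for all $a:A$, $b:B$, $p:f(a)=g(b)$, and which is an equivalence. 3. For all $A:\mathcal U$ and $x,y:A$ there is an equivalence $e:(x^\sharp=y^\sharp)\simeq\sharp(x=y)$ such that $e(\mathsf{ap}_{(-)^\sharp}(p))=p^\sharp$ for all $p:x=y$. 4. $\sharp$ preserves $n$-types: for all $n\ge -2$ and all $A:\mathcal U$, if $A$ is an $n$-type then so is $\sharp A$. -/

import Mathlib

/-!
# Spatial type theory with the `♯` modality

Raw terms (de Bruijn indices), substitution, and the inductively generated judgments of
the dependent type theory with a crisp and a cohesive context zone.  The ordinary rules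
(cumulative Russell universes, `Π`, `Σ`, `1`, `ℕ`, identity types, function
extensionality) act on the cohesive zone only; the rules of `♯` interact with both.
-/

namespace SpatialTT

/-- Raw terms; types are terms, the universes being à la Russell.  Variables are de Bruijn
indices.  The number of variables bound in an argument is given in the comments. -/
inductive Tm : Type where
  | var (n : ℕ)
  | univ (i : ℕ)
  /-- `Π (x : A), B`; `B` binds one variable -/
  | pi (A B : Tm)
  /-- `λ (x : A), b`; `b` binds one variable -/
  | lam (A b : Tm)
  | app (f a : Tm)
  /-- `Σ (x : A), B`; `B` binds one variable -/
  | sig (A B : Tm)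
  | pair (a b : Tm)
  /-- `ind_Σ (z. C, x. y. g, p)`; `C` binds one variable, `g` binds two -/
  | indSig (C g p : Tm)
  | unit
  | star
  /-- `ind_1 (z. C, c, t)`; `C` binds one variable -/
  | indUnit (C c t : Tm)
  | nat
  | zero
  | succ (n : Tm)
  /-- `ind_ℕ (n. C, c₀, n. r. cs, t)`; `C` binds one variable, `cs` binds two -/
  | indNat (C c₀ cs t : Tm)
  /-- the identity type `a =_A b` -/
  | id (A a b : Tm)
  | refl (a : Tm)
  /-- based path induction `ind_= (y. p. C, c, b, p)`; `C` binds two variables -/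
  | indId (C c b p : Tm)
  /-- the type `♯ A` -/
  | sharp (A : Tm)
  /-- the introduction form `a^♯` -/
  | sharpIn (a : Tm)
  /-- the elimination form `a_♯` -/
  | sharpOut (a : Tm)
  /-- the constant for function extensionality in the universe `i` -/
  | funext (i : ℕ)

namespace Tm

/-- The action of a renaming under one binder. -/
def liftRen (ρ : ℕ → ℕ) : ℕ → ℕ
  | 0 => 0
  | n + 1 => ρ n + 1

/-- Renaming of the free variables. -/
def rename : (ℕ → ℕ) → Tm → Tm
  | ρ, var n => var (ρ n)
  | _, univ i => univ i
  | ρ, pi A B => pi (rename ρ A) (rename (liftRen ρ) B)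
  | ρ, lam A b => lam (rename ρ A) (rename (liftRen ρ) b)
  | ρ, app f a => app (rename ρ f) (rename ρ a)
  | ρ, sig A B => sig (rename ρ A) (rename (liftRen ρ) B)
  | ρ, pair a b => pair (rename ρ a) (rename ρ b)
  | ρ, indSig C g p =>
      indSig (rename (liftRen ρ) C) (rename (liftRen (liftRen ρ)) g) (rename ρ p)
  | _, unit => unit
  | _, star => star
  | ρ, indUnit C c t => indUnit (rename (liftRen ρ) C) (rename ρ c) (rename ρ t)
  | _, nat => nat
  | _, zero => zero
  | ρ, succ n => succ (rename ρ n)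
  | ρ, indNat C c₀ cs t =>
      indNat (rename (liftRen ρ) C) (rename ρ c₀) (rename (liftRen (liftRen ρ)) cs)
        (rename ρ t)
  | ρ, id A a b => id (rename ρ A) (rename ρ a) (rename ρ b)
  | ρ, refl a => refl (rename ρ a)
  | ρ, indId C c b p =>
      indId (rename (liftRen (liftRen ρ)) C) (rename ρ c) (rename ρ b) (rename ρ p)
  | ρ, sharp A => sharp (rename ρ A)
  | ρ, sharpIn a => sharpIn (rename ρ a)
  | ρ, sharpOut a => sharpOut (rename ρ a)
  | _, funext i => funext i

/-- Weakening by `k` variables. -/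
def wk (k : ℕ) (t : Tm) : Tm := rename (fun n => n + k) t

/-- The action of a substitution under one binder. -/
def liftSub (σ : ℕ → Tm) : ℕ → Tm
  | 0 => var 0
  | n + 1 => wk 1 (σ n)

/-- Simultaneous capture-avoiding substitution. -/
def subst : (ℕ → Tm) → Tm → Tm
  | σ, var n => σ n
  | _, univ i => univ i
  | σ, pi A B => pi (subst σ A) (subst (liftSub σ) B)
  | σ, lam A b => lam (subst σ A) (subst (liftSub σ) b)
  | σ, app f a => app (subst σ f) (subst σ a)
  | σ, sig A B => sig (subst σ A) (subst (liftSub σ) B)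
  | σ, pair a b => pair (subst σ a) (subst σ b)
  | σ, indSig C g p =>
      indSig (subst (liftSub σ) C) (subst (liftSub (liftSub σ)) g) (subst σ p)
  | _, unit => unit
  | _, star => star
  | σ, indUnit C c t => indUnit (subst (liftSub σ) C) (subst σ c) (subst σ t)
  | _, nat => nat
  | _, zero => zero
  | σ, succ n => succ (subst σ n)
  | σ, indNat C c₀ cs t =>
      indNat (subst (liftSub σ) C) (subst σ c₀) (subst (liftSub (liftSub σ)) cs) (subst σ t)
  | σ, id A a b => id (subst σ A) (subst σ a) (subst σ b)
  | σ, refl a => refl (subst σ a)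
  | σ, indId C c b p =>
      indId (subst (liftSub (liftSub σ)) C) (subst σ c) (subst σ b) (subst σ p)
  | σ, sharp A => sharp (subst σ A)
  | σ, sharpIn a => sharpIn (subst σ a)
  | σ, sharpOut a => sharpOut (subst σ a)
  | _, funext i => funext i

/-- The substitution of `a` for the variable `0`. -/
def single (a : Tm) : ℕ → Tm
  | 0 => a
  | n + 1 => var n

/-- The substitution of `a` for the variable `1` and of `b` for the variable `0`. -/
def double (a b : Tm) : ℕ → Tm
  | 0 => b
  | 1 => a
  | n + 2 => var n

/-- `t[a/x]`, where `x` is the last variable of the context of `t`. -/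
def inst (t a : Tm) : Tm := subst (single a) t

/-- `t[a/x, b/y]`, where `x`, `y` are the last two variables of the context of `t`. -/
def inst₂ (t a b : Tm) : Tm := subst (double a b) t

/-- For `C` with last variable `z`: the term `C[c/z]` in the context in which `z` is replaced
by two variables, where `c` is a term in this new context. -/
def reinst₂ (C c : Tm) : Tm :=
  subst (fun n => match n with
    | 0 => c
    | n + 1 => var (n + 2)) C

/-! ### Derived type formers -/

/-- `A → B` -/
def arrow (A B : Tm) : Tm := pi A (wk 1 B)

/-- `A × B` -/
def prod (A B : Tm) : Tm := sig A (wk 1 B)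

/-- `isContr A := Σ (a : A), Π (x : A), a = x` -/
def isContr (A : Tm) : Tm := sig A (pi (wk 1 A) (id (wk 2 A) (var 1) (var 0)))

/-- For `f : A → B`:
`isEquiv f := (Σ (g : B → A), Π (b : B), f (g b) = b) × (Σ (h : B → A), Π (a : A), h (f a) = a)` -/
def isEquiv (A B f : Tm) : Tm :=
  prod
    (sig (arrow B A)
      (pi (wk 1 B) (id (wk 2 B) (app (wk 2 f) (app (var 1) (var 0))) (var 0))))
    (sig (arrow B A)
      (pi (wk 1 A) (id (wk 2 A) (app (var 1) (app (wk 2 f) (var 0))) (var 0))))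

/-- For `A` a type, `B : A → 𝒰` and `f, g : Π (x : A), B x`, the map
`happly : (f = g) → Π (x : A), f x = g x`, defined by path induction. -/
def happly (A B f g : Tm) : Tm :=
  lam (id (pi A (app (wk 1 B) (var 0))) f g)
    (indId
      (pi (wk 3 A) (id (app (wk 4 B) (var 0)) (app (wk 4 f) (var 0)) (app (var 2) (var 0))))
      (lam (wk 1 A) (refl (app (wk 2 f) (var 0))))
      (wk 1 g) (var 0))

/-- The type of the function extensionality axiom:
`Π (A : 𝒰ᵢ) (B : A → 𝒰ᵢ) (f g : Π (x : A), B x), isEquiv happly`. -/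
def funextType (i : ℕ) : Tm :=
  pi (univ i) <| pi (arrow (var 0) (univ i)) <|
  pi (pi (var 1) (app (var 1) (var 0))) <| pi (pi (var 2) (app (var 2) (var 0))) <|
    isEquiv (id (pi (var 3) (app (var 3) (var 0))) (var 1) (var 0))
      (pi (var 3) (id (app (var 3) (var 0)) (app (var 2) (var 0)) (app (var 1) (var 0))))
      (happly (var 3) (var 2) (var 1) (var 0))

end Tm

open Tm

/-- The judgments.  `Δ` is the crisp zone and `Γ` the cohesive zone of the context `Δ ∣ Γ`; in
both lists the most recent variable comes first, and the de Bruijn indices count through `Γ`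
and then through `Δ`.  Hence the context `Δ, Γ ∣ ·` is the pair `Γ ++ Δ`, `[]`, and raw terms
need no change when passing from `Δ ∣ Γ` to it. -/
inductive Judgment : Type where
  /-- `Δ ∣ Γ` is a context -/
  | ctx (Δ Γ : List Tm)
  /-- `Δ ∣ Γ ⊢ t : A` -/
  | tm (Δ Γ : List Tm) (t A : Tm)
  /-- `Δ ∣ Γ ⊢ t ≡ u : A` -/
  | eq (Δ Γ : List Tm) (t u A : Tm)

open Judgment

/-- The derivable judgments. -/
inductive Derivable : Judgment → Prop where
  /- contexts -/
  | ctx_nil : Derivable (ctx [] [])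
  | ctx_crisp {Δ A i} : Derivable (tm Δ [] A (univ i)) → Derivable (ctx (A :: Δ) [])
  | ctx_cohesive {Δ Γ A i} : Derivable (tm Δ Γ A (univ i)) → Derivable (ctx Δ (A :: Γ))
  /- variables, crisp or cohesive -/
  | var {Δ Γ n A} : Derivable (ctx Δ Γ) → (Γ ++ Δ)[n]? = some A →
      Derivable (tm Δ Γ (var n) (wk (n + 1) A))
  /- judgmental equality -/
  | eq_refl {Δ Γ t A} : Derivable (tm Δ Γ t A) → Derivable (eq Δ Γ t t A)
  | eq_symm {Δ Γ t u A} : Derivable (eq Δ Γ t u A) → Derivable (eq Δ Γ u t A)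
  | eq_trans {Δ Γ t u v A} : Derivable (eq Δ Γ t u A) → Derivable (eq Δ Γ u v A) →
      Derivable (eq Δ Γ t v A)
  | conv {Δ Γ t A B i} : Derivable (tm Δ Γ t A) → Derivable (eq Δ Γ A B (univ i)) →
      Derivable (tm Δ Γ t B)
  | eq_conv {Δ Γ t u A B i} : Derivable (eq Δ Γ t u A) → Derivable (eq Δ Γ A B (univ i)) →
      Derivable (eq Δ Γ t u B)
  /- universes -/
  | univ {Δ Γ i} : Derivable (ctx Δ Γ) → Derivable (tm Δ Γ (univ i) (univ (i + 1)))
  | cumul {Δ Γ A i} : Derivable (tm Δ Γ A (univ i)) → Derivable (tm Δ Γ A (univ (i + 1)))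
  | eq_cumul {Δ Γ A B i} : Derivable (eq Δ Γ A B (univ i)) →
      Derivable (eq Δ Γ A B (univ (i + 1)))
  /- `Π`-types -/
  | pi {Δ Γ A B i} : Derivable (tm Δ Γ A (univ i)) → Derivable (tm Δ (A :: Γ) B (univ i)) →
      Derivable (tm Δ Γ (pi A B) (univ i))
  | pi_congr {Δ Γ A A' B B' i} : Derivable (tm Δ Γ A (univ i)) →
      Derivable (eq Δ Γ A A' (univ i)) → Derivable (eq Δ (A :: Γ) B B' (univ i)) →
      Derivable (eq Δ Γ (pi A B) (pi A' B') (univ i))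
  | lam {Δ Γ A B b i} : Derivable (tm Δ Γ A (univ i)) → Derivable (tm Δ (A :: Γ) b B) →
      Derivable (tm Δ Γ (lam A b) (pi A B))
  | lam_congr {Δ Γ A A' B b b' i} : Derivable (tm Δ Γ A (univ i)) →
      Derivable (eq Δ Γ A A' (univ i)) → Derivable (eq Δ (A :: Γ) b b' B) →
      Derivable (eq Δ Γ (lam A b) (lam A' b') (pi A B))
  | app {Δ Γ A B f a} : Derivable (tm Δ Γ f (pi A B)) → Derivable (tm Δ Γ a A) →
      Derivable (tm Δ Γ (app f a) (inst B a))
  | app_congr {Δ Γ A B f f' a a'} : Derivable (eq Δ Γ f f' (pi A B)) →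
      Derivable (eq Δ Γ a a' A) → Derivable (eq Δ Γ (app f a) (app f' a') (inst B a))
  | pi_beta {Δ Γ A B b a} : Derivable (tm Δ (A :: Γ) b B) → Derivable (tm Δ Γ a A) →
      Derivable (eq Δ Γ (app (lam A b) a) (inst b a) (inst B a))
  | pi_eta {Δ Γ A B f} : Derivable (tm Δ Γ f (pi A B)) →
      Derivable (eq Δ Γ f (lam A (app (wk 1 f) (var 0))) (pi A B))
  /- `Σ`-types -/
  | sig {Δ Γ A B i} : Derivable (tm Δ Γ A (univ i)) → Derivable (tm Δ (A :: Γ) B (univ i)) →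
      Derivable (tm Δ Γ (sig A B) (univ i))
  | sig_congr {Δ Γ A A' B B' i} : Derivable (tm Δ Γ A (univ i)) →
      Derivable (eq Δ Γ A A' (univ i)) → Derivable (eq Δ (A :: Γ) B B' (univ i)) →
      Derivable (eq Δ Γ (sig A B) (sig A' B') (univ i))
  | pair {Δ Γ A B a b i} : Derivable (tm Δ (A :: Γ) B (univ i)) → Derivable (tm Δ Γ a A) →
      Derivable (tm Δ Γ b (inst B a)) → Derivable (tm Δ Γ (pair a b) (sig A B))
  | pair_congr {Δ Γ A B a a' b b' i} : Derivable (tm Δ (A :: Γ) B (univ i)) →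
      Derivable (eq Δ Γ a a' A) → Derivable (eq Δ Γ b b' (inst B a)) →
      Derivable (eq Δ Γ (pair a b) (pair a' b') (sig A B))
  | indSig {Δ Γ A B C g p i} : Derivable (tm Δ (sig A B :: Γ) C (univ i)) →
      Derivable (tm Δ (B :: A :: Γ) g (reinst₂ C (pair (var 1) (var 0)))) →
      Derivable (tm Δ Γ p (sig A B)) → Derivable (tm Δ Γ (indSig C g p) (inst C p))
  | indSig_congr {Δ Γ A B C C' g g' p p' i} :
      Derivable (eq Δ (sig A B :: Γ) C C' (univ i)) →
      Derivable (eq Δ (B :: A :: Γ) g g' (reinst₂ C (pair (var 1) (var 0)))) →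
      Derivable (eq Δ Γ p p' (sig A B)) →
      Derivable (eq Δ Γ (indSig C g p) (indSig C' g' p') (inst C p))
  | sig_beta {Δ Γ A B C g a b i} : Derivable (tm Δ (sig A B :: Γ) C (univ i)) →
      Derivable (tm Δ (B :: A :: Γ) g (reinst₂ C (pair (var 1) (var 0)))) →
      Derivable (tm Δ Γ a A) → Derivable (tm Δ Γ b (inst B a)) →
      Derivable (eq Δ Γ (indSig C g (pair a b)) (inst₂ g a b) (inst C (pair a b)))
  /- the unit type -/
  | unit {Δ Γ i} : Derivable (ctx Δ Γ) → Derivable (tm Δ Γ unit (univ i))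
  | star {Δ Γ} : Derivable (ctx Δ Γ) → Derivable (tm Δ Γ star unit)
  | indUnit {Δ Γ C c t i} : Derivable (tm Δ (unit :: Γ) C (univ i)) →
      Derivable (tm Δ Γ c (inst C star)) → Derivable (tm Δ Γ t unit) →
      Derivable (tm Δ Γ (indUnit C c t) (inst C t))
  | indUnit_congr {Δ Γ C C' c c' t t' i} : Derivable (eq Δ (unit :: Γ) C C' (univ i)) →
      Derivable (eq Δ Γ c c' (inst C star)) → Derivable (eq Δ Γ t t' unit) →
      Derivable (eq Δ Γ (indUnit C c t) (indUnit C' c' t') (inst C t))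
  | unit_beta {Δ Γ C c i} : Derivable (tm Δ (unit :: Γ) C (univ i)) →
      Derivable (tm Δ Γ c (inst C star)) →
      Derivable (eq Δ Γ (indUnit C c star) c (inst C star))
  /- the natural numbers -/
  | nat {Δ Γ i} : Derivable (ctx Δ Γ) → Derivable (tm Δ Γ nat (univ i))
  | zero {Δ Γ} : Derivable (ctx Δ Γ) → Derivable (tm Δ Γ zero nat)
  | succ {Δ Γ n} : Derivable (tm Δ Γ n nat) → Derivable (tm Δ Γ (succ n) nat)
  | succ_congr {Δ Γ n n'} : Derivable (eq Δ Γ n n' nat) →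
      Derivable (eq Δ Γ (succ n) (succ n') nat)
  | indNat {Δ Γ C c₀ cs t i} : Derivable (tm Δ (nat :: Γ) C (univ i)) →
      Derivable (tm Δ Γ c₀ (inst C zero)) →
      Derivable (tm Δ (C :: nat :: Γ) cs (reinst₂ C (succ (var 1)))) →
      Derivable (tm Δ Γ t nat) → Derivable (tm Δ Γ (indNat C c₀ cs t) (inst C t))
  | indNat_congr {Δ Γ C C' c₀ c₀' cs cs' t t' i} :
      Derivable (eq Δ (nat :: Γ) C C' (univ i)) → Derivable (eq Δ Γ c₀ c₀' (inst C zero)) →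
      Derivable (eq Δ (C :: nat :: Γ) cs cs' (reinst₂ C (succ (var 1)))) →
      Derivable (eq Δ Γ t t' nat) →
      Derivable (eq Δ Γ (indNat C c₀ cs t) (indNat C' c₀' cs' t') (inst C t))
  | nat_beta_zero {Δ Γ C c₀ cs i} : Derivable (tm Δ (nat :: Γ) C (univ i)) →
      Derivable (tm Δ Γ c₀ (inst C zero)) →
      Derivable (tm Δ (C :: nat :: Γ) cs (reinst₂ C (succ (var 1)))) →
      Derivable (eq Δ Γ (indNat C c₀ cs zero) c₀ (inst C zero))
  | nat_beta_succ {Δ Γ C c₀ cs t i} : Derivable (tm Δ (nat :: Γ) C (univ i)) →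
      Derivable (tm Δ Γ c₀ (inst C zero)) →
      Derivable (tm Δ (C :: nat :: Γ) cs (reinst₂ C (succ (var 1)))) →
      Derivable (tm Δ Γ t nat) →
      Derivable (eq Δ Γ (indNat C c₀ cs (succ t)) (inst₂ cs t (indNat C c₀ cs t))
        (inst C (succ t)))
  /- identity types -/
  | id {Δ Γ A a b i} : Derivable (tm Δ Γ A (univ i)) → Derivable (tm Δ Γ a A) →
      Derivable (tm Δ Γ b A) → Derivable (tm Δ Γ (id A a b) (univ i))
  | id_congr {Δ Γ A A' a a' b b' i} : Derivable (eq Δ Γ A A' (univ i)) →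
      Derivable (eq Δ Γ a a' A) → Derivable (eq Δ Γ b b' A) →
      Derivable (eq Δ Γ (id A a b) (id A' a' b') (univ i))
  | refl {Δ Γ A a} : Derivable (tm Δ Γ a A) → Derivable (tm Δ Γ (refl a) (id A a a))
  | refl_congr {Δ Γ A a a'} : Derivable (eq Δ Γ a a' A) →
      Derivable (eq Δ Γ (refl a) (refl a') (id A a a))
  | indId {Δ Γ A C a c b p i} : Derivable (tm Δ Γ a A) →
      Derivable (tm Δ (id (wk 1 A) (wk 1 a) (var 0) :: A :: Γ) C (univ i)) →
      Derivable (tm Δ Γ c (inst₂ C a (refl a))) → Derivable (tm Δ Γ b A) →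
      Derivable (tm Δ Γ p (id A a b)) → Derivable (tm Δ Γ (indId C c b p) (inst₂ C b p))
  | indId_congr {Δ Γ A C C' a c c' b b' p p' i} : Derivable (tm Δ Γ a A) →
      Derivable (eq Δ (id (wk 1 A) (wk 1 a) (var 0) :: A :: Γ) C C' (univ i)) →
      Derivable (eq Δ Γ c c' (inst₂ C a (refl a))) → Derivable (eq Δ Γ b b' A) →
      Derivable (eq Δ Γ p p' (id A a b)) →
      Derivable (eq Δ Γ (indId C c b p) (indId C' c' b' p') (inst₂ C b p))
  | id_beta {Δ Γ A C a c i} : Derivable (tm Δ Γ a A) →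
      Derivable (tm Δ (id (wk 1 A) (wk 1 a) (var 0) :: A :: Γ) C (univ i)) →
      Derivable (tm Δ Γ c (inst₂ C a (refl a))) →
      Derivable (eq Δ Γ (indId C c a (refl a)) c (inst₂ C a (refl a)))
  /- the type former `♯`: everything inside `♯ -` and `(-)^♯` may be used as if crisp,
  and `(-)_♯` applies to crisp terms -/
  | sharp {Δ Γ A i} : Derivable (ctx Δ Γ) → Derivable (tm (Γ ++ Δ) [] A (univ i)) →
      Derivable (tm Δ Γ (sharp A) (univ i))
  | sharp_congr {Δ Γ A A' i} : Derivable (ctx Δ Γ) →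
      Derivable (eq (Γ ++ Δ) [] A A' (univ i)) →
      Derivable (eq Δ Γ (sharp A) (sharp A') (univ i))
  | sharpIn {Δ Γ A a} : Derivable (ctx Δ Γ) → Derivable (tm (Γ ++ Δ) [] a A) →
      Derivable (tm Δ Γ (sharpIn a) (sharp A))
  | sharpIn_congr {Δ Γ A a a'} : Derivable (ctx Δ Γ) →
      Derivable (eq (Γ ++ Δ) [] a a' A) →
      Derivable (eq Δ Γ (sharpIn a) (sharpIn a') (sharp A))
  | sharpOut {Δ Γ A a} : Derivable (ctx Δ Γ) → Derivable (tm Δ [] a (sharp A)) →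
      Derivable (tm Δ Γ (sharpOut (wk Γ.length a)) (wk Γ.length A))
  | sharpOut_congr {Δ Γ A a a'} : Derivable (ctx Δ Γ) →
      Derivable (eq Δ [] a a' (sharp A)) →
      Derivable (eq Δ Γ (sharpOut (wk Γ.length a)) (sharpOut (wk Γ.length a'))
        (wk Γ.length A))
  | sharp_beta {Δ Γ A a} : Derivable (ctx Δ Γ) → Derivable (tm Δ [] a A) →
      Derivable (eq Δ Γ (sharpOut (sharpIn (wk Γ.length a))) (wk Γ.length a)
        (wk Γ.length A))
  | sharp_eta {Δ Γ A a} : Derivable (tm Δ Γ a (sharp A)) →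
      Derivable (eq Δ Γ (sharpIn (sharpOut a)) a (sharp A))
  /- function extensionality -/
  | funext {Δ Γ i} : Derivable (ctx Δ Γ) → Derivable (tm Δ Γ (funext i) (funextType i))

/-- The closed type `T` is inhabited: there is a closed term of type `T`. -/
def Inhabited (T : Tm) : Prop := ∃ t : Tm, Derivable (tm [] [] t T)

/-! ### The statements about `♯`, as types of the theory -/

namespace Tm

/-- For `p : x =_A y`, the term `ap_{(-)^♯} p : x^♯ =_{♯A} y^♯`, by path induction. -/
def apSharpIn (A x y p : Tm) : Tm :=
  indId (id (sharp (wk 2 A)) (sharpIn (wk 2 x)) (sharpIn (var 1))) (refl (sharpIn x)) y p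

/-- For `f : A → B`, the map `♯f : ♯A → ♯B`, `♯f (u) := f(u_♯)^♯`. -/
def sharpMap (A f : Tm) : Tm :=
  lam (sharp A) (sharpIn (app (wk 1 f) (sharpOut (var 0))))

/-- For `f : A → C` and `g : B → C`, the pullback
`A ×_C B := Σ (x : A) (y : B), f x = g y`. -/
def pullback (A B C f g : Tm) : Tm :=
  sig A (sig (wk 1 B) (id (wk 2 C) (app (wk 2 f) (var 1)) (app (wk 2 g) (var 0))))

/-- For closed `O : 𝒰ᵢ → 𝒰ᵢ` and `η : Π (A : 𝒰ᵢ), A → O A`, the type expressing that they form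
a (monadic) modality: there are

* for all `A : 𝒰ᵢ` and `B : O A → 𝒰ᵢ`, a function
  `ind : (Π (a : A), O (B (η a))) → Π (z : O A), O (B z)` with `ind f (η a) = f a`,
* for all `A : 𝒰ᵢ` and `z z' : O A`, a proof that `η : (z = z') → O (z = z')` is an
  equivalence. -/
def isModality (i : ℕ) (O η : Tm) : Tm :=
  prod
    (pi (univ i) <| pi (arrow (app O (var 0)) (univ i)) <|
      -- context: `A` is 1, `B` is 0
      sig
        (arrow
          (pi (var 1) (app O (app (var 1) (app (app η (var 2)) (var 0)))))
          (pi (app O (var 1)) (app O (app (var 1) (var 0)))))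
        -- context: `A` is 2, `B` is 1, `ind` is 0
        (pi (pi (var 2) (app O (app (var 2) (app (app η (var 3)) (var 0))))) <|
          pi (var 3) <|
          -- context: `A` is 4, `B` is 3, `ind` is 2, `f` is 1, `a` is 0
          id (app O (app (var 3) (app (app η (var 4)) (var 0))))
            (app (app (var 2) (var 1)) (app (app η (var 4)) (var 0)))
            (app (var 1) (var 0))))
    (pi (univ i) <| pi (app O (var 0)) <| pi (app O (var 1)) <|
      -- context: `A` is 2, `z` is 1, `z'` is 0
      isEquiv
        (id (app O (var 2)) (var 1) (var 0))
        (app O (id (app O (var 2)) (var 1) (var 0)))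
        (app η (id (app O (var 2)) (var 1) (var 0))))

/-- The operation `♯ : 𝒰ᵢ → 𝒰ᵢ`. -/
def sharpOp (i : ℕ) : Tm := lam (univ i) (sharp (var 0))

/-- The maps `(-)^♯ : A → ♯A`, for all `A : 𝒰ᵢ`. -/
def sharpUnit (i : ℕ) : Tm := lam (univ i) (lam (var 0) (sharpIn (var 0)))

/-- For all `A : 𝒰ᵢ` and `x y : A`, there is `e : (x^♯ = y^♯) → ♯(x = y)` that is an equivalence
and satisfies `e (ap_{(-)^♯} p) = p^♯` for all `p : x = y`. -/
def pathSharp (i : ℕ) : Tm :=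
  pi (univ i) <| pi (var 0) <| pi (var 1) <|
    -- context: `A` is 2, `x` is 1, `y` is 0
    sig
      (arrow (id (sharp (var 2)) (sharpIn (var 1)) (sharpIn (var 0)))
        (sharp (id (var 2) (var 1) (var 0)))) <|
      -- context: `A` is 3, `x` is 2, `y` is 1, `e` is 0
      prod
        (isEquiv (id (sharp (var 3)) (sharpIn (var 2)) (sharpIn (var 1)))
          (sharp (id (var 3) (var 2) (var 1))) (var 0))
        (pi (id (var 3) (var 2) (var 1)) <|
          -- context: `A` is 4, `x` is 3, `y` is 2, `e` is 1, `p` is 0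
          id (sharp (id (var 4) (var 3) (var 2)))
            (app (var 1) (apSharpIn (var 4) (var 3) (var 2) (var 0)))
            (sharpIn (var 0)))

/-- For all `A B C : 𝒰ᵢ`, `f : A → C` and `g : B → C`, there is a map
`c : ♯(A ×_C B) → ♯A ×_{♯C} ♯B`, the pullback on the right being that of `♯f` and `♯g`, which is
the comparison map, i.e. `c ((a, b, p)^♯) = (a^♯, b^♯, ap_{(-)^♯} p)` for all `a : A`, `b : B` and
`p : f a = g b`, and which is an equivalence.  (Maps out of `♯(A ×_C B)` into this codiscrete type
are determined by their composites with `(-)^♯`.) -/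
def sharpPullback (i : ℕ) : Tm :=
  pi (univ i) <| pi (univ i) <| pi (univ i) <|
  pi (arrow (var 2) (var 0)) <| pi (arrow (var 2) (var 1)) <|
    -- context: `A` is 4, `B` is 3, `C` is 2, `f` is 1, `g` is 0
    sig
      (arrow (sharp (pullback (var 4) (var 3) (var 2) (var 1) (var 0)))
        (pullback (sharp (var 4)) (sharp (var 3)) (sharp (var 2))
          (sharpMap (var 4) (var 1)) (sharpMap (var 3) (var 0)))) <|
      -- context: `A` is 5, `B` is 4, `C` is 3, `f` is 2, `g` is 1, `c` is 0
      prod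
        (pi (var 5) <| pi (var 5) <| pi (id (var 5) (app (var 4) (var 1)) (app (var 3) (var 0))) <|
          -- context: `A` is 8, `B` is 7, `C` is 6, `f` is 5, `g` is 4, `c` is 3,
          -- `a` is 2, `b` is 1, `p` is 0
          id
            (pullback (sharp (var 8)) (sharp (var 7)) (sharp (var 6))
              (sharpMap (var 8) (var 5)) (sharpMap (var 7) (var 4)))
            (app (var 3) (sharpIn (pair (var 2) (pair (var 1) (var 0)))))
            (pair (sharpIn (var 2)) (pair (sharpIn (var 1))
              (apSharpIn (var 6) (app (var 5) (var 2)) (app (var 4) (var 1)) (var 0)))))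
        (isEquiv
          (sharp (pullback (var 5) (var 4) (var 3) (var 2) (var 1)))
          (pullback (sharp (var 5)) (sharp (var 4)) (sharp (var 3))
            (sharpMap (var 5) (var 2)) (sharpMap (var 4) (var 1)))
          (var 0))

/-- For `n : ℕ` and `A : 𝒰ᵢ`, the type expressing that `A` is an `(n - 2)`-type, defined by
recursion on `n`: contractible for `n = 0`, and all `x =_A y` are `(n - 2)`-types for `n + 1`. -/
def isTruncated (i : ℕ) (n A : Tm) : Tm :=
  app
    (indNat (arrow (univ i) (univ i))
      (lam (univ i) (isContr (var 0)))
      -- in the successor case, the recursively defined family is the variable 0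
      (lam (univ i) <| pi (var 0) <| pi (var 1) <|
        app (var 3) (id (var 2) (var 1) (var 0)))
      n)
    A

/-- For all `n : ℕ` and `A : 𝒰ᵢ`, if `A` is an `(n - 2)`-type then so is `♯A`. -/
def sharpTruncated (i : ℕ) : Tm :=
  pi nat <| pi (univ i) <|
    arrow (isTruncated i (var 1) (var 0)) (isTruncated i (var 1) (sharp (var 0)))

end Tm

end SpatialTT

/-! The heart of the matter is that identity types of codiscrete types are `♯`-stable: for `X : ♯𝒰`
and `z z' : ♯(X_♯)` there is a map `r : ♯(z = z') → (z = z')` with `r (p^♯) = p` (the proof of this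
equation is called `ρ`). Consider the two functions of `y : ♯(X_♯)` and `p : z = y` with values `z`
and `y`. They agree pointwise, so they are equal by function extensionality. Since a function `F` of
this kind takes values in a `♯`, it can be evaluated at `z'` and at `u : ♯(z = z')` in the form `((F
z' u_♯)_♯)^♯`: under `(-)^♯` every variable counts as crisp. The equality of the two functions then
becomes `z = z'`, because `♯` has a judgmental `η`. Composition with the inverse of the value at
`refl^♯` makes `refl^♯` go to `refl`, and path induction gives `r (p^♯) = p` (`weakStable`,
`stable`, `stableRefl`).

All four statements follow from `r` and `ρ`. To prove an equation in a type `♯A` it is enough to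
prove it under `♯`, where an element `w : ♯P` may be replaced by `(w_♯)^♯`. Dependent elimination is
`z ↦ ((f z_♯)_♯)^♯`, which computes judgmentally, and `r` inverts `(-)^♯` on paths. Path induction
gives `enc : (z = z') → ♯(z_♯ = z'_♯)`, with inverse `dec u := r ((ap u_♯)^♯)`. Pullbacks are
compared componentwise, with `enc` and `dec` on the path component. For `n`-types one inducts on
`n`: `z = z'` is a retract of `♯(z_♯ = z'_♯)`, and retracts inherit truncatedness, so univalence is
not used. The lemmas range over `X : ♯𝒰` rather than over `𝒰` because a type such as `z_♯ = z'_♯`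
with cohesive `z`, `z'` makes sense only under `♯`.

Derivations are obtained by writing these proofs as raw terms and evaluating a type checker on them.
Only its soundness is needed (`engine_sound`); normalization, confluence and injectivity of type
formers play no role, because the checker retypes whatever it contracts. Soundness rests on the
metatheory: stability under renaming and substitution (`SubstClass.preserved`), functionality
(`Derivable.functional`) and presuppositions (`Derivable.presupposition`). The terms are checked for
`𝒰₀` only; raising all levels preserves derivability (`Derivable.raise`) and gives every other
universe. -/

namespace SpatialTT

namespace Tm

/-! ### Renaming and substitution -/

theorem liftRen_id : liftRen (fun n => n) = fun n => n := by
  funext n; cases n <;> rfl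

theorem liftRen_comp (ρ ρ' : ℕ → ℕ) :
    (fun n => liftRen ρ' (liftRen ρ n)) = liftRen fun n => ρ' (ρ n) := by
  funext n; cases n <;> rfl

theorem rename_id (t : Tm) : rename (fun n => n) t = t := by
  induction t <;> simp [rename, liftRen_id, *]

theorem rename_rename (t : Tm) (ρ ρ' : ℕ → ℕ) :
    rename ρ' (rename ρ t) = rename (fun n => ρ' (ρ n)) t := by
  induction t generalizing ρ ρ' <;> simp [rename, ← liftRen_comp, *]

theorem liftSub_var (ρ : ℕ → ℕ) : liftSub (fun n => var (ρ n)) = fun n => var (liftRen ρ n) := by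
  funext n; cases n <;> rfl

theorem subst_var (t : Tm) (ρ : ℕ → ℕ) : subst (fun n => var (ρ n)) t = rename ρ t := by
  induction t generalizing ρ <;> simp [rename, subst, liftSub_var, *]

theorem subst_id (t : Tm) : subst var t = t := by
  rw [show var = fun n => var ((fun n => n) n) from rfl, subst_var, rename_id]

theorem liftSub_comp_ren (σ : ℕ → Tm) (ρ : ℕ → ℕ) :
    (fun n => liftSub σ (liftRen ρ n)) = liftSub fun n => σ (ρ n) := by
  funext n; cases n <;> rfl

theorem subst_rename (t : Tm) (σ : ℕ → Tm) (ρ : ℕ → ℕ) :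
    subst σ (rename ρ t) = subst (fun n => σ (ρ n)) t := by
  induction t generalizing σ ρ <;> simp [rename, subst, ← liftSub_comp_ren, *]

theorem ren_comp_liftSub (σ : ℕ → Tm) (ρ : ℕ → ℕ) :
    (fun n => rename (liftRen ρ) (liftSub σ n)) = liftSub fun n => rename ρ (σ n) := by
  funext n
  cases n with
  | zero => rfl
  | succ n => simp [liftSub, wk, rename_rename, liftRen]

theorem rename_subst (t : Tm) (σ : ℕ → Tm) (ρ : ℕ → ℕ) :
    rename ρ (subst σ t) = subst (fun n => rename ρ (σ n)) t := by
  induction t generalizing σ ρ <;> simp [rename, subst, ← ren_comp_liftSub, *]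

theorem sub_comp_liftSub (σ τ : ℕ → Tm) :
    (fun n => subst (liftSub τ) (liftSub σ n)) = liftSub fun n => subst τ (σ n) := by
  funext n
  cases n with
  | zero => rfl
  | succ n => simp [liftSub, wk, subst_rename, rename_subst]

theorem subst_subst (t : Tm) (σ τ : ℕ → Tm) :
    subst τ (subst σ t) = subst (fun n => subst τ (σ n)) t := by
  induction t generalizing σ τ <;> simp [subst, ← sub_comp_liftSub, *]

theorem wk_zero (t : Tm) : wk 0 t = t := rename_id t

theorem wk_wk (k l : ℕ) (t : Tm) : wk k (wk l t) = wk (l + k) t := by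
  simp [wk, rename_rename, Nat.add_assoc]

theorem rename_sub_wk (k : ℕ) (t : Tm) : rename (fun n => n - k) (wk k t) = t := by
  simp [wk, rename_rename, rename_id]

/-- Truncated subtraction undoes weakening. Injectivity allows an equation between weakened types to
be cancelled back to the crisp zone. -/
theorem wk_injective (k : ℕ) : Function.Injective (wk k) :=
  Function.LeftInverse.injective (rename_sub_wk k)

theorem subst_wk (σ : ℕ → Tm) (k : ℕ) (t : Tm) :
    subst σ (wk k t) = subst (fun n => σ (n + k)) t := subst_rename _ _ _

theorem wk_subst (σ : ℕ → Tm) (k : ℕ) (t : Tm) :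
    wk k (subst σ t) = subst (fun n => wk k (σ n)) t := rename_subst _ _ _

theorem wk_eq_subst (k : ℕ) (t : Tm) : wk k t = subst (fun n => var (n + k)) t :=
  (subst_var _ _).symm

theorem subst_liftSub_wk (σ : ℕ → Tm) (t : Tm) :
    subst (liftSub σ) (wk 1 t) = wk 1 (subst σ t) := by
  rw [subst_wk, wk_subst]; rfl

theorem subst_inst (σ : ℕ → Tm) (B a : Tm) :
    subst σ (inst B a) = inst (subst (liftSub σ) B) (subst σ a) := by
  simp only [inst, subst_subst]
  congr 1; funext n
  cases n with
  | zero => rfl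
  | succ n => exact ((subst_wk _ _ _).trans (subst_id _)).symm

theorem subst_inst₂ (σ : ℕ → Tm) (C a b : Tm) :
    subst σ (inst₂ C a b) =
      inst₂ (subst (liftSub (liftSub σ)) C) (subst σ a) (subst σ b) := by
  simp only [inst₂, subst_subst]
  congr 1; funext n
  match n with
  | 0 => rfl
  | 1 => rfl
  | n + 2 =>
    simp only [double, liftSub, wk_wk, subst_wk]
    exact (subst_id _).symm

theorem subst_reinst₂ (σ : ℕ → Tm) (C c : Tm) :
    subst (liftSub (liftSub σ)) (reinst₂ C c) =
      reinst₂ (subst (liftSub σ) C) (subst (liftSub (liftSub σ)) c) := by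
  simp only [reinst₂, subst_subst]
  congr 1; funext n
  cases n with
  | zero => rfl
  | succ n =>
    simp only [liftSub, wk_wk, subst_wk, subst]
    exact wk_eq_subst _ _

theorem inst_wk (t a : Tm) : inst (wk 1 t) a = t := by
  rw [inst, subst_wk]; exact subst_id t

end Tm

open Tm Judgment

/-! ### Substitutions between contexts -/

/-- A class of substitutions `σ : (Δ' ∣ Γ') → (Δ ∣ Γ)` that is stable under the operations
on contexts in the rules. -/
structure SubstClass (S : (ℕ → Tm) → List Tm → List Tm → List Tm → List Tm → Prop) : Prop where
  ctx {σ Δ Γ Δ' Γ'} : S σ Δ Γ Δ' Γ' → Derivable (ctx Δ' Γ')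
  var {σ Δ Γ Δ' Γ' n A} : S σ Δ Γ Δ' Γ' → (Γ ++ Δ)[n]? = some A →
    Derivable (tm Δ' Γ' (σ n) (subst σ (wk (n + 1) A)))
  -- The hypothesis on `A` ranges over all targets of `σ`: for renamings, `A` must remain a type
  -- when a part of `Γ'` becomes crisp.
  lift {σ Δ Γ Δ' Γ' A i} :
    (∀ Δ' Γ', S σ Δ Γ Δ' Γ' → Derivable (tm Δ' Γ' (subst σ A) (univ i))) →
    S σ Δ Γ Δ' Γ' → S (liftSub σ) Δ (A :: Γ) Δ' (subst σ A :: Γ')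
  -- This serves the rules of `♯ A` and `a^♯`, whose premises live over `Γ ++ Δ ∣ ·`.
  crisp {σ Δ Γ Δ' Γ'} : S σ Δ Γ Δ' Γ' → S σ (Γ ++ Δ) [] (Γ' ++ Δ') []
  -- This serves the rules of `a_♯`, whose subject is weakened from `Δ ∣ ·`: there `σ` acts only
  -- through its crisp part `τ`.
  core {σ Δ Γ Δ' Γ'} : S σ Δ Γ Δ' Γ' →
    ∃ τ, S τ Δ [] Δ' [] ∧ ∀ n, σ (n + Γ.length) = wk Γ'.length (τ n)

/-- The types in the cohesive zone of a context are preserved by the class `S`. -/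
def CtxPreserved (S : (ℕ → Tm) → List Tm → List Tm → List Tm → List Tm → Prop) (Δ : List Tm) :
    List Tm → Prop
  | [] => True
  | A :: Γ => CtxPreserved S Δ Γ ∧ ∃ i, ∀ σ Δ' Γ', S σ Δ Γ Δ' Γ' →
      Derivable (tm Δ' Γ' (subst σ A) (univ i))

/-- The context is included because some rules, such as `pi_beta`, go under a binder without a
premise saying that its type is a type. Only the cohesive zone matters, since binders never extend
the crisp zone. -/
def Preserved (S : (ℕ → Tm) → List Tm → List Tm → List Tm → List Tm → Prop) : Judgment → Prop
  | ctx Δ Γ => CtxPreserved S Δ Γ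
  | tm Δ Γ t A => CtxPreserved S Δ Γ ∧ ∀ σ Δ' Γ', S σ Δ Γ Δ' Γ' →
      Derivable (tm Δ' Γ' (subst σ t) (subst σ A))
  | eq Δ Γ t u A => CtxPreserved S Δ Γ ∧ ∀ σ Δ' Γ', S σ Δ Γ Δ' Γ' →
      Derivable (eq Δ' Γ' (subst σ t) (subst σ u) (subst σ A))

section

variable {S : (ℕ → Tm) → List Tm → List Tm → List Tm → List Tm → Prop}

theorem SubstClass.lift_preserved (hS : SubstClass S) {σ Δ Γ Δ' Γ' A}
    (h : CtxPreserved S Δ (A :: Γ)) (hσ : S σ Δ Γ Δ' Γ') :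
    S (liftSub σ) Δ (A :: Γ) Δ' (subst σ A :: Γ') :=
  let ⟨_, hA⟩ := h.2
  hS.lift (hA σ) hσ

theorem SubstClass.lift_ty (hS : SubstClass S) {σ Δ Γ Δ' Γ' A i}
    (h : Preserved S (tm Δ Γ A (univ i))) (hσ : S σ Δ Γ Δ' Γ') :
    S (liftSub σ) Δ (A :: Γ) Δ' (subst σ A :: Γ') :=
  hS.lift (h.2 σ) hσ

theorem SubstClass.exists_core (hS : SubstClass S) {σ Δ Γ Δ' Γ'} (hσ : S σ Δ Γ Δ' Γ') :
    ∃ τ, S τ Δ [] Δ' [] ∧ ∀ t, subst σ (wk Γ.length t) = wk Γ'.length (subst τ t) := by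
  obtain ⟨τ, hτ, h⟩ := hS.core hσ
  refine ⟨τ, hτ, fun t => ?_⟩
  rw [subst_wk, wk_subst]
  simp only [h]

/-- A single induction over the rules serves twice: first for renamings, which yields weakening, and
then for substitutions, whose lifting under binders uses weakening. -/
theorem SubstClass.preserved (hS : SubstClass S) {J : Judgment} (h : Derivable J) :
    Preserved S J := by
  induction h with
  | ctx_nil => trivial
  | ctx_crisp _ _ => trivial
  | ctx_cohesive _ ih => exact ⟨ih.1, _, ih.2⟩
  | var _ hn ih => exact ⟨ih, fun _ _ _ hσ => hS.var hσ hn⟩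
  | eq_refl _ ih => exact ⟨ih.1, fun _ _ _ hσ => .eq_refl (ih.2 _ _ _ hσ)⟩
  | eq_symm _ ih => exact ⟨ih.1, fun _ _ _ hσ => .eq_symm (ih.2 _ _ _ hσ)⟩
  | eq_trans _ _ ih₁ ih₂ =>
    exact ⟨ih₁.1, fun _ _ _ hσ => .eq_trans (ih₁.2 _ _ _ hσ) (ih₂.2 _ _ _ hσ)⟩
  | conv _ _ ih₁ ih₂ => exact ⟨ih₁.1, fun _ _ _ hσ => .conv (ih₁.2 _ _ _ hσ) (ih₂.2 _ _ _ hσ)⟩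
  | eq_conv _ _ ih₁ ih₂ =>
    exact ⟨ih₁.1, fun _ _ _ hσ => .eq_conv (ih₁.2 _ _ _ hσ) (ih₂.2 _ _ _ hσ)⟩
  | univ _ ih => exact ⟨ih, fun _ _ _ hσ => .univ (hS.ctx hσ)⟩
  | cumul _ ih => exact ⟨ih.1, fun _ _ _ hσ => .cumul (ih.2 _ _ _ hσ)⟩
  | eq_cumul _ ih => exact ⟨ih.1, fun _ _ _ hσ => .eq_cumul (ih.2 _ _ _ hσ)⟩
  | pi _ _ ih₁ ih₂ =>
    exact ⟨ih₁.1, fun _ _ _ hσ => .pi (ih₁.2 _ _ _ hσ) (ih₂.2 _ _ _ (hS.lift_ty ih₁ hσ))⟩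
  | pi_congr _ _ _ ih₁ ih₂ ih₃ =>
    exact ⟨ih₁.1, fun _ _ _ hσ =>
      .pi_congr (ih₁.2 _ _ _ hσ) (ih₂.2 _ _ _ hσ) (ih₃.2 _ _ _ (hS.lift_ty ih₁ hσ))⟩
  | lam _ _ ih₁ ih₂ =>
    exact ⟨ih₁.1, fun _ _ _ hσ => .lam (ih₁.2 _ _ _ hσ) (ih₂.2 _ _ _ (hS.lift_ty ih₁ hσ))⟩
  | lam_congr _ _ _ ih₁ ih₂ ih₃ =>
    exact ⟨ih₁.1, fun _ _ _ hσ =>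
      .lam_congr (ih₁.2 _ _ _ hσ) (ih₂.2 _ _ _ hσ) (ih₃.2 _ _ _ (hS.lift_ty ih₁ hσ))⟩
  | app _ _ ih₁ ih₂ =>
    refine ⟨ih₁.1, fun _ _ _ hσ => ?_⟩
    rw [subst_inst]
    exact .app (ih₁.2 _ _ _ hσ) (ih₂.2 _ _ _ hσ)
  | app_congr _ _ ih₁ ih₂ =>
    refine ⟨ih₁.1, fun _ _ _ hσ => ?_⟩
    rw [subst_inst]
    exact .app_congr (ih₁.2 _ _ _ hσ) (ih₂.2 _ _ _ hσ)
  | pi_beta _ _ ih₁ ih₂ =>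
    refine ⟨ih₂.1, fun _ _ _ hσ => ?_⟩
    rw [subst_inst, subst_inst]
    exact .pi_beta (ih₁.2 _ _ _ (hS.lift_preserved ih₁.1 hσ)) (ih₂.2 _ _ _ hσ)
  | @pi_eta Δ Γ A B f _ ih =>
    refine ⟨ih.1, fun σ _ _ hσ => ?_⟩
    have h := Derivable.pi_eta (ih.2 _ _ _ hσ)
    rwa [← subst_liftSub_wk] at h
  | sig _ _ ih₁ ih₂ =>
    exact ⟨ih₁.1, fun _ _ _ hσ => .sig (ih₁.2 _ _ _ hσ) (ih₂.2 _ _ _ (hS.lift_ty ih₁ hσ))⟩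
  | sig_congr _ _ _ ih₁ ih₂ ih₃ =>
    exact ⟨ih₁.1, fun _ _ _ hσ =>
      .sig_congr (ih₁.2 _ _ _ hσ) (ih₂.2 _ _ _ hσ) (ih₃.2 _ _ _ (hS.lift_ty ih₁ hσ))⟩
  | pair _ _ _ ih₁ ih₂ ih₃ =>
    refine ⟨ih₂.1, fun _ _ _ hσ =>
      .pair (ih₁.2 _ _ _ (hS.lift_preserved ih₁.1 hσ)) (ih₂.2 _ _ _ hσ) ?_⟩
    rw [← subst_inst]
    exact ih₃.2 _ _ _ hσ
  | pair_congr _ _ _ ih₁ ih₂ ih₃ =>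
    refine ⟨ih₂.1, fun _ _ _ hσ =>
      .pair_congr (ih₁.2 _ _ _ (hS.lift_preserved ih₁.1 hσ)) (ih₂.2 _ _ _ hσ) ?_⟩
    rw [← subst_inst]
    exact ih₃.2 _ _ _ hσ
  | indSig _ _ _ ih₁ ih₂ ih₃ =>
    refine ⟨ih₃.1, fun _ _ _ hσ => ?_⟩
    rw [subst_inst]
    refine .indSig (ih₁.2 _ _ _ (hS.lift_preserved ih₁.1 hσ)) ?_ (ih₃.2 _ _ _ hσ)
    have h := ih₂.2 _ _ _ (hS.lift_preserved ih₂.1 (hS.lift_preserved ih₂.1.1 hσ))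
    rwa [subst_reinst₂] at h
  | indSig_congr _ _ _ ih₁ ih₂ ih₃ =>
    refine ⟨ih₃.1, fun _ _ _ hσ => ?_⟩
    rw [subst_inst]
    refine .indSig_congr (ih₁.2 _ _ _ (hS.lift_preserved ih₁.1 hσ)) ?_ (ih₃.2 _ _ _ hσ)
    have h := ih₂.2 _ _ _ (hS.lift_preserved ih₂.1 (hS.lift_preserved ih₂.1.1 hσ))
    rwa [subst_reinst₂] at h
  | sig_beta _ _ _ _ ih₁ ih₂ ih₃ ih₄ =>
    refine ⟨ih₃.1, fun _ _ _ hσ => ?_⟩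
    rw [subst_inst, subst_inst₂]
    refine .sig_beta (ih₁.2 _ _ _ (hS.lift_preserved ih₁.1 hσ)) ?_ (ih₃.2 _ _ _ hσ) ?_
    · have h := ih₂.2 _ _ _ (hS.lift_preserved ih₂.1 (hS.lift_preserved ih₂.1.1 hσ))
      rwa [subst_reinst₂] at h
    · rw [← subst_inst]
      exact ih₄.2 _ _ _ hσ
  | unit _ ih => exact ⟨ih, fun _ _ _ hσ => .unit (hS.ctx hσ)⟩
  | star _ ih => exact ⟨ih, fun _ _ _ hσ => .star (hS.ctx hσ)⟩
  | indUnit _ _ _ ih₁ ih₂ ih₃ =>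
    refine ⟨ih₃.1, fun _ _ _ hσ => ?_⟩
    have h := ih₂.2 _ _ _ hσ
    rw [subst_inst] at h ⊢
    exact .indUnit (ih₁.2 _ _ _ (hS.lift_preserved ih₁.1 hσ)) h (ih₃.2 _ _ _ hσ)
  | indUnit_congr _ _ _ ih₁ ih₂ ih₃ =>
    refine ⟨ih₃.1, fun _ _ _ hσ => ?_⟩
    have h := ih₂.2 _ _ _ hσ
    rw [subst_inst] at h ⊢
    exact .indUnit_congr (ih₁.2 _ _ _ (hS.lift_preserved ih₁.1 hσ)) h (ih₃.2 _ _ _ hσ)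
  | unit_beta _ _ ih₁ ih₂ =>
    refine ⟨ih₂.1, fun _ _ _ hσ => ?_⟩
    have h := ih₂.2 _ _ _ hσ
    rw [subst_inst] at h ⊢
    exact .unit_beta (ih₁.2 _ _ _ (hS.lift_preserved ih₁.1 hσ)) h
  | nat _ ih => exact ⟨ih, fun _ _ _ hσ => .nat (hS.ctx hσ)⟩
  | zero _ ih => exact ⟨ih, fun _ _ _ hσ => .zero (hS.ctx hσ)⟩
  | succ _ ih => exact ⟨ih.1, fun _ _ _ hσ => .succ (ih.2 _ _ _ hσ)⟩
  | succ_congr _ ih => exact ⟨ih.1, fun _ _ _ hσ => .succ_congr (ih.2 _ _ _ hσ)⟩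
  | indNat _ _ _ _ ih₁ ih₂ ih₃ ih₄ =>
    refine ⟨ih₄.1, fun _ _ _ hσ => ?_⟩
    have h := ih₂.2 _ _ _ hσ
    have h' := ih₃.2 _ _ _ (hS.lift_preserved ih₃.1 (hS.lift_preserved ih₁.1 hσ))
    rw [subst_inst] at h ⊢
    rw [subst_reinst₂] at h'
    exact .indNat (ih₁.2 _ _ _ (hS.lift_preserved ih₁.1 hσ)) h h' (ih₄.2 _ _ _ hσ)
  | indNat_congr _ _ _ _ ih₁ ih₂ ih₃ ih₄ =>
    refine ⟨ih₄.1, fun _ _ _ hσ => ?_⟩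
    have h := ih₂.2 _ _ _ hσ
    have h' := ih₃.2 _ _ _ (hS.lift_preserved ih₃.1 (hS.lift_preserved ih₁.1 hσ))
    rw [subst_inst] at h ⊢
    rw [subst_reinst₂] at h'
    exact .indNat_congr (ih₁.2 _ _ _ (hS.lift_preserved ih₁.1 hσ)) h h' (ih₄.2 _ _ _ hσ)
  | nat_beta_zero _ _ _ ih₁ ih₂ ih₃ =>
    refine ⟨ih₂.1, fun _ _ _ hσ => ?_⟩
    have h := ih₂.2 _ _ _ hσ
    have h' := ih₃.2 _ _ _ (hS.lift_preserved ih₃.1 (hS.lift_preserved ih₁.1 hσ))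
    rw [subst_inst] at h ⊢
    rw [subst_reinst₂] at h'
    exact .nat_beta_zero (ih₁.2 _ _ _ (hS.lift_preserved ih₁.1 hσ)) h h'
  | nat_beta_succ _ _ _ _ ih₁ ih₂ ih₃ ih₄ =>
    refine ⟨ih₄.1, fun _ _ _ hσ => ?_⟩
    have h := ih₂.2 _ _ _ hσ
    have h' := ih₃.2 _ _ _ (hS.lift_preserved ih₃.1 (hS.lift_preserved ih₁.1 hσ))
    rw [subst_inst] at h
    rw [subst_inst, subst_inst₂]
    rw [subst_reinst₂] at h'
    exact .nat_beta_succ (ih₁.2 _ _ _ (hS.lift_preserved ih₁.1 hσ)) h h' (ih₄.2 _ _ _ hσ)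
  | id _ _ _ ih₁ ih₂ ih₃ =>
    exact ⟨ih₁.1, fun _ _ _ hσ => .id (ih₁.2 _ _ _ hσ) (ih₂.2 _ _ _ hσ) (ih₃.2 _ _ _ hσ)⟩
  | id_congr _ _ _ ih₁ ih₂ ih₃ =>
    exact ⟨ih₁.1, fun _ _ _ hσ =>
      .id_congr (ih₁.2 _ _ _ hσ) (ih₂.2 _ _ _ hσ) (ih₃.2 _ _ _ hσ)⟩
  | refl _ ih => exact ⟨ih.1, fun _ _ _ hσ => .refl (ih.2 _ _ _ hσ)⟩
  | refl_congr _ ih => exact ⟨ih.1, fun _ _ _ hσ => .refl_congr (ih.2 _ _ _ hσ)⟩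
  | indId _ _ _ _ _ ih₁ ih₂ ih₃ ih₄ ih₅ =>
    refine ⟨ih₁.1, fun _ _ _ hσ => ?_⟩
    have h := ih₂.2 _ _ _ (hS.lift_preserved ih₂.1 (hS.lift_preserved ih₂.1.1 hσ))
    have h' := ih₃.2 _ _ _ hσ
    simp only [subst, subst_liftSub_wk] at h
    rw [subst_inst₂] at h' ⊢
    exact .indId (ih₁.2 _ _ _ hσ) h h' (ih₄.2 _ _ _ hσ) (ih₅.2 _ _ _ hσ)
  | indId_congr _ _ _ _ _ ih₁ ih₂ ih₃ ih₄ ih₅ =>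
    refine ⟨ih₁.1, fun _ _ _ hσ => ?_⟩
    have h := ih₂.2 _ _ _ (hS.lift_preserved ih₂.1 (hS.lift_preserved ih₂.1.1 hσ))
    have h' := ih₃.2 _ _ _ hσ
    simp only [subst, subst_liftSub_wk] at h
    rw [subst_inst₂] at h' ⊢
    exact .indId_congr (ih₁.2 _ _ _ hσ) h h' (ih₄.2 _ _ _ hσ) (ih₅.2 _ _ _ hσ)
  | id_beta _ _ _ ih₁ ih₂ ih₃ =>
    refine ⟨ih₁.1, fun _ _ _ hσ => ?_⟩
    have h := ih₂.2 _ _ _ (hS.lift_preserved ih₂.1 (hS.lift_preserved ih₂.1.1 hσ))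
    have h' := ih₃.2 _ _ _ hσ
    simp only [subst, subst_liftSub_wk] at h
    rw [subst_inst₂] at h' ⊢
    exact .id_beta (ih₁.2 _ _ _ hσ) h h'
  | sharp _ _ ih₁ ih₂ =>
    exact ⟨ih₁, fun _ _ _ hσ => .sharp (hS.ctx hσ) (ih₂.2 _ _ _ (hS.crisp hσ))⟩
  | sharp_congr _ _ ih₁ ih₂ =>
    exact ⟨ih₁, fun _ _ _ hσ => .sharp_congr (hS.ctx hσ) (ih₂.2 _ _ _ (hS.crisp hσ))⟩
  | sharpIn _ _ ih₁ ih₂ =>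
    exact ⟨ih₁, fun _ _ _ hσ => .sharpIn (hS.ctx hσ) (ih₂.2 _ _ _ (hS.crisp hσ))⟩
  | sharpIn_congr _ _ ih₁ ih₂ =>
    exact ⟨ih₁, fun _ _ _ hσ => .sharpIn_congr (hS.ctx hσ) (ih₂.2 _ _ _ (hS.crisp hσ))⟩
  | sharpOut _ _ ih₁ ih₂ =>
    refine ⟨ih₁, fun _ _ _ hσ => ?_⟩
    obtain ⟨τ, hτ, h⟩ := hS.exists_core hσ
    rw [subst, h, h]
    exact .sharpOut (hS.ctx hσ) (ih₂.2 _ _ _ hτ)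
  | sharpOut_congr _ _ ih₁ ih₂ =>
    refine ⟨ih₁, fun _ _ _ hσ => ?_⟩
    obtain ⟨τ, hτ, h⟩ := hS.exists_core hσ
    rw [subst, subst, h, h, h]
    exact .sharpOut_congr (hS.ctx hσ) (ih₂.2 _ _ _ hτ)
  | sharp_beta _ _ ih₁ ih₂ =>
    refine ⟨ih₁, fun _ _ _ hσ => ?_⟩
    obtain ⟨τ, hτ, h⟩ := hS.exists_core hσ
    rw [subst, subst, h, h]
    exact .sharp_beta (hS.ctx hσ) (ih₂.2 _ _ _ hτ)
  | sharp_eta _ ih => exact ⟨ih.1, fun _ _ _ hσ => .sharp_eta (ih.2 _ _ _ hσ)⟩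
  | funext _ ih => exact ⟨ih, fun _ _ _ hσ => .funext (hS.ctx hσ)⟩

end

open Tm Judgment

/-! ### Contexts underlying derivable judgments. -/

theorem Derivable.ctx_crispZone {Δ Γ} (h : Derivable (ctx Δ Γ)) : Derivable (ctx Δ []) := by
  suffices ∀ {J}, Derivable J → Derivable (match J with
      | .ctx Δ _ => ctx Δ [] | .tm Δ _ _ _ => ctx Δ [] | .eq Δ _ _ _ _ => ctx Δ []) from this h
  intro J h
  induction h with
  | ctx_nil => exact .ctx_nil
  | ctx_crisp h _ => exact .ctx_crisp h
  | _ => assumption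

theorem Derivable.ctx_of {J} (h : Derivable J) : Derivable (match J with
    | .ctx Δ Γ => ctx Δ Γ | .tm Δ Γ _ _ => ctx Δ Γ | .eq Δ Γ _ _ _ => ctx Δ Γ) := by
  induction h with
  | ctx_nil => exact .ctx_nil
  | ctx_crisp h _ => exact .ctx_crisp h
  | ctx_cohesive h _ => exact .ctx_cohesive h
  | _ => assumption

theorem Derivable.ctx_of_tm {Δ Γ t A} (h : Derivable (tm Δ Γ t A)) : Derivable (ctx Δ Γ) :=
  h.ctx_of

theorem Derivable.ctx_of_eq {Δ Γ t u A} (h : Derivable (eq Δ Γ t u A)) : Derivable (ctx Δ Γ) :=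
  h.ctx_of

theorem Derivable.ctx_cons_inv {Δ Γ A} (h : Derivable (ctx Δ (A :: Γ))) :
    ∃ i, Derivable (tm Δ Γ A (Tm.univ i)) := by
  cases h with
  | ctx_cohesive h => exact ⟨_, h⟩

theorem Derivable.ctx_crisp_cons_inv {Δ A} (h : Derivable (ctx (A :: Δ) [])) :
    ∃ i, Derivable (tm Δ [] A (Tm.univ i)) := by
  cases h with
  | ctx_crisp h => exact ⟨_, h⟩

/-! ### Renamings -/

/-- `Δ ∣ Γ` is a context, and so is the result of moving an initial part of `Γ` to the crisp
zone. -/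
def IsCrispableCtx (Δ Γ : List Tm) : Prop :=
  ∀ Γ₁ Γ₂, Γ = Γ₂ ++ Γ₁ → Derivable (ctx (Γ₁ ++ Δ) Γ₂)

/-- Renamings that send crisp variables to crisp variables. -/
def IsRenaming (σ : ℕ → Tm) (Δ Γ Δ' Γ' : List Tm) : Prop :=
  ∃ ρ : ℕ → ℕ, (σ = fun n => var (ρ n)) ∧ IsCrispableCtx Δ' Γ' ∧
    (∀ n A, (Γ ++ Δ)[n]? = some A →
      ∃ A', (Γ' ++ Δ')[ρ n]? = some A' ∧ wk (ρ n + 1) A' = rename ρ (wk (n + 1) A)) ∧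
    ∀ n, Γ.length ≤ n → Γ'.length ≤ ρ n

theorem IsCrispableCtx.split {Δ Γ₁ Γ₂} (h : IsCrispableCtx Δ (Γ₂ ++ Γ₁)) :
    IsCrispableCtx (Γ₁ ++ Δ) Γ₂ := by
  rintro X Y rfl
  rw [← List.append_assoc]
  exact h _ _ (by simp)

theorem IsRenaming.split {σ Δ Γ Δ' Γ₁ Γ₂} (h : IsRenaming σ Δ Γ Δ' (Γ₂ ++ Γ₁)) :
    IsRenaming σ Δ Γ (Γ₁ ++ Δ') Γ₂ := by
  obtain ⟨ρ, rfl, hc, hl, hb⟩ := h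
  refine ⟨ρ, rfl, hc.split, fun n A hn => ?_, fun n hn => ?_⟩
  · rw [← List.append_assoc]; exact hl n A hn
  · have := hb n hn
    simp only [List.length_append] at this
    lia

theorem isCrispableCtx_nil {Δ} (h : Derivable (ctx Δ [])) : IsCrispableCtx Δ [] := by
  intro Γ₁ Γ₂ h'
  obtain ⟨rfl, rfl⟩ := List.append_eq_nil_iff.1 h'.symm
  exact h

theorem IsCrispableCtx.ctx {Δ Γ} (h : IsCrispableCtx Δ Γ) : Derivable (ctx Δ Γ) :=
  h [] Γ (by simp)

/-- Crispability of the target is built into `IsRenaming` because `crisp` has to produce the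
derivable context `Γ' ++ Δ' ∣ ·` before it is known that every context can be made crisp. That fact
is then deduced from this instance. -/
theorem substClass_isRenaming : SubstClass IsRenaming where
  ctx h := by
    obtain ⟨ρ, rfl, hc, -⟩ := h
    exact hc.ctx
  var {σ Δ Γ Δ' Γ' n A} h hn := by
    obtain ⟨ρ, rfl, hc, hl, hb⟩ := h
    obtain ⟨A', hA', e⟩ := hl n A hn
    rw [subst_var, ← e]
    exact .var hc.ctx hA'
  lift {σ Δ Γ Δ' Γ' A i} hA h := by
    have h' := h
    obtain ⟨ρ, rfl, hc, hl, hb⟩ := h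
    refine ⟨liftRen ρ, liftSub_var ρ, ?_, fun n B hn => ?_, fun n hn => ?_⟩
    · intro Γ₁ Γ₂ e
      cases Γ₂ with
      | nil =>
        obtain rfl : _ = Γ₁ := e
        exact .ctx_crisp (hA _ _ (IsRenaming.split (Γ₂ := []) h'))
      | cons B Γ₂ =>
        obtain ⟨rfl, rfl⟩ := List.cons_eq_cons.1 e
        exact .ctx_cohesive (hA _ _ h'.split)
    · cases n with
      | zero =>
        obtain rfl : A = B := by simpa using hn
        refine ⟨_, rfl, ?_⟩
        rw [subst_var]
        simp [wk, rename_rename, liftRen]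
      | succ n =>
        obtain ⟨A', hA', e⟩ := hl n B (by simpa using hn)
        refine ⟨A', by simpa [liftRen] using hA', ?_⟩
        have := congrArg (wk 1) e
        rw [wk_wk] at this
        simp only [liftRen, this]
        simp [wk, rename_rename, liftRen, ← Nat.add_assoc]
    · cases n with
      | zero => simp at hn
      | succ n => simpa [liftRen] using hb n (by simpa using hn)
  crisp {σ Δ Γ Δ' Γ'} h := by
    obtain ⟨ρ, rfl, hc, hl, hb⟩ := IsRenaming.split (Γ₂ := []) h
    exact ⟨ρ, rfl, hc, hl, fun _ _ => Nat.zero_le _⟩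
  core {σ Δ Γ Δ' Γ'} h := by
    obtain ⟨ρ, rfl, hc, hl, hb⟩ := h
    refine ⟨fun n => var (ρ (n + Γ.length) - Γ'.length),
      ⟨fun n => ρ (n + Γ.length) - Γ'.length, rfl, isCrispableCtx_nil hc.ctx.ctx_crispZone,
        fun n A hn => ?_, fun _ _ => Nat.zero_le _⟩, fun n => ?_⟩
    · obtain ⟨A', hA', e⟩ := hl (n + Γ.length) A (by
        rw [List.getElem?_append_right (by lia)]
        simpa using hn)
      have hle := hb (n + Γ.length) (by lia)
      -- The equation of types over `Δ' ∣ ·` is recovered from the one over `Δ' ∣ Γ'` by cancelling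
      -- the weakening along `Γ'`.
      refine ⟨A', ?_, wk_injective Γ'.length ?_⟩
      · rw [List.getElem?_append_right hle] at hA'
        exact hA'
      · rw [wk_wk,
          show ρ (n + Γ.length) - Γ'.length + 1 + Γ'.length = ρ (n + Γ.length) + 1 by lia, e]
        simp only [wk, rename_rename]
        congr 1
        funext k
        have := hb (k + (n + 1) + Γ.length) (by lia)
        rw [show k + (n + Γ.length + 1) = k + (n + 1) + Γ.length by lia]
        lia
    · have hle := hb (n + Γ.length) (by lia)
      simp only [wk, rename]
      congr 1
      lia

/-- Induction on `Γ`: once all splittings of `Γ` are contexts, the identity is a renaming from `Δ ∣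
Γ` to each of them, so the next type is still a type there. -/
theorem Derivable.isCrispableCtx {Δ Γ} (h : Derivable (ctx Δ Γ)) : IsCrispableCtx Δ Γ := by
  induction Γ with
  | nil => exact isCrispableCtx_nil h
  | cons A Γ ih =>
    obtain ⟨i, hA⟩ := h.ctx_cons_inv
    have hid : ∀ Γ₁ Γ₂, Γ = Γ₂ ++ Γ₁ → IsRenaming Tm.var Δ Γ (Γ₁ ++ Δ) Γ₂ := by
      rintro Γ₁ Γ₂ rfl
      refine ⟨fun n => n, rfl, (ih hA.ctx_of_tm).split, fun n A hn => ⟨A, ?_, ?_⟩, fun n hn => ?_⟩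
      · rw [← List.append_assoc]; exact hn
      · rw [rename_id]
      · simp only [List.length_append] at hn; lia
    have hA' := fun Γ₁ Γ₂ e => (substClass_isRenaming.preserved hA).2 _ _ _ (hid Γ₁ Γ₂ e)
    simp only [subst_id, subst] at hA'
    intro Γ₁ Γ₂ e
    cases Γ₂ with
    | nil =>
      obtain rfl : _ = Γ₁ := e
      exact .ctx_crisp (hA' _ _ rfl)
    | cons B Γ₂ =>
      obtain ⟨rfl, rfl⟩ := List.cons_eq_cons.1 e
      exact .ctx_cohesive (hA' _ _ rfl)

theorem Derivable.ctx_toCrisp {Δ Γ} (h : Derivable (ctx Δ Γ)) : Derivable (ctx (Γ ++ Δ) []) :=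
  h.isCrispableCtx Γ [] rfl

theorem isRenaming_toCrisp {Δ Γ} (h : Derivable (ctx Δ Γ)) :
    IsRenaming Tm.var Δ Γ (Γ ++ Δ) [] :=
  ⟨fun n => n, rfl, h.isCrispableCtx.split (Γ₂ := []), fun n A hn => ⟨A, hn, by rw [rename_id]⟩,
    fun _ _ => Nat.zero_le _⟩

theorem isRenaming_wk {Δ Γ Γ'} (h : Derivable (ctx Δ (Γ' ++ Γ))) :
    IsRenaming (fun n => Tm.var (n + Γ'.length)) Δ Γ Δ (Γ' ++ Γ) := by
  refine ⟨fun n => n + Γ'.length, rfl, h.isCrispableCtx, fun n A hn => ⟨A, ?_, ?_⟩, fun n hn => ?_⟩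
  · rw [List.append_assoc, List.getElem?_append_right (by lia)]
    simpa using hn
  · simp only [wk, rename_rename]; congr 1; funext k; lia
  · simp only [List.length_append]; lia

theorem Derivable.tm_toCrisp {Δ Γ t A} (h : Derivable (tm Δ Γ t A)) :
    Derivable (tm (Γ ++ Δ) [] t A) := by
  have := (substClass_isRenaming.preserved h).2 _ _ _ (isRenaming_toCrisp h.ctx_of_tm)
  rwa [subst_id, subst_id] at this

theorem Derivable.eq_toCrisp {Δ Γ t u A} (h : Derivable (eq Δ Γ t u A)) :
    Derivable (eq (Γ ++ Δ) [] t u A) := by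
  have := (substClass_isRenaming.preserved h).2 _ _ _ (isRenaming_toCrisp h.ctx_of_eq)
  rwa [subst_id, subst_id, subst_id] at this

theorem Derivable.tm_wk {Δ Γ Γ' t A} (h : Derivable (tm Δ Γ t A))
    (h' : Derivable (ctx Δ (Γ' ++ Γ))) :
    Derivable (tm Δ (Γ' ++ Γ) (wk Γ'.length t) (wk Γ'.length A)) := by
  have := (substClass_isRenaming.preserved h).2 _ _ _ (isRenaming_wk h')
  rwa [subst_var, subst_var] at this

theorem Derivable.eq_wk {Δ Γ Γ' t u A} (h : Derivable (eq Δ Γ t u A))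
    (h' : Derivable (ctx Δ (Γ' ++ Γ))) :
    Derivable (eq Δ (Γ' ++ Γ) (wk Γ'.length t) (wk Γ'.length u) (wk Γ'.length A)) := by
  have := (substClass_isRenaming.preserved h).2 _ _ _ (isRenaming_wk h')
  rwa [subst_var, subst_var, subst_var] at this

theorem Derivable.tm_wk_one {Δ Γ B t A} (h : Derivable (tm Δ Γ t A))
    (h' : Derivable (ctx Δ (B :: Γ))) : Derivable (tm Δ (B :: Γ) (wk 1 t) (wk 1 A)) :=
  h.tm_wk (Γ' := [B]) h'

theorem Derivable.eq_wk_one {Δ Γ B t u A} (h : Derivable (eq Δ Γ t u A))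
    (h' : Derivable (ctx Δ (B :: Γ))) :
    Derivable (eq Δ (B :: Γ) (wk 1 t) (wk 1 u) (wk 1 A)) :=
  h.eq_wk (Γ' := [B]) h'

theorem Derivable.tm_wk_nil {Δ Γ t A} (h : Derivable (tm Δ [] t A)) (h' : Derivable (ctx Δ Γ)) :
    Derivable (tm Δ Γ (wk Γ.length t) (wk Γ.length A)) := by
  have := h.tm_wk (Γ' := Γ) (by simpa using h')
  simpa using this

/-- Weaken by a cohesive variable, then make that variable crisp. -/
theorem Derivable.tm_crisp_wk_one {Δ B t A} (h : Derivable (tm Δ [] t A))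
    (h' : Derivable (ctx (B :: Δ) [])) : Derivable (tm (B :: Δ) [] (wk 1 t) (wk 1 A)) := by
  obtain ⟨i, hB⟩ := h'.ctx_crisp_cons_inv
  exact (h.tm_wk_one (.ctx_cohesive hB)).tm_toCrisp

/-- The types in a context are types. -/
theorem Derivable.lookup_type {Δ Γ} (h : Derivable (ctx Δ Γ)) {n A} (hn : (Γ ++ Δ)[n]? = some A) :
    ∃ i, Derivable (tm Δ Γ (wk (n + 1) A) (Tm.univ i)) := by
  induction Γ generalizing n with
  | nil =>
    simp only [List.nil_append] at hn
    induction Δ generalizing n with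
    | nil => simp at hn
    | cons B Δ ih =>
      obtain ⟨i, hB⟩ := h.ctx_crisp_cons_inv
      cases n with
      | zero =>
        obtain rfl : B = A := by simpa using hn
        exact ⟨i, hB.tm_crisp_wk_one h⟩
      | succ n =>
        obtain ⟨j, hA⟩ := ih hB.ctx_of_tm (by simpa using hn)
        rw [← wk_wk]
        exact ⟨j, hA.tm_crisp_wk_one h⟩
  | cons B Γ ih =>
    obtain ⟨i, hB⟩ := h.ctx_cons_inv
    cases n with
    | zero =>
      obtain rfl : B = A := by simpa using hn
      exact ⟨i, hB.tm_wk_one h⟩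
    | succ n =>
      obtain ⟨j, hA⟩ := ih hB.ctx_of_tm (by simpa using hn)
      rw [← wk_wk]
      exact ⟨j, hA.tm_wk_one h⟩

/-! ### Substitutions -/

/-- `σ` sends the variables of the list `Γ` to terms in the context `Δ' ∣ Γ'`. -/
def MapsVars (σ : ℕ → Tm) (Γ Δ' Γ' : List Tm) : Prop :=
  ∀ n A, Γ[n]? = some A → Derivable (tm Δ' Γ' (σ n) (subst σ (wk (n + 1) A)))

/-- Substitutions that send crisp variables to crisp terms. -/
def IsSubst (σ : ℕ → Tm) (Δ Γ Δ' Γ' : List Tm) : Prop :=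
  Derivable (ctx Δ' Γ') ∧ MapsVars σ (Γ ++ Δ) Δ' Γ' ∧
    ∃ τ, MapsVars τ Δ Δ' [] ∧ ∀ n, σ (n + Γ.length) = wk Γ'.length (τ n)

theorem MapsVars.lift {σ Γ Δ' Γ' A} (h : MapsVars σ Γ Δ' Γ')
    (h' : Derivable (ctx Δ' (subst σ A :: Γ'))) :
    MapsVars (liftSub σ) (A :: Γ) Δ' (subst σ A :: Γ') := by
  intro n B hn
  cases n with
  | zero =>
    obtain rfl : A = B := by simpa using hn
    rw [subst_liftSub_wk]
    exact .var h' rfl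
  | succ n =>
    rw [← wk_wk, subst_liftSub_wk]
    exact (h n B (by simpa using hn)).tm_wk_one h'

theorem MapsVars.toCrisp {σ Γ Δ' Γ'} (h : MapsVars σ Γ Δ' Γ') : MapsVars σ Γ (Γ' ++ Δ') [] :=
  fun n A hn => (h n A hn).tm_toCrisp

/-- Since every context is now known to be crispable, `IsSubst` needs no condition on splittings of
the target. -/
theorem substClass_isSubst : SubstClass IsSubst where
  ctx h := h.1
  var h hn := h.2.1 _ _ hn
  lift {σ Δ Γ Δ' Γ' A i} hA h := by
    have hc := Derivable.ctx_cohesive (hA _ _ h)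
    obtain ⟨h₁, h₂, τ, hτ, e⟩ := h
    refine ⟨hc, h₂.lift hc, τ, hτ, fun n => ?_⟩
    rw [List.length_cons, List.length_cons, ← Nat.add_assoc, liftSub, e, wk_wk]
  crisp h := ⟨h.1.ctx_toCrisp, h.2.1.toCrisp, _, h.2.1.toCrisp, fun _ => (wk_zero _).symm⟩
  core h := by
    obtain ⟨h₁, h₂, τ, hτ, e⟩ := h
    exact ⟨τ, ⟨h₁.ctx_crispZone, hτ, τ, hτ, fun _ => (wk_zero _).symm⟩, e⟩

theorem Derivable.tm_subst {Δ Γ t A σ Δ' Γ'} (h : Derivable (tm Δ Γ t A))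
    (hσ : IsSubst σ Δ Γ Δ' Γ') : Derivable (tm Δ' Γ' (subst σ t) (subst σ A)) :=
  (substClass_isSubst.preserved h).2 _ _ _ hσ

theorem Derivable.eq_subst {Δ Γ t u A σ Δ' Γ'} (h : Derivable (eq Δ Γ t u A))
    (hσ : IsSubst σ Δ Γ Δ' Γ') : Derivable (eq Δ' Γ' (subst σ t) (subst σ u) (subst σ A)) :=
  (substClass_isSubst.preserved h).2 _ _ _ hσ

theorem mapsVars_var {Δ Γ} (h : Derivable (ctx Δ Γ)) : MapsVars Tm.var (Γ ++ Δ) Δ Γ := by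
  intro n A hn
  rw [subst_id]
  exact .var h hn

theorem mapsVars_var_crisp {Δ Γ} (h : Derivable (ctx Δ Γ)) : MapsVars Tm.var Δ Δ [] :=
  mapsVars_var (Γ := []) h.ctx_crispZone

theorem isSubst_var {Δ Γ} (h : Derivable (ctx Δ Γ)) : IsSubst Tm.var Δ Γ Δ Γ :=
  ⟨h, mapsVars_var h, Tm.var, mapsVars_var_crisp h, fun _ => rfl⟩

theorem isSubst_cons {Δ Γ Γ' σ A a} (h : IsSubst (fun n => σ (n + 1)) Δ Γ Δ Γ')
    (ha : Derivable (tm Δ Γ' a (subst (fun n => σ (n + 1)) A))) (h₀ : σ 0 = a) :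
    IsSubst σ Δ (A :: Γ) Δ Γ' := by
  obtain ⟨h₁, h₂, τ, hτ, e⟩ := h
  refine ⟨h₁, fun n B hn => ?_, τ, hτ, e⟩
  cases n with
  | zero =>
    obtain rfl : A = B := by simpa using hn
    rwa [subst_wk, h₀]
  | succ n =>
    rw [← wk_wk, subst_wk]
    exact h₂ n B (by simpa using hn)

theorem isSubst_single {Δ Γ A a} (ha : Derivable (tm Δ Γ a A)) :
    IsSubst (single a) Δ (A :: Γ) Δ Γ :=
  isSubst_cons (isSubst_var ha.ctx_of_tm) (by simpa only [single, subst_id] using ha) rfl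

theorem isSubst_double {Δ Γ A B a b} (ha : Derivable (tm Δ Γ a A))
    (hb : Derivable (tm Δ Γ b (inst B a))) :
    IsSubst (double a b) Δ (B :: A :: Γ) Δ Γ := by
  refine isSubst_cons (a := b) ?_ ?_ rfl
  · exact isSubst_cons (a := a) (isSubst_var ha.ctx_of_tm)
      (by simpa only [double, subst_id] using ha) rfl
  · convert hb using 2
    rw [inst]; congr 1; funext n; cases n <;> rfl

/-- A change of the type of the last variable. -/
theorem isSubst_conv {Δ Γ A A' i j} (hA : Derivable (tm Δ Γ A' (Tm.univ j)))
    (h : Derivable (eq Δ Γ A' A (Tm.univ i))) : IsSubst Tm.var Δ (A :: Γ) Δ (A' :: Γ) := by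
  have hc := Derivable.ctx_cohesive hA
  refine isSubst_cons (a := Tm.var 0) (σ := Tm.var) ?_ ?_ rfl
  · refine ⟨hc, fun n B hn => ?_, Tm.var, mapsVars_var_crisp hA.ctx_of_tm, fun n => ?_⟩
    · have := Derivable.var (n := n + 1) hc hn
      rwa [← wk_wk, wk_eq_subst 1, ← wk_eq_subst, wk_eq_subst 1] at this
    · rw [wk]; simp [rename, Nat.add_assoc]
  · rw [← wk_eq_subst]
    exact .conv (.var hc rfl) (h.eq_wk_one hc)

theorem Derivable.tm_inst {Δ Γ A B t a} (h : Derivable (tm Δ (A :: Γ) t B))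
    (ha : Derivable (tm Δ Γ a A)) : Derivable (tm Δ Γ (inst t a) (inst B a)) :=
  h.tm_subst (isSubst_single ha)

theorem Derivable.eq_inst {Δ Γ A B t u a} (h : Derivable (eq Δ (A :: Γ) t u B))
    (ha : Derivable (tm Δ Γ a A)) : Derivable (eq Δ Γ (inst t a) (inst u a) (inst B a)) :=
  h.eq_subst (isSubst_single ha)

theorem Derivable.tm_conv_ctx {Δ Γ A A' t B i j} (h : Derivable (tm Δ (A :: Γ) t B))
    (hA : Derivable (tm Δ Γ A' (Tm.univ j))) (e : Derivable (eq Δ Γ A A' (Tm.univ i))) :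
    Derivable (tm Δ (A' :: Γ) t B) := by
  have := h.tm_subst (isSubst_conv hA e.eq_symm)
  rwa [subst_id, subst_id] at this

open Tm Judgment

theorem Derivable.cumul_le {Δ Γ A i j} (h : Derivable (tm Δ Γ A (Tm.univ i))) (hij : i ≤ j) :
    Derivable (tm Δ Γ A (Tm.univ j)) := by
  induction hij with
  | refl => exact h
  | step _ ih => exact ih.cumul

theorem Derivable.eq_cumul_le {Δ Γ A B i j} (h : Derivable (eq Δ Γ A B (Tm.univ i)))
    (hij : i ≤ j) : Derivable (eq Δ Γ A B (Tm.univ j)) := by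
  induction hij with
  | refl => exact h
  | step _ ih => exact ih.eq_cumul

/-! ### Inversion -/

/-- Only the formation rule, `conv` and `cumul` can type a term of this shape, so inversion needs no
uniqueness of types. The same holds for the three inversions that follow. -/
theorem Derivable.pi_inv {Δ Γ A B T} (h : Derivable (tm Δ Γ (Tm.pi A B) T)) :
    ∃ i, Derivable (tm Δ Γ A (Tm.univ i)) ∧ Derivable (tm Δ (A :: Γ) B (Tm.univ i)) := by
  generalize hJ : tm Δ Γ (Tm.pi A B) T = J at h
  induction h generalizing T with
  | conv _ _ ih => cases hJ; exact ih rfl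
  | cumul _ ih => cases hJ; exact ih rfl
  | pi h₁ h₂ => cases hJ; exact ⟨_, h₁, h₂⟩
  | _ => cases hJ

theorem Derivable.sig_inv {Δ Γ A B T} (h : Derivable (tm Δ Γ (Tm.sig A B) T)) :
    ∃ i, Derivable (tm Δ Γ A (Tm.univ i)) ∧ Derivable (tm Δ (A :: Γ) B (Tm.univ i)) := by
  generalize hJ : tm Δ Γ (Tm.sig A B) T = J at h
  induction h generalizing T with
  | conv _ _ ih => cases hJ; exact ih rfl
  | cumul _ ih => cases hJ; exact ih rfl
  | sig h₁ h₂ => cases hJ; exact ⟨_, h₁, h₂⟩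
  | _ => cases hJ

theorem Derivable.id_inv {Δ Γ A a b T} (h : Derivable (tm Δ Γ (Tm.id A a b) T)) :
    ∃ i, Derivable (tm Δ Γ A (Tm.univ i)) ∧ Derivable (tm Δ Γ a A) ∧
      Derivable (tm Δ Γ b A) := by
  generalize hJ : tm Δ Γ (Tm.id A a b) T = J at h
  induction h generalizing T with
  | conv _ _ ih => cases hJ; exact ih rfl
  | cumul _ ih => cases hJ; exact ih rfl
  | id h₁ h₂ h₃ => cases hJ; exact ⟨_, h₁, h₂, h₃⟩
  | _ => cases hJ

theorem Derivable.sharp_inv {Δ Γ A T} (h : Derivable (tm Δ Γ (Tm.sharp A) T)) :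
    ∃ i, Derivable (tm (Γ ++ Δ) [] A (Tm.univ i)) := by
  generalize hJ : tm Δ Γ (Tm.sharp A) T = J at h
  induction h generalizing T with
  | conv _ _ ih => cases hJ; exact ih rfl
  | cumul _ ih => cases hJ; exact ih rfl
  | sharp _ h => cases hJ; exact ⟨_, h⟩
  | _ => cases hJ

/-! ### Equal substitutions -/

def MapsVarsEq (σ σ' : ℕ → Tm) (Γ Δ' Γ' : List Tm) : Prop :=
  ∀ n A, Γ[n]? = some A → Derivable (eq Δ' Γ' (σ n) (σ' n) (subst σ (wk (n + 1) A)))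

/-- Judgmentally equal substitutions. -/
def IsSubstEq (σ σ' : ℕ → Tm) (Δ Γ Δ' Γ' : List Tm) : Prop :=
  IsSubst σ Δ Γ Δ' Γ' ∧ IsSubst σ' Δ Γ Δ' Γ' ∧ MapsVarsEq σ σ' (Γ ++ Δ) Δ' Γ' ∧
    ∃ τ τ', MapsVars τ Δ Δ' [] ∧ MapsVars τ' Δ Δ' [] ∧ MapsVarsEq τ τ' Δ Δ' [] ∧
      (∀ n, σ (n + Γ.length) = wk Γ'.length (τ n)) ∧
      ∀ n, σ' (n + Γ.length) = wk Γ'.length (τ' n)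

theorem IsSubst.toCrisp {σ Δ Γ Δ' Γ'} (h : IsSubst σ Δ Γ Δ' Γ') :
    IsSubst σ (Γ ++ Δ) [] (Γ' ++ Δ') [] :=
  substClass_isSubst.crisp h

theorem MapsVarsEq.toCrisp {σ σ' Γ Δ' Γ'} (h : MapsVarsEq σ σ' Γ Δ' Γ') :
    MapsVarsEq σ σ' Γ (Γ' ++ Δ') [] :=
  fun n A hn => (h n A hn).eq_toCrisp

theorem IsSubstEq.toCrisp {σ σ' Δ Γ Δ' Γ'} (h : IsSubstEq σ σ' Δ Γ Δ' Γ') :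
    IsSubstEq σ σ' (Γ ++ Δ) [] (Γ' ++ Δ') [] := by
  obtain ⟨h, h', e, -⟩ := h
  exact ⟨h.toCrisp, h'.toCrisp, e.toCrisp, σ, σ', h.2.1.toCrisp, h'.2.1.toCrisp, e.toCrisp,
    fun _ => (wk_zero _).symm, fun _ => (wk_zero _).symm⟩

theorem IsSubstEq.exists_core {σ σ' Δ Γ Δ' Γ'} (h : IsSubstEq σ σ' Δ Γ Δ' Γ') :
    ∃ τ τ', IsSubstEq τ τ' Δ [] Δ' [] ∧
      (∀ t, subst σ (wk Γ.length t) = wk Γ'.length (subst τ t)) ∧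
      ∀ t, subst σ' (wk Γ.length t) = wk Γ'.length (subst τ' t) := by
  obtain ⟨h, h', e, τ, τ', hτ, hτ', eτ, hs, hs'⟩ := h
  have hc := h.1.ctx_crispZone
  refine ⟨τ, τ', ⟨⟨hc, hτ, τ, hτ, fun _ => (wk_zero _).symm⟩,
    ⟨hc, hτ', τ', hτ', fun _ => (wk_zero _).symm⟩, eτ, τ, τ', hτ, hτ', eτ,
    fun _ => (wk_zero _).symm, fun _ => (wk_zero _).symm⟩, fun t => ?_, fun t => ?_⟩
  · rw [subst_wk, wk_subst]; simp only [hs]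
  · rw [subst_wk, wk_subst]; simp only [hs']

theorem IsSubst.lift {σ Δ Γ Δ' Γ' A i} (h : IsSubst σ Δ Γ Δ' Γ')
    (hA : Derivable (tm Δ Γ A (Tm.univ i))) :
    IsSubst (liftSub σ) Δ (A :: Γ) Δ' (subst σ A :: Γ') :=
  substClass_isSubst.lift (fun _ _ h => hA.tm_subst h) h

theorem IsSubstEq.lift {σ σ' Δ Γ Δ' Γ' A i j} (h : IsSubstEq σ σ' Δ Γ Δ' Γ')
    (hA : Derivable (tm Δ Γ A (Tm.univ i)))
    (eA : Derivable (eq Δ' Γ' (subst σ A) (subst σ' A) (Tm.univ j))) :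
    IsSubstEq (liftSub σ) (liftSub σ') Δ (A :: Γ) Δ' (subst σ A :: Γ') := by
  obtain ⟨h, h', e, τ, τ', hτ, hτ', eτ, hs, hs'⟩ := h
  have hl := h.lift hA
  have hc : Derivable (ctx Δ' (subst σ A :: Γ')) := hl.1
  have hsl' : ∀ n, liftSub σ' (n + (A :: Γ).length) = wk (subst σ A :: Γ').length (τ' n) := by
    intro n
    rw [List.length_cons, List.length_cons, ← Nat.add_assoc, liftSub, hs', wk_wk]
  refine ⟨hl, ⟨hc, fun n B hn => ?_, τ', hτ', hsl'⟩, fun n B hn => ?_, τ, τ', hτ, hτ', eτ,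
    fun n => ?_, hsl'⟩
  · cases n with
    | zero =>
      obtain rfl : A = B := by simpa using hn
      rw [subst_liftSub_wk]
      -- In the lifted target context the new variable has type `subst σ A`, whereas `liftSub σ'`
      -- must send it into `subst σ' A`.
      exact .conv (.var hc rfl) (eA.eq_wk_one hc)
    | succ n =>
      rw [← wk_wk, subst_liftSub_wk]
      exact (h'.2.1 n B (by simpa using hn)).tm_wk_one hc
  · cases n with
    | zero =>
      obtain rfl : A = B := by simpa using hn
      rw [subst_liftSub_wk]
      exact .eq_refl (.var hc rfl)
    | succ n =>
      rw [← wk_wk, subst_liftSub_wk]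
      exact (e n B (by simpa using hn)).eq_wk_one hc
  · rw [List.length_cons, List.length_cons, ← Nat.add_assoc, liftSub, hs, wk_wk]

/-- The types in the cohesive zone of a context respect equality of substitutions. -/
def CtxFunctional (Δ : List Tm) : List Tm → Prop
  | [] => True
  | A :: Γ => CtxFunctional Δ Γ ∧ ∃ i, Derivable (tm Δ Γ A (Tm.univ i)) ∧
      ∀ σ σ' Δ' Γ', IsSubstEq σ σ' Δ Γ Δ' Γ' →
        Derivable (eq Δ' Γ' (subst σ A) (subst σ' A) (Tm.univ i))

/-- This is needed for presuppositions: the right-hand side of a congruence rule naturally has its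
type instantiated at the right-hand terms, and that type must be converted. `IsSubstEq` assumes both
substitutions well typed because typing of a right-hand side cannot yet be read off an equality. -/
def Functional : Judgment → Prop
  | ctx Δ Γ => CtxFunctional Δ Γ
  | tm Δ Γ t A => CtxFunctional Δ Γ ∧ ∀ σ σ' Δ' Γ', IsSubstEq σ σ' Δ Γ Δ' Γ' →
      Derivable (eq Δ' Γ' (subst σ t) (subst σ' t) (subst σ A))
  | eq _ _ _ _ _ => True

theorem CtxFunctional.lift {σ σ' Δ Γ Δ' Γ' A} (h : CtxFunctional Δ (A :: Γ))
    (hσ : IsSubstEq σ σ' Δ Γ Δ' Γ') :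
    IsSubstEq (liftSub σ) (liftSub σ') Δ (A :: Γ) Δ' (subst σ A :: Γ') :=
  let ⟨_, hA, eA⟩ := h.2
  hσ.lift hA (eA _ _ _ _ hσ)

/-- Each typing rule is matched by the corresponding congruence rule, with reflexivity for
constants. -/
theorem Derivable.functional {J : Judgment} (h : Derivable J) : Functional J := by
  induction h with
  | ctx_nil => trivial
  | ctx_crisp _ _ => trivial
  | ctx_cohesive h ih => exact ⟨ih.1, _, h, ih.2⟩
  | var _ hn ih => exact ⟨ih, fun _ _ _ _ hσ => hσ.2.2.1 _ _ hn⟩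
  | conv _ h ih₁ _ =>
    exact ⟨ih₁.1, fun _ _ _ _ hσ => .eq_conv (ih₁.2 _ _ _ _ hσ) (h.eq_subst hσ.1)⟩
  | univ _ ih => exact ⟨ih, fun _ _ _ _ hσ => .eq_refl (.univ hσ.1.1)⟩
  | cumul _ ih => exact ⟨ih.1, fun _ _ _ _ hσ => .eq_cumul (ih.2 _ _ _ _ hσ)⟩
  | pi h _ ih₁ ih₂ =>
    exact ⟨ih₁.1, fun _ _ _ _ hσ =>
      .pi_congr (h.tm_subst hσ.1) (ih₁.2 _ _ _ _ hσ) (ih₂.2 _ _ _ _ (ih₂.1.lift hσ))⟩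
  | lam h _ ih₁ ih₂ =>
    exact ⟨ih₁.1, fun _ _ _ _ hσ =>
      .lam_congr (h.tm_subst hσ.1) (ih₁.2 _ _ _ _ hσ) (ih₂.2 _ _ _ _ (ih₂.1.lift hσ))⟩
  | app _ _ ih₁ ih₂ =>
    refine ⟨ih₁.1, fun _ _ _ _ hσ => ?_⟩
    rw [subst_inst]
    exact .app_congr (ih₁.2 _ _ _ _ hσ) (ih₂.2 _ _ _ _ hσ)
  | sig h _ ih₁ ih₂ =>
    exact ⟨ih₁.1, fun _ _ _ _ hσ =>
      .sig_congr (h.tm_subst hσ.1) (ih₁.2 _ _ _ _ hσ) (ih₂.2 _ _ _ _ (ih₂.1.lift hσ))⟩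
  | pair h _ _ ih₁ ih₂ ih₃ =>
    refine ⟨ih₂.1, fun _ _ _ _ hσ =>
      .pair_congr (h.tm_subst (ih₁.1.lift hσ).1) (ih₂.2 _ _ _ _ hσ) ?_⟩
    rw [← subst_inst]
    exact ih₃.2 _ _ _ _ hσ
  | indSig _ _ _ ih₁ ih₂ ih₃ =>
    refine ⟨ih₃.1, fun _ _ _ _ hσ => ?_⟩
    rw [subst_inst]
    refine .indSig_congr (ih₁.2 _ _ _ _ (ih₁.1.lift hσ)) ?_ (ih₃.2 _ _ _ _ hσ)
    have h := ih₂.2 _ _ _ _ (ih₂.1.lift (ih₂.1.1.lift hσ))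
    rwa [subst_reinst₂] at h
  | unit _ ih => exact ⟨ih, fun _ _ _ _ hσ => .eq_refl (.unit hσ.1.1)⟩
  | star _ ih => exact ⟨ih, fun _ _ _ _ hσ => .eq_refl (.star hσ.1.1)⟩
  | indUnit _ _ _ ih₁ ih₂ ih₃ =>
    refine ⟨ih₃.1, fun _ _ _ _ hσ => ?_⟩
    have h := ih₂.2 _ _ _ _ hσ
    rw [subst_inst] at h ⊢
    exact .indUnit_congr (ih₁.2 _ _ _ _ (ih₁.1.lift hσ)) h (ih₃.2 _ _ _ _ hσ)
  | nat _ ih => exact ⟨ih, fun _ _ _ _ hσ => .eq_refl (.nat hσ.1.1)⟩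
  | zero _ ih => exact ⟨ih, fun _ _ _ _ hσ => .eq_refl (.zero hσ.1.1)⟩
  | succ _ ih => exact ⟨ih.1, fun _ _ _ _ hσ => .succ_congr (ih.2 _ _ _ _ hσ)⟩
  | indNat _ _ _ _ ih₁ ih₂ ih₃ ih₄ =>
    refine ⟨ih₄.1, fun _ _ _ _ hσ => ?_⟩
    have h := ih₂.2 _ _ _ _ hσ
    have h' := ih₃.2 _ _ _ _ (ih₃.1.lift (ih₁.1.lift hσ))
    rw [subst_inst] at h ⊢
    rw [subst_reinst₂] at h'
    exact .indNat_congr (ih₁.2 _ _ _ _ (ih₁.1.lift hσ)) h h' (ih₄.2 _ _ _ _ hσ)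
  | id _ _ _ ih₁ ih₂ ih₃ =>
    exact ⟨ih₁.1, fun _ _ _ _ hσ =>
      .id_congr (ih₁.2 _ _ _ _ hσ) (ih₂.2 _ _ _ _ hσ) (ih₃.2 _ _ _ _ hσ)⟩
  | refl _ ih => exact ⟨ih.1, fun _ _ _ _ hσ => .refl_congr (ih.2 _ _ _ _ hσ)⟩
  | indId h _ _ _ _ ih₁ ih₂ ih₃ ih₄ ih₅ =>
    refine ⟨ih₁.1, fun _ _ _ _ hσ => ?_⟩
    have h₂ := ih₂.2 _ _ _ _ (ih₂.1.lift (ih₂.1.1.lift hσ))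
    have h₃ := ih₃.2 _ _ _ _ hσ
    simp only [subst, subst_liftSub_wk] at h₂
    rw [subst_inst₂] at h₃ ⊢
    exact .indId_congr (h.tm_subst hσ.1) h₂ h₃ (ih₄.2 _ _ _ _ hσ) (ih₅.2 _ _ _ _ hσ)
  | sharp _ _ ih₁ ih₂ =>
    exact ⟨ih₁, fun _ _ _ _ hσ => .sharp_congr hσ.1.1 (ih₂.2 _ _ _ _ hσ.toCrisp)⟩
  | sharpIn _ _ ih₁ ih₂ =>
    exact ⟨ih₁, fun _ _ _ _ hσ => .sharpIn_congr hσ.1.1 (ih₂.2 _ _ _ _ hσ.toCrisp)⟩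
  | sharpOut _ _ ih₁ ih₂ =>
    refine ⟨ih₁, fun _ _ _ _ hσ => ?_⟩
    obtain ⟨τ, τ', hτ, h, h'⟩ := hσ.exists_core
    rw [subst, subst, h, h, h']
    exact .sharpOut_congr hσ.1.1 (ih₂.2 _ _ _ _ hτ)
  | funext _ ih => exact ⟨ih, fun _ _ _ _ hσ => .eq_refl (.funext hσ.1.1)⟩
  | _ => trivial

theorem Derivable.tm_substEq {Δ Γ t A σ σ' Δ' Γ'} (h : Derivable (tm Δ Γ t A))
    (hσ : IsSubstEq σ σ' Δ Γ Δ' Γ') :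
    Derivable (eq Δ' Γ' (subst σ t) (subst σ' t) (subst σ A)) :=
  h.functional.2 _ _ _ _ hσ

theorem isSubstEq_var {Δ Γ} (h : Derivable (ctx Δ Γ)) : IsSubstEq Tm.var Tm.var Δ Γ Δ Γ := by
  have h' : MapsVarsEq Tm.var Tm.var (Γ ++ Δ) Δ Γ := fun n A hn => .eq_refl (mapsVars_var h n A hn)
  exact ⟨isSubst_var h, isSubst_var h, h', Tm.var, Tm.var, mapsVars_var_crisp h,
    mapsVars_var_crisp h, fun n A hn => .eq_refl (mapsVars_var_crisp h n A hn),
    fun _ => rfl, fun _ => rfl⟩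

theorem isSubstEq_cons {Δ Γ Γ' σ σ' A a a'}
    (h : IsSubstEq (fun n => σ (n + 1)) (fun n => σ' (n + 1)) Δ Γ Δ Γ')
    (ha : Derivable (tm Δ Γ' a (subst (fun n => σ (n + 1)) A)))
    (ha' : Derivable (tm Δ Γ' a' (subst (fun n => σ' (n + 1)) A)))
    (e : Derivable (eq Δ Γ' a a' (subst (fun n => σ (n + 1)) A))) (h₀ : σ 0 = a)
    (h₀' : σ' 0 = a') : IsSubstEq σ σ' Δ (A :: Γ) Δ Γ' := by
  obtain ⟨h, h', eσ, τ, τ', hτ⟩ := h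
  refine ⟨isSubst_cons h ha h₀, isSubst_cons h' ha' h₀', fun n B hn => ?_, τ, τ', hτ⟩
  cases n with
  | zero =>
    obtain rfl : A = B := by simpa using hn
    rwa [subst_wk, h₀, h₀']
  | succ n =>
    rw [← wk_wk, subst_wk]
    exact eσ n B (by simpa using hn)

theorem isSubstEq_single {Δ Γ A a a'} (ha : Derivable (tm Δ Γ a A))
    (ha' : Derivable (tm Δ Γ a' A)) (e : Derivable (eq Δ Γ a a' A)) :
    IsSubstEq (single a) (single a') Δ (A :: Γ) Δ Γ :=
  isSubstEq_cons (a := a) (a' := a') (isSubstEq_var ha.ctx_of_tm)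
    (by simpa only [single, subst_id] using ha) (by simpa only [single, subst_id] using ha')
    (by simpa only [single, subst_id] using e) rfl rfl

theorem subst_double_succ (B a b : Tm) : subst (fun n => double a b (n + 1)) B = inst B a := by
  rw [inst]; congr 1; funext n; cases n <;> rfl

theorem isSubstEq_double {Δ Γ A B a a' b b'} (ha : Derivable (tm Δ Γ a A))
    (ha' : Derivable (tm Δ Γ a' A)) (ea : Derivable (eq Δ Γ a a' A))
    (hb : Derivable (tm Δ Γ b (inst B a))) (hb' : Derivable (tm Δ Γ b' (inst B a')))
    (eb : Derivable (eq Δ Γ b b' (inst B a))) :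
    IsSubstEq (double a b) (double a' b') Δ (B :: A :: Γ) Δ Γ := by
  refine isSubstEq_cons (a := b) (a' := b') ?_ ?_ ?_ ?_ rfl rfl
  · exact isSubstEq_cons (a := a) (a' := a') (isSubstEq_var ha.ctx_of_tm)
      (by simpa only [double, subst_id] using ha) (by simpa only [double, subst_id] using ha')
      (by simpa only [double, subst_id] using ea) rfl rfl
  · rwa [subst_double_succ]
  · rwa [subst_double_succ]
  · rwa [subst_double_succ]

/-- Instantiation of equal types at equal terms. -/
theorem Derivable.inst_congr {Δ Γ A C C' a a' i} (hC : Derivable (eq Δ (A :: Γ) C C' (Tm.univ i)))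
    (hC' : Derivable (tm Δ (A :: Γ) C' (Tm.univ i)))
    (ha : Derivable (tm Δ Γ a A)) (ha' : Derivable (tm Δ Γ a' A))
    (e : Derivable (eq Δ Γ a a' A)) :
    Derivable (eq Δ Γ (inst C a) (inst C' a') (Tm.univ i)) :=
  .eq_trans (hC.eq_inst ha) (hC'.tm_substEq (isSubstEq_single ha ha' e))

/-- The substitution in `reinst₂`. -/
theorem isSubst_reinst {Δ Γ A B D c} (hc : Derivable (tm Δ (B :: A :: Γ) c (wk 2 D))) :
    IsSubst (fun n => match n with
      | 0 => c
      | n + 1 => Tm.var (n + 2)) Δ (D :: Γ) Δ (B :: A :: Γ) := by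
  refine isSubst_cons (a := c) ?_ (by rwa [← wk_eq_subst]) rfl
  have h := hc.ctx_of_tm
  refine ⟨h, fun n E hn => ?_, Tm.var, mapsVars_var_crisp h, fun n => ?_⟩
  · rw [← wk_eq_subst, wk_wk]
    exact .var (n := n + 2) h hn
  · simp [wk, rename, Nat.add_assoc]

theorem inst₂_reinst₂ (C c a b : Tm) : inst₂ (reinst₂ C c) a b = inst C (inst₂ c a b) := by
  simp only [inst₂, reinst₂, inst, subst_subst]
  congr 1; funext n; cases n <;> rfl

open Tm Judgment

/-! ### Formation of derived types -/

theorem Derivable.var_of {Δ Γ n A B} (h : Derivable (ctx Δ Γ)) (hn : (Γ ++ Δ)[n]? = some A)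
    (e : wk (n + 1) A = B) : Derivable (tm Δ Γ (Tm.var n) B) :=
  e ▸ .var h hn

theorem Derivable.app_of {Δ Γ A B C f a} (hf : Derivable (tm Δ Γ f (Tm.pi A B)))
    (ha : Derivable (tm Δ Γ a A)) (e : inst B a = C) : Derivable (tm Δ Γ (Tm.app f a) C) :=
  e ▸ .app hf ha

theorem wk_arrow (k : ℕ) (A B : Tm) : wk k (arrow A B) = arrow (wk k A) (wk k B) := by
  simp [wk, arrow, rename, rename_rename, liftRen]

theorem Derivable.app_arrow {Δ Γ A B f a} (hf : Derivable (tm Δ Γ f (arrow A B)))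
    (ha : Derivable (tm Δ Γ a A)) : Derivable (tm Δ Γ (Tm.app f a) B) :=
  .app_of hf ha (inst_wk _ _)

theorem Derivable.type_wk_one {Δ Γ B A i} (h : Derivable (tm Δ Γ A (Tm.univ i)))
    (h' : Derivable (ctx Δ (B :: Γ))) : Derivable (tm Δ (B :: Γ) (wk 1 A) (Tm.univ i)) :=
  h.tm_wk_one h'

theorem Derivable.arrow {Δ Γ A B i} (hA : Derivable (tm Δ Γ A (Tm.univ i)))
    (hB : Derivable (tm Δ Γ B (Tm.univ i))) : Derivable (tm Δ Γ (arrow A B) (Tm.univ i)) :=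
  .pi hA (hB.type_wk_one (.ctx_cohesive hA))

theorem Derivable.prod {Δ Γ A B i} (hA : Derivable (tm Δ Γ A (Tm.univ i)))
    (hB : Derivable (tm Δ Γ B (Tm.univ i))) : Derivable (tm Δ Γ (prod A B) (Tm.univ i)) :=
  .sig hA (hB.type_wk_one (.ctx_cohesive hA))

theorem Derivable.isEquiv {Δ Γ A B f i} (hA : Derivable (tm Δ Γ A (Tm.univ i)))
    (hB : Derivable (tm Δ Γ B (Tm.univ i))) (hf : Derivable (tm Δ Γ f (Tm.arrow A B))) :
    Derivable (tm Δ Γ (isEquiv A B f) (Tm.univ i)) := by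
  have hBA := hB.arrow hA
  have c₁ := Derivable.ctx_cohesive hBA
  have hA₁ := hA.type_wk_one c₁
  have hB₁ := hB.type_wk_one c₁
  have hf₁ := hf.tm_wk_one c₁
  have ca := Derivable.ctx_cohesive hA₁
  have cb := Derivable.ctx_cohesive hB₁
  have key : ∀ {D}, Derivable (ctx Δ (D :: Tm.arrow B A :: Γ)) →
      Derivable (tm Δ (D :: Tm.arrow B A :: Γ) (Tm.var 1) (Tm.arrow (wk 2 B) (wk 2 A))) ∧
      Derivable (tm Δ (D :: Tm.arrow B A :: Γ) (wk 2 f) (Tm.arrow (wk 2 A) (wk 2 B))) ∧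
      Derivable (tm Δ (D :: Tm.arrow B A :: Γ) (wk 2 A) (Tm.univ i)) ∧
      Derivable (tm Δ (D :: Tm.arrow B A :: Γ) (wk 2 B) (Tm.univ i)) := by
    intro D c
    have hA₂ := hA₁.type_wk_one c
    have hB₂ := hB₁.type_wk_one c
    have hf₂ := hf₁.tm_wk_one c
    rw [wk_wk] at hA₂ hB₂ hf₂
    rw [wk_wk, wk_arrow] at hf₂
    exact ⟨.var_of c rfl (wk_arrow 2 B A), hf₂, hA₂, hB₂⟩
  obtain ⟨g, f', hA₂, hB₂⟩ := key ca
  obtain ⟨g', f'', hA₂', hB₂'⟩ := key cb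
  refine .prod (.sig hBA (.pi hB₁ (.id hB₂' (f''.app_arrow (g'.app_arrow ?_)) ?_)))
    (.sig hBA (.pi hA₁ (.id hA₂ (g.app_arrow (f'.app_arrow ?_)) ?_)))
  all_goals exact .var_of (by assumption) rfl (wk_wk 1 1 _)

/-- The rule for `funext` has only a context as premise, so its presupposition has to be derived by
hand. The level is `i + 1` because the type quantifies over `univ i`. -/
theorem Derivable.funextType {Δ Γ} (i : ℕ) (c : Derivable (ctx Δ Γ)) :
    Derivable (tm Δ Γ (funextType i) (Tm.univ (i + 1))) := by
  have t₀ := Derivable.univ (i := i) c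
  have c₁ := Derivable.ctx_cohesive t₀
  have t₁ : Derivable (tm Δ (Tm.univ i :: Γ) (Tm.arrow (Tm.var 0) (Tm.univ i))
      (Tm.univ (i + 1))) :=
    .arrow (.cumul (.var_of c₁ rfl rfl)) (.univ c₁)
  have c₂ := Derivable.ctx_cohesive t₁
  have t₂ : Derivable (tm Δ (Tm.arrow (Tm.var 0) (Tm.univ i) :: Tm.univ i :: Γ)
      (Tm.pi (Tm.var 1) (Tm.app (Tm.var 1) (Tm.var 0))) (Tm.univ i)) := by
    have h := Derivable.var_of (n := 1) c₂ rfl rfl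
    have c := Derivable.ctx_cohesive h
    exact .pi h (.app_of (.var_of c rfl rfl) (.var_of c rfl rfl) rfl)
  have c₃ := Derivable.ctx_cohesive t₂
  have t₃ := t₂.type_wk_one c₃
  have c₄ := Derivable.ctx_cohesive t₃
  have t₄ := t₃.type_wk_one c₄
  have h₄ : Derivable (tm Δ _ (Tm.id _ (Tm.var 1) (Tm.var 0)) (Tm.univ i)) :=
    .id t₄ (.var_of c₄ rfl rfl) (.var_of c₄ rfl rfl)
  have a₄ := Derivable.var_of (n := 3) c₄ rfl rfl
  have ca := Derivable.ctx_cohesive a₄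
  have p₄ : Derivable (tm Δ _ (Tm.pi (Tm.var 3) (Tm.id (Tm.app (Tm.var 3) (Tm.var 0))
      (Tm.app (Tm.var 2) (Tm.var 0)) (Tm.app (Tm.var 1) (Tm.var 0)))) (Tm.univ i)) :=
    .pi a₄ (.id (.app_of (.var_of ca rfl rfl) (.var_of ca rfl rfl) rfl)
      (.app_of (.var_of ca rfl rfl) (.var_of ca rfl rfl) rfl)
      (.app_of (.var_of ca rfl rfl) (.var_of ca rfl rfl) rfl))
  have c₅ := Derivable.ctx_cohesive h₄
  have t₅ := t₄.type_wk_one c₅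
  have c₆ := Derivable.ctx_cohesive t₅
  have t₆ := t₅.type_wk_one c₆
  have h₆ : Derivable (tm Δ _ (Tm.id _ (Tm.var 3) (Tm.var 0)) (Tm.univ i)) :=
    .id t₆ (.var_of c₆ rfl rfl) (.var_of c₆ rfl rfl)
  have c₇ := Derivable.ctx_cohesive h₆
  have a₇ := Derivable.var_of (n := 6) c₇ rfl rfl
  have cb := Derivable.ctx_cohesive a₇
  have a₅ := Derivable.var_of (n := 4) c₅ rfl rfl
  have cc := Derivable.ctx_cohesive a₅
  refine .pi t₀ (.pi t₁ (.pi t₂.cumul (.pi t₃.cumul (.isEquiv h₄.cumul p₄.cumul ?_))))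
  refine .lam h₄ (.indId (a := Tm.var 2) (.var_of c₅ rfl rfl)
    (C := Tm.pi (Tm.var 6) (Tm.id (Tm.app (Tm.var 6) (Tm.var 0))
      (Tm.app (Tm.var 5) (Tm.var 0)) (Tm.app (Tm.var 2) (Tm.var 0)))) (i := i)
    (.pi a₇ (.id (.app_of (.var_of cb rfl rfl) (.var_of cb rfl rfl) rfl)
      (.app_of (.var_of cb rfl rfl) (.var_of cb rfl rfl) rfl)
      (.app_of (.var_of cb rfl rfl) (.var_of cb rfl rfl) rfl)))
    (.lam a₅ (.refl (.app_of (.var_of cc rfl rfl) (.var_of cc rfl rfl) rfl)))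
    (.var_of c₅ rfl rfl) (.var_of c₅ rfl rfl))

/-! ### Presuppositions -/

theorem inst_liftRen_wk (B : Tm) : inst (rename (liftRen (· + 1)) B) (Tm.var 0) = B := by
  rw [inst, subst_rename]
  conv_rhs => rw [← subst_id B]
  congr 1; funext n; cases n <;> rfl

def Presupposition : Judgment → Prop
  | ctx _ _ => True
  | tm Δ Γ _ A => ∃ i, Derivable (tm Δ Γ A (Tm.univ i))
  | eq Δ Γ t u A => Derivable (tm Δ Γ t A) ∧ Derivable (tm Δ Γ u A) ∧
      ∃ i, Derivable (tm Δ Γ A (Tm.univ i))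

theorem inst_id_wk (A a b : Tm) : inst (Tm.id (wk 1 A) (wk 1 a) (Tm.var 0)) b = Tm.id A a b := by
  have h := inst_wk A b
  have h' := inst_wk a b
  simp only [inst] at h h' ⊢
  simp only [subst, h, h']; rfl

theorem Derivable.tm_inst₂ {Δ Γ A B C D a b} (h : Derivable (tm Δ (B :: A :: Γ) C D))
    (ha : Derivable (tm Δ Γ a A)) (hb : Derivable (tm Δ Γ b (inst B a))) :
    Derivable (tm Δ Γ (inst₂ C a b) (inst₂ D a b)) :=
  h.tm_subst (isSubst_double ha hb)

theorem Derivable.eq_inst₂ {Δ Γ A B C C' D a b} (h : Derivable (eq Δ (B :: A :: Γ) C C' D))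
    (ha : Derivable (tm Δ Γ a A)) (hb : Derivable (tm Δ Γ b (inst B a))) :
    Derivable (eq Δ Γ (inst₂ C a b) (inst₂ C' a b) (inst₂ D a b)) :=
  h.eq_subst (isSubst_double ha hb)

theorem Derivable.eq_reinst₂ {Δ Γ A B C C' D E c} (h : Derivable (eq Δ (E :: Γ) C C' D))
    (hc : Derivable (tm Δ (B :: A :: Γ) c (wk 2 E))) :
    Derivable (eq Δ (B :: A :: Γ) (reinst₂ C c) (reinst₂ C' c) (reinst₂ D c)) :=
  h.eq_subst (isSubst_reinst hc)

/-- The generic element of a `Σ`-type. -/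
theorem Derivable.pair_var {Δ Γ A B} (c : Derivable (ctx Δ (B :: A :: Γ))) :
    Derivable (tm Δ (B :: A :: Γ) (Tm.pair (Tm.var 1) (Tm.var 0)) (wk 2 (Tm.sig A B))) := by
  obtain ⟨i, hB⟩ := c.ctx_cons_inv
  obtain ⟨j, hA⟩ := hB.ctx_of_tm.ctx_cons_inv
  have hA₂ := (hA.type_wk_one hB.ctx_of_tm).type_wk_one c
  rw [wk_wk] at hA₂
  refine .pair (A := wk 2 A) (B := rename (liftRen (· + 2)) B) (i := i) ?_
    (.var_of c rfl rfl) (.var_of c rfl ?_)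
  · have hσ : IsSubst (fun n => Tm.var (liftRen (· + 2) n)) Δ (A :: Γ) Δ
        (wk 2 A :: B :: A :: Γ) := by
      have := (isRenaming_wk (Γ := Γ) (Γ' := [B, A]) c)
      have c' := Derivable.ctx_cohesive hA₂
      refine isSubst_cons (a := Tm.var 0) ⟨c', fun n E hn => ?_, Tm.var,
        mapsVars_var_crisp c', fun n => ?_⟩ ?_ rfl
      · rw [subst_var]
        refine .var_of (n := n + 3) c' hn ?_
        simp only [wk, rename_rename, liftRen]; congr 1
      · simp [wk, rename, liftRen, Nat.add_assoc]
      · refine .var_of c' rfl ?_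
        rw [subst_var, wk_wk]; rfl
    have := hB.tm_subst hσ
    rwa [subst_var] at this
  · rw [wk_eq_subst, inst, subst_rename]
    congr 1; funext n; cases n <;> rfl

theorem Derivable.succ_var {Δ Γ C} (c : Derivable (ctx Δ (C :: Tm.nat :: Γ))) :
    Derivable (tm Δ (C :: Tm.nat :: Γ) (Tm.succ (Tm.var 1)) (wk 2 Tm.nat)) :=
  .succ (.var_of c rfl rfl)

/-- In the congruence rules the right-hand side is first typed at its own type. It is then brought
to the stated type by functionality (`inst_congr`, `tm_substEq`), and under binders by a change of
the context (`tm_conv_ctx`). -/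
theorem Derivable.presupposition {J : Judgment} (h : Derivable J) : Presupposition J := by
  induction h with
  | ctx_nil => trivial
  | ctx_crisp _ _ => trivial
  | ctx_cohesive _ _ => trivial
  | var h hn _ => exact h.lookup_type hn
  | eq_refl h ih => exact ⟨h, h, ih⟩
  | eq_symm _ ih => exact ⟨ih.2.1, ih.1, ih.2.2⟩
  | eq_trans _ _ ih₁ ih₂ => exact ⟨ih₁.1, ih₂.2.1, ih₁.2.2⟩
  | conv _ _ _ ih => exact ⟨_, ih.2.1⟩
  | eq_conv _ h ih₁ ih₂ => exact ⟨.conv ih₁.1 h, .conv ih₁.2.1 h, _, ih₂.2.1⟩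
  | univ h _ => exact ⟨_, .univ h⟩
  | cumul h _ => exact ⟨_, .univ h.ctx_of_tm⟩
  | eq_cumul h ih => exact ⟨.cumul ih.1, .cumul ih.2.1, _, .univ h.ctx_of_eq⟩
  | pi h _ _ _ => exact ⟨_, .univ h.ctx_of_tm⟩
  | pi_congr h e _ _ ih₂ ih₃ =>
    exact ⟨.pi h ih₃.1, .pi ih₂.2.1 (ih₃.2.1.tm_conv_ctx ih₂.2.1 e), _, .univ h.ctx_of_tm⟩
  | @lam Δ Γ A B b i h _ _ ih =>
    obtain ⟨j, hB⟩ := ih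
    exact ⟨max i j, .pi (h.cumul_le (le_max_left _ _)) (hB.cumul_le (le_max_right _ _))⟩
  | @lam_congr Δ Γ A A' B b b' i h e _ _ ih₂ ih₃ =>
    obtain ⟨h₁, h₂, j, hB⟩ := ih₃
    have h' := h.cumul_le (le_max_left i j)
    have e' := e.eq_cumul_le (le_max_left i j)
    have hB' := hB.cumul_le (le_max_right i j)
    exact ⟨.lam h h₁, .conv (.lam ih₂.2.1 (h₂.tm_conv_ctx ih₂.2.1 e))
      (.eq_symm (.pi_congr h' e' (.eq_refl hB'))), _, .pi h' hB'⟩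
  | app hf ha ih _ =>
    obtain ⟨_, h⟩ := ih
    obtain ⟨_, hA, hB⟩ := h.pi_inv
    exact ⟨_, hB.tm_inst ha⟩
  | app_congr _ e ih₁ ih₂ =>
    obtain ⟨hf, hf', _, h⟩ := ih₁
    obtain ⟨_, hA, hB⟩ := h.pi_inv
    exact ⟨.app hf ih₂.1, .conv (.app hf' ih₂.2.1)
      (.eq_symm (Derivable.inst_congr (.eq_refl hB) hB ih₂.1 ih₂.2.1 e)), _, hB.tm_inst ih₂.1⟩
  | pi_beta hb ha ih₁ _ =>
    obtain ⟨_, hB⟩ := ih₁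
    obtain ⟨_, hA⟩ := hb.ctx_of_tm.ctx_cons_inv
    exact ⟨.app (.lam hA hb) ha, hb.tm_inst ha, _, hB.tm_inst ha⟩
  | pi_eta hf ih =>
    obtain ⟨_, h⟩ := ih
    obtain ⟨_, hA, hB⟩ := h.pi_inv
    exact ⟨hf, .lam hA (.app_of (hf.tm_wk_one hB.ctx_of_tm) (.var hB.ctx_of_tm rfl)
      (inst_liftRen_wk _)), _, h⟩
  | sig h _ _ _ => exact ⟨_, .univ h.ctx_of_tm⟩
  | sig_congr h e _ _ ih₂ ih₃ =>
    exact ⟨.sig h ih₃.1, .sig ih₂.2.1 (ih₃.2.1.tm_conv_ctx ih₂.2.1 e), _, .univ h.ctx_of_tm⟩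
  | @pair Δ Γ A B a b i hB _ _ _ _ _ =>
    obtain ⟨j, hA⟩ := hB.ctx_of_tm.ctx_cons_inv
    exact ⟨max i j, .sig (hA.cumul_le (le_max_right _ _)) (hB.cumul_le (le_max_left _ _))⟩
  | @pair_congr Δ Γ A B a a' b b' i hB e _ _ ih₂ ih₃ =>
    obtain ⟨j, hA⟩ := hB.ctx_of_tm.ctx_cons_inv
    exact ⟨.pair hB ih₂.1 ih₃.1, .pair hB ih₂.2.1
      (.conv ih₃.2.1 (Derivable.inst_congr (.eq_refl hB) hB ih₂.1 ih₂.2.1 e)),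
      max i j, .sig (hA.cumul_le (le_max_right _ _)) (hB.cumul_le (le_max_left _ _))⟩
  | indSig hC _ hp _ _ _ => exact ⟨_, hC.tm_inst hp⟩
  | indSig_congr eC eg ep ih₁ ih₂ ih₃ =>
    have c := eg.ctx_of_eq
    exact ⟨.indSig ih₁.1 ih₂.1 ih₃.1,
      .conv (.indSig ih₁.2.1 (.conv ih₂.2.1 (eC.eq_reinst₂ (.pair_var c))) ih₃.2.1)
        (.eq_symm (Derivable.inst_congr eC ih₁.2.1 ih₃.1 ih₃.2.1 ep)), _, ih₁.1.tm_inst ih₃.1⟩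
  | sig_beta hC hg ha hb _ _ _ _ =>
    obtain ⟨_, hB⟩ := hg.ctx_of_tm.ctx_cons_inv
    have hp := Derivable.pair hB ha hb
    have h := hg.tm_inst₂ ha hb
    rw [inst₂_reinst₂] at h
    exact ⟨.indSig hC hg hp, h, _, hC.tm_inst hp⟩
  | unit h _ => exact ⟨_, .univ h⟩
  | star h _ => exact ⟨0, .unit h⟩
  | indUnit hC _ ht _ _ _ => exact ⟨_, hC.tm_inst ht⟩
  | indUnit_congr eC ec et ih₁ ih₂ ih₃ =>
    exact ⟨.indUnit ih₁.1 ih₂.1 ih₃.1,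
      .conv (.indUnit ih₁.2.1 (.conv ih₂.2.1 (eC.eq_inst (.star ec.ctx_of_eq))) ih₃.2.1)
        (.eq_symm (Derivable.inst_congr eC ih₁.2.1 ih₃.1 ih₃.2.1 et)), _, ih₁.1.tm_inst ih₃.1⟩
  | unit_beta hC hc _ ih =>
    exact ⟨.indUnit hC hc (.star hc.ctx_of_tm), hc, ih⟩
  | nat h _ => exact ⟨_, .univ h⟩
  | zero h _ => exact ⟨0, .nat h⟩
  | succ h _ => exact ⟨0, .nat h.ctx_of_tm⟩
  | succ_congr h ih => exact ⟨.succ ih.1, .succ ih.2.1, 0, .nat h.ctx_of_eq⟩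
  | indNat hC _ _ ht _ _ _ _ => exact ⟨_, hC.tm_inst ht⟩
  | indNat_congr eC e₀ es et ih₁ ih₂ ih₃ ih₄ =>
    have c := es.ctx_of_eq
    exact ⟨.indNat ih₁.1 ih₂.1 ih₃.1 ih₄.1,
      .conv (.indNat ih₁.2.1 (.conv ih₂.2.1 (eC.eq_inst (.zero e₀.ctx_of_eq)))
        (.tm_conv_ctx (.conv ih₃.2.1 (eC.eq_reinst₂ (.succ_var c))) ih₁.2.1 eC) ih₄.2.1)
        (.eq_symm (Derivable.inst_congr eC ih₁.2.1 ih₄.1 ih₄.2.1 et)), _, ih₁.1.tm_inst ih₄.1⟩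
  | nat_beta_zero hC h₀ hs _ ih _ => exact ⟨.indNat hC h₀ hs (.zero h₀.ctx_of_tm), h₀, ih⟩
  | nat_beta_succ hC h₀ hs ht _ _ _ _ =>
    have h := hs.tm_inst₂ ht (.indNat hC h₀ hs ht)
    rw [inst₂_reinst₂] at h
    exact ⟨.indNat hC h₀ hs (.succ ht), h, _, hC.tm_inst (.succ ht)⟩
  | id h _ _ _ _ _ => exact ⟨_, .univ h.ctx_of_tm⟩
  | id_congr eA ea eb ih₁ ih₂ ih₃ =>
    exact ⟨.id ih₁.1 ih₂.1 ih₃.1,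
      .id ih₁.2.1 (.conv ih₂.2.1 eA) (.conv ih₃.2.1 eA), _, .univ eA.ctx_of_eq⟩
  | refl h ih =>
    obtain ⟨_, hA⟩ := ih
    exact ⟨_, .id hA h h⟩
  | refl_congr e ih =>
    obtain ⟨h, h', _, hA⟩ := ih
    exact ⟨.refl h, .conv (.refl h') (.eq_symm (.id_congr (.eq_refl hA) e e)), _, .id hA h h⟩
  | indId _ hC _ hb hp _ _ _ _ _ =>
    exact ⟨_, hC.tm_inst₂ hb (by rwa [inst_id_wk])⟩
  | indId_congr ha eC ec eb ep ih₁ ih₂ ih₃ ih₄ ih₅ =>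
    obtain ⟨_, hA⟩ := ih₁
    have hp' := Derivable.conv ih₅.2.1 (.id_congr (.eq_refl hA) (.eq_refl ha) eb)
    refine ⟨.indId ha ih₂.1 ih₃.1 ih₄.1 ih₅.1,
      .conv (.indId ha ih₂.2.1 (.conv ih₃.2.1 (eC.eq_inst₂ ha ?_)) ih₄.2.1 hp')
        (.eq_symm (.eq_trans (eC.eq_inst₂ ih₄.1 ?_) (ih₂.2.1.tm_substEq (isSubstEq_double
          ih₄.1 ih₄.2.1 eb ?_ ?_ ?_)))), _, ih₂.1.tm_inst₂ ih₄.1 ?_⟩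
    · rw [inst_id_wk]; exact .refl ha
    · rw [inst_id_wk]; exact ih₅.1
    · rw [inst_id_wk]; exact ih₅.1
    · rw [inst_id_wk]; exact hp'
    · rw [inst_id_wk]; exact ep
    · rw [inst_id_wk]; exact ih₅.1
  | id_beta ha hC hc _ _ ih => exact ⟨.indId ha hC hc ha (.refl ha), hc, ih⟩
  | sharp h _ _ _ => exact ⟨_, .univ h⟩
  | sharp_congr h _ _ ih => exact ⟨.sharp h ih.1, .sharp h ih.2.1, _, .univ h⟩
  | sharpIn h _ _ ih =>
    obtain ⟨_, hA⟩ := ih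
    exact ⟨_, .sharp h hA⟩
  | sharpIn_congr h _ _ ih =>
    obtain ⟨h₁, h₂, _, hA⟩ := ih
    exact ⟨.sharpIn h h₁, .sharpIn h h₂, _, .sharp h hA⟩
  | sharpOut h _ _ ih =>
    obtain ⟨_, hA⟩ := ih
    obtain ⟨_, hA⟩ := hA.sharp_inv
    exact ⟨_, hA.tm_wk_nil h⟩
  | sharpOut_congr h _ _ ih =>
    obtain ⟨h₁, h₂, _, hA⟩ := ih
    obtain ⟨_, hA⟩ := hA.sharp_inv
    exact ⟨.sharpOut h h₁, .sharpOut h h₂, _, hA.tm_wk_nil h⟩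
  | sharp_beta h ha _ ih =>
    obtain ⟨_, hA⟩ := ih
    exact ⟨.sharpOut h (.sharpIn ha.ctx_of_tm ha), ha.tm_wk_nil h, _, hA.tm_wk_nil h⟩
  | sharp_eta ha ih =>
    -- The term `a` may use cohesive variables, but under `(-)^♯` these are crisp, and there `a_♯`
    -- can be formed with empty cohesive zone.
    have h := ha.tm_toCrisp
    have := Derivable.sharpOut h.ctx_of_tm h
    simp only [List.length_nil, wk_zero] at this
    exact ⟨.sharpIn ha.ctx_of_tm this, ha, ih⟩
  | funext h _ => exact ⟨_, .funextType _ h⟩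

theorem Derivable.exists_type {Δ Γ t A} (h : Derivable (tm Δ Γ t A)) :
    ∃ i, Derivable (tm Δ Γ A (Tm.univ i)) := h.presupposition

theorem Derivable.tm_left {Δ Γ t u A} (h : Derivable (eq Δ Γ t u A)) :
    Derivable (tm Δ Γ t A) := h.presupposition.1

theorem Derivable.tm_right {Δ Γ t u A} (h : Derivable (eq Δ Γ t u A)) :
    Derivable (tm Δ Γ u A) := h.presupposition.2.1

open Tm Judgment

/-! ### Raising all universe levels. -/

namespace Tm

/-- Increase all universe levels by `k`. -/
def raise (k : ℕ) : Tm → Tm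
  | var n => var n
  | univ i => univ (i + k)
  | pi A B => pi (raise k A) (raise k B)
  | lam A b => lam (raise k A) (raise k b)
  | app f a => app (raise k f) (raise k a)
  | sig A B => sig (raise k A) (raise k B)
  | pair a b => pair (raise k a) (raise k b)
  | indSig C g p => indSig (raise k C) (raise k g) (raise k p)
  | unit => unit
  | star => star
  | indUnit C c t => indUnit (raise k C) (raise k c) (raise k t)
  | nat => nat
  | zero => zero
  | succ n => succ (raise k n)
  | indNat C c₀ cs t => indNat (raise k C) (raise k c₀) (raise k cs) (raise k t)
  | id A a b => id (raise k A) (raise k a) (raise k b)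
  | refl a => refl (raise k a)
  | indId C c b p => indId (raise k C) (raise k c) (raise k b) (raise k p)
  | sharp A => sharp (raise k A)
  | sharpIn a => sharpIn (raise k a)
  | sharpOut a => sharpOut (raise k a)
  | funext i => funext (i + k)

theorem raise_rename (k : ℕ) (ρ : ℕ → ℕ) (t : Tm) :
    raise k (rename ρ t) = rename ρ (raise k t) := by
  induction t generalizing ρ <;> simp [rename, raise, *]

theorem raise_wk (k l : ℕ) (t : Tm) : raise k (wk l t) = wk l (raise k t) := raise_rename _ _ _

theorem raise_liftSub (k : ℕ) (σ : ℕ → Tm) :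
    (fun n => raise k (liftSub σ n)) = liftSub fun n => raise k (σ n) := by
  funext n
  cases n with
  | zero => rfl
  | succ n => exact raise_wk _ _ _

theorem raise_subst (k : ℕ) (σ : ℕ → Tm) (t : Tm) :
    raise k (subst σ t) = subst (fun n => raise k (σ n)) (raise k t) := by
  induction t generalizing σ <;> simp [subst, raise, ← raise_liftSub, *]

theorem raise_inst (k : ℕ) (t a : Tm) : raise k (inst t a) = inst (raise k t) (raise k a) := by
  rw [inst, raise_subst, inst]
  congr 1; funext n; cases n <;> rfl

theorem raise_inst₂ (k : ℕ) (t a b : Tm) :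
    raise k (inst₂ t a b) = inst₂ (raise k t) (raise k a) (raise k b) := by
  rw [inst₂, raise_subst, inst₂]
  congr 1; funext n
  match n with
  | 0 => rfl
  | 1 => rfl
  | n + 2 => rfl

theorem raise_reinst₂ (k : ℕ) (C c : Tm) :
    raise k (reinst₂ C c) = reinst₂ (raise k C) (raise k c) := by
  rw [reinst₂, raise_subst, reinst₂]
  congr 1; funext n; cases n <;> rfl

theorem raise_funextType (k i : ℕ) : raise k (funextType i) = funextType (i + k) := rfl

end Tm

def Judgment.raise (k : ℕ) : Judgment → Judgment
  | ctx Δ Γ => ctx (Δ.map (Tm.raise k)) (Γ.map (Tm.raise k))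
  | tm Δ Γ t A => tm (Δ.map (Tm.raise k)) (Γ.map (Tm.raise k)) (t.raise k) (A.raise k)
  | eq Δ Γ t u A =>
    eq (Δ.map (Tm.raise k)) (Γ.map (Tm.raise k)) (t.raise k) (u.raise k) (A.raise k)

set_option linter.unnecessarySeqFocus false in
/-- Derivability is invariant under an increase of all universe levels. -/
theorem Derivable.raise (k : ℕ) {J : Judgment} (h : Derivable J) : Derivable (J.raise k) := by
  induction h <;>
    simp only [Judgment.raise, Tm.raise, List.map_cons, List.map_nil, List.map_append, raise_inst,
      raise_inst₂, raise_reinst₂, raise_wk, raise_funextType, Nat.add_right_comm _ 1 k] at *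
  case ctx_nil => exact .ctx_nil
  case ctx_crisp h => exact .ctx_crisp h
  case ctx_cohesive h => exact .ctx_cohesive h
  case var hn h => exact .var h (by rw [← List.map_append, List.getElem?_map, hn]; rfl)
  case eq_symm h => exact .eq_symm h
  case eq_trans h₁ h₂ => exact .eq_trans h₁ h₂
  case sharpOut h₁ h₂ => simpa using Derivable.sharpOut h₁ h₂
  case sharpOut_congr h₁ h₂ => simpa using Derivable.sharpOut_congr h₁ h₂
  case sharp_beta h₁ h₂ => simpa using Derivable.sharp_beta h₁ h₂
  case conv => apply Derivable.conv <;> assumption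
  case eq_conv => apply Derivable.eq_conv <;> assumption
  case eq_refl => apply Derivable.eq_refl <;> assumption
  case univ => apply Derivable.univ <;> assumption
  case cumul => apply Derivable.cumul <;> assumption
  case eq_cumul => apply Derivable.eq_cumul <;> assumption
  case pi => apply Derivable.pi <;> assumption
  case pi_congr => apply Derivable.pi_congr <;> assumption
  case lam => apply Derivable.lam <;> assumption
  case lam_congr => apply Derivable.lam_congr <;> assumption
  case app => apply Derivable.app <;> assumption
  case app_congr => apply Derivable.app_congr <;> assumption
  case pi_beta => apply Derivable.pi_beta <;> assumption
  case pi_eta => apply Derivable.pi_eta <;> assumption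
  case sig => apply Derivable.sig <;> assumption
  case sig_congr => apply Derivable.sig_congr <;> assumption
  case pair => apply Derivable.pair <;> assumption
  case pair_congr => apply Derivable.pair_congr <;> assumption
  case indSig => apply Derivable.indSig <;> assumption
  case indSig_congr => apply Derivable.indSig_congr <;> assumption
  case sig_beta => apply Derivable.sig_beta <;> assumption
  case unit => apply Derivable.unit <;> assumption
  case star => apply Derivable.star <;> assumption
  case indUnit => apply Derivable.indUnit <;> assumption
  case indUnit_congr => apply Derivable.indUnit_congr <;> assumption
  case unit_beta => apply Derivable.unit_beta <;> assumption
  case nat => apply Derivable.nat <;> assumption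
  case zero => apply Derivable.zero <;> assumption
  case succ => apply Derivable.succ <;> assumption
  case succ_congr => apply Derivable.succ_congr <;> assumption
  case indNat => apply Derivable.indNat <;> assumption
  case indNat_congr => apply Derivable.indNat_congr <;> assumption
  case nat_beta_zero => apply Derivable.nat_beta_zero <;> assumption
  case nat_beta_succ => apply Derivable.nat_beta_succ <;> assumption
  case id => apply Derivable.id <;> assumption
  case id_congr => apply Derivable.id_congr <;> assumption
  case refl => apply Derivable.refl <;> assumption
  case refl_congr => apply Derivable.refl_congr <;> assumption
  case indId h₁ h₂ h₃ h₄ h₅ => exact .indId h₁ h₄ h₅ h₂ h₃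
  case indId_congr h₁ h₂ h₃ h₄ h₅ => exact .indId_congr h₁ h₄ h₅ h₂ h₃
  case id_beta => apply Derivable.id_beta <;> assumption
  case sharp => apply Derivable.sharp <;> assumption
  case sharp_congr => apply Derivable.sharp_congr <;> assumption
  case sharpIn => apply Derivable.sharpIn <;> assumption
  case sharpIn_congr => apply Derivable.sharpIn_congr <;> assumption
  case sharp_eta => apply Derivable.sharp_eta <;> assumption
  case funext => apply Derivable.funext <;> assumption

/-! ### A type checker -/

set_option linter.unusedVariables false

noncomputable section

namespace Tm

/-- `wk` under `c` binders, in a form that evaluates efficiently. -/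
def shiftAt (k : ℕ) (t : Tm) : ℕ → Tm :=
  Tm.rec (motive := fun _ => ℕ → Tm)
    (fun n c => bif Nat.ble c n then var (n + k) else var n)
    (fun i _ => univ i)
    (fun _ _ A B c => pi (A c) (B (c + 1)))
    (fun _ _ A b c => lam (A c) (b (c + 1)))
    (fun _ _ f a c => app (f c) (a c))
    (fun _ _ A B c => sig (A c) (B (c + 1)))
    (fun _ _ a b c => pair (a c) (b c))
    (fun _ _ _ C g p c => indSig (C (c + 1)) (g (c + 2)) (p c))
    (fun _ => unit)
    (fun _ => Tm.star)
    (fun _ _ _ C x t c => indUnit (C (c + 1)) (x c) (t c))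
    (fun _ => nat)
    (fun _ => zero)
    (fun _ n c => succ (n c))
    (fun _ _ _ _ C z s t c => indNat (C (c + 1)) (z c) (s (c + 2)) (t c))
    (fun _ _ _ A a b c => Tm.id (A c) (a c) (b c))
    (fun _ a c => Tm.refl (a c))
    (fun _ _ _ _ C x b p c => indId (C (c + 2)) (x c) (b c) (p c))
    (fun _ A c => sharp (A c))
    (fun _ a c => sharpIn (a c))
    (fun _ a c => sharpOut (a c))
    (fun i _ => Tm.funext i)
    t

/-- Efficient version of `wk`. -/
def shift (k : ℕ) (t : Tm) : Tm :=
  match k with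
  | 0 => t
  | k + 1 => shiftAt (k + 1) t 0

/-- The substitution, under `c` binders, of a list of terms for the last variables of the
context. -/
def instAt (l : List Tm) (t : Tm) : ℕ → Tm :=
  Tm.rec (motive := fun _ => ℕ → Tm)
    (fun n c => bif Nat.ble c n then
        match l[n - c]? with
        | some u => shift c u
        | none => var (n - l.length)
      else var n)
    (fun i _ => univ i)
    (fun _ _ A B c => pi (A c) (B (c + 1)))
    (fun _ _ A b c => lam (A c) (b (c + 1)))
    (fun _ _ f a c => app (f c) (a c))
    (fun _ _ A B c => sig (A c) (B (c + 1)))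
    (fun _ _ a b c => pair (a c) (b c))
    (fun _ _ _ C g p c => indSig (C (c + 1)) (g (c + 2)) (p c))
    (fun _ => unit)
    (fun _ => Tm.star)
    (fun _ _ _ C x t c => indUnit (C (c + 1)) (x c) (t c))
    (fun _ => nat)
    (fun _ => zero)
    (fun _ n c => succ (n c))
    (fun _ _ _ _ C z s t c => indNat (C (c + 1)) (z c) (s (c + 2)) (t c))
    (fun _ _ _ A a b c => Tm.id (A c) (a c) (b c))
    (fun _ a c => Tm.refl (a c))
    (fun _ _ _ _ C x b p c => indId (C (c + 2)) (x c) (b c) (p c))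
    (fun _ A c => sharp (A c))
    (fun _ a c => sharpIn (a c))
    (fun _ a c => sharpOut (a c))
    (fun i _ => Tm.funext i)
    t

/-- The inverse of `shift`, where it is defined. -/
def unshift (k : ℕ) (t : Tm) : Tm :=
  match k with
  | 0 => t
  | k + 1 => rename (fun n => n - (k + 1)) t

def instFast (t a : Tm) : Tm := instAt [a] t 0
def instFast₂ (t a b : Tm) : Tm := instAt [b, a] t 0
def reinstFast₂ (C c : Tm) : Tm := instAt [c] (shiftAt 2 C 1) 0

/-- Syntactic equality of raw terms. -/
def beq (t : Tm) : Tm → Bool :=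
  Tm.rec (motive := fun _ => Tm → Bool)
    (fun m t => match t with | var n => Nat.beq m n | _ => false)
    (fun m t => match t with | univ n => Nat.beq m n | _ => false)
    (fun _ _ A B t => match t with | pi A' B' => A A' && B B' | _ => false)
    (fun _ _ A B t => match t with | lam A' B' => A A' && B B' | _ => false)
    (fun _ _ A B t => match t with | app A' B' => A A' && B B' | _ => false)
    (fun _ _ A B t => match t with | sig A' B' => A A' && B B' | _ => false)
    (fun _ _ A B t => match t with | pair A' B' => A A' && B B' | _ => false)
    (fun _ _ _ A B C t =>
      match t with | indSig A' B' C' => A A' && (B B' && C C') | _ => false)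
    (fun t => match t with | unit => true | _ => false)
    (fun t => match t with | Tm.star => true | _ => false)
    (fun _ _ _ A B C t =>
      match t with | indUnit A' B' C' => A A' && (B B' && C C') | _ => false)
    (fun t => match t with | nat => true | _ => false)
    (fun t => match t with | zero => true | _ => false)
    (fun _ A t => match t with | succ A' => A A' | _ => false)
    (fun _ _ _ _ A B C D t =>
      match t with
      | indNat A' B' C' D' => A A' && (B B' && (C C' && D D'))
      | _ => false)
    (fun _ _ _ A B C t => match t with | Tm.id A' B' C' => A A' && (B B' && C C') | _ => false)
    (fun _ A t => match t with | Tm.refl A' => A A' | _ => false)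
    (fun _ _ _ _ A B C D t =>
      match t with
      | indId A' B' C' D' => A A' && (B B' && (C C' && D D'))
      | _ => false)
    (fun _ A t => match t with | sharp A' => A A' | _ => false)
    (fun _ A t => match t with | sharpIn A' => A A' | _ => false)
    (fun _ A t => match t with | sharpOut A' => A A' | _ => false)
    (fun m t => match t with | Tm.funext n => Nat.beq m n | _ => false)
    t

def isPair : Tm → Bool
  | pair _ _ => true
  | _ => false

def isRefl : Tm → Bool
  | Tm.refl _ => true
  | _ => false

end Tm

open Tm
/-- A partial type inference and a partial type checking function.  Their first argument tells
whether the term is to be normalized; both return the resulting term. -/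
structure Engine where
  infer : Bool → List Tm → List Tm → Tm → Option (Tm × Tm)
  check : Bool → List Tm → List Tm → Tm → Tm → Option Tm

namespace Engine

variable (E : Engine)

/-- Check that `A` is a type, and return it with its level. -/
def ty (q : Bool) (Δ Γ : List Tm) (A : Tm) : Option (Tm × ℕ) :=
  (E.infer q Δ Γ A).bind fun r => match r.2 with
    | univ i => some (r.1, i)
    | T => (E.infer true Δ Γ T).bind fun s => match s.2 with
      | univ _ => match s.1 with
        | univ i => some (r.1, i)
        | _ => none
      | _ => none

/-- The type is read off a normal form that is provably equal to `T`; domain and codomain are then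
used as found, so injectivity of `Π` is never invoked. The same applies to `asSig`, `asId` and
`asSharp`. -/
def asPi (Δ Γ : List Tm) (T : Tm) : Option (Tm × Tm) :=
  match T with
  | pi A B => some (A, B)
  | _ => (E.ty true Δ Γ T).bind fun r => match r.1 with
    | pi A B => some (A, B)
    | _ => none

def asSig (Δ Γ : List Tm) (T : Tm) : Option (Tm × Tm) :=
  match T with
  | sig A B => some (A, B)
  | _ => (E.ty true Δ Γ T).bind fun r => match r.1 with
    | sig A B => some (A, B)
    | _ => none

def asId (Δ Γ : List Tm) (T : Tm) : Option (Tm × Tm × Tm) :=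
  match T with
  | Tm.id A a b => some (A, a, b)
  | _ => (E.ty true Δ Γ T).bind fun r => match r.1 with
    | Tm.id A a b => some (A, a, b)
    | _ => none

def asSharp (Δ Γ : List Tm) (T : Tm) : Option Tm :=
  match T with
  | sharp A => some A
  | _ => (E.ty true Δ Γ T).bind fun r => match r.1 with
    | sharp A => some A
    | _ => none

/-- Inclusion of universes, and otherwise syntactic equality. -/
def leSyn (A B : Tm) : Bool :=
  match A with
  | univ i => match B with
    | univ j => Nat.ble i j
    | _ => false
  | _ => beq A B

/-- Convertibility of types up to cumulativity, by normalization. -/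
def subNormal (Δ Γ : List Tm) (A B : Tm) : Bool :=
  match E.ty true Δ Γ A with
  | none => false
  | some r => match E.ty true Δ Γ B with
    | none => false
    | some s => leSyn r.1 s.1

/-- Convertibility of types. -/
def conv (Δ Γ : List Tm) (A B : Tm) : Bool :=
  match beq A B with
  | true => true
  | false => match E.ty true Δ Γ A with
    | none => false
    | some r => match E.ty true Δ Γ B with
      | none => false
      | some s => beq r.1 s.1

/-- Convertibility of terms of type `A`. -/
def convTm (Δ Γ : List Tm) (a b A : Tm) : Bool :=
  match beq a b with
  | true => true
  | false => match E.check true Δ Γ a A with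
    | none => false
    | some a' => match E.check true Δ Γ b A with
      | none => false
      | some b' => beq a' b'

/-- Convertibility of types up to cumulativity. -/
def sub (Δ Γ : List Tm) (S T : Tm) : Bool :=
  match leSyn S T with
  | true => true
  | false => match S with
    | Tm.id A a b => match T with
      | Tm.id A' a' b' => match beq A A' with
        | true => E.convTm Δ Γ a a' A && E.convTm Δ Γ b b' A
        | false => E.subNormal Δ Γ (Tm.id A a b) (Tm.id A' a' b')
      | T => E.subNormal Δ Γ (Tm.id A a b) T
    | S => E.subNormal Δ Γ S T

/-- `(-)^♯`, contracting an `η`-redex of type `♯ A` if `q` holds. -/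
def mkSharpIn (q : Bool) (Δ Γ : List Tm) (a A : Tm) : Tm :=
  match q with
  | false => sharpIn a
  | true => match a with
    -- The rule `sharp_eta` requires `c : ♯ A` over `Δ ∣ Γ` itself, while under `(-)^♯` it is only
    -- known with all variables crisp. Hence `c` is typed again before the contraction.
    | sharpOut c => match E.infer false Δ Γ c with
      | none => sharpIn a
      | some r => match E.sub Δ Γ r.2 (sharp A) with
        | true => c
        | false => sharpIn a
    | _ => sharpIn a

def guard (b : Bool) (x : Option α) : Option α :=
  match b with
  | true => x
  | false => none

def inferApp (q : Bool) (Δ Γ : List Tm) (f a : Tm) : Option (Tm × Tm) :=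
  (E.infer q Δ Γ f).bind fun r => (E.asPi Δ Γ r.2).bind fun P =>
  (E.check q Δ Γ a P.1).bind fun a' =>
  match q with
  | false => some (app r.1 a', instFast P.2 a)
  | true => match r.1 with
    -- The redex is typed afresh from the annotation of the `λ`, which need not coincide with the
    -- domain found for `f`.
    | lam A b => (E.check true Δ Γ (app (lam A b) a') (instFast P.2 a)).bind fun t =>
      some (t, instFast P.2 a)
    | f' => some (app f' a', instFast P.2 a)

def inferBeta (Δ Γ : List Tm) (A b a : Tm) : Option (Tm × Tm) :=
  (E.ty false Δ Γ A).bind fun _ => (E.infer false Δ (A :: Γ) b).bind fun s =>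
  (E.check true Δ Γ a A).bind fun a' =>
  match b with
  -- The identity function occurs as a type ascription; its argument is already normalized.
  | var 0 => some (a', instFast s.2 a')
  | b => (E.check true Δ Γ (instFast b a') (instFast s.2 a')).bind fun t =>
    some (t, instFast s.2 a')

def inferSigElim (q : Bool) (Δ Γ : List Tm) (C g p : Tm) : Option (Tm × Tm) :=
  (E.infer q Δ Γ p).bind fun r => (E.asSig Δ Γ r.2).bind fun P =>
  match q && r.1.isPair with
  | false =>
    (E.ty q Δ (sig P.1 P.2 :: Γ) C).bind fun C' =>
    (E.check q Δ (P.2 :: P.1 :: Γ) g (reinstFast₂ C (pair (var 1) (var 0)))).bind fun g' =>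
    some (indSig C'.1 g' r.1, instFast C p)
  | true => match r.1 with
    | pair a b =>
      (E.ty false Δ (sig P.1 P.2 :: Γ) C).bind fun _ =>
      (E.check false Δ (P.2 :: P.1 :: Γ) g
        (reinstFast₂ C (pair (var 1) (var 0)))).bind fun _ =>
      -- The components are checked against the given `Σ`-type, in place of an inversion of the
      -- typing of the pair.
      (E.check false Δ Γ a P.1).bind fun _ =>
      (E.check false Δ Γ b (instFast P.2 a)).bind fun _ =>
      (E.check true Δ Γ (instFast₂ g a b) (instFast C p)).bind fun t => some (t, instFast C p)
    | _ => none

def inferUnitElim (q : Bool) (Δ Γ : List Tm) (C c t : Tm) : Option (Tm × Tm) :=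
  (E.check q Δ Γ t unit).bind fun t' => (E.ty q Δ (unit :: Γ) C).bind fun C' =>
  (E.check q Δ Γ c (instFast C Tm.star)).bind fun c' =>
  some (indUnit C'.1 c' t', instFast C t)

def inferNatElim (q : Bool) (Δ Γ : List Tm) (C c₀ cs t : Tm) : Option (Tm × Tm) :=
  (E.check q Δ Γ t nat).bind fun t' => (E.ty q Δ (nat :: Γ) C).bind fun C' =>
  (E.check q Δ Γ c₀ (instFast C zero)).bind fun c₀' =>
  (E.check q Δ (C :: nat :: Γ) cs (reinstFast₂ C (succ (var 1)))).bind fun cs' =>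
  match q with
  | false => some (indNat C'.1 c₀' cs' t', instFast C t)
  | true => match t' with
    | zero => some (c₀', instFast C t)
    | succ n =>
      (E.check false Δ Γ n nat).bind fun _ =>
      (E.check true Δ Γ (instFast₂ cs n (indNat C c₀ cs n)) (instFast C t)).bind fun u =>
      some (u, instFast C t)
    | t' => some (indNat C'.1 c₀' cs' t', instFast C t)

def inferIdElim (q : Bool) (Δ Γ : List Tm) (C c b p : Tm) : Option (Tm × Tm) :=
  (E.infer q Δ Γ p).bind fun r => (E.asId Δ Γ r.2).bind fun P =>
  (E.check q Δ Γ b P.1).bind fun b' =>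
  guard (E.sub Δ Γ (Tm.id P.1 P.2.1 P.2.2) (Tm.id P.1 P.2.1 b)) <|
  -- If the path reduces to `refl`, the motive disappears from the result and is only checked, not
  -- normalized.
  (E.ty (q && !r.1.isRefl) Δ
    (Tm.id (shift 1 P.1) (shift 1 P.2.1) (var 0) :: P.1 :: Γ) C).bind fun C' =>
  (E.check q Δ Γ c (instFast₂ C P.2.1 (Tm.refl P.2.1))).bind fun c' =>
  match q && r.1.isRefl with
  | false => some (indId C'.1 c' b' r.1, instFast₂ C b p)
  | true => match r.1 with
    | Tm.refl x =>
      (E.check true Δ Γ P.2.1 P.1).bind fun a' => (E.check true Δ Γ x P.1).bind fun x' =>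
      -- `id_beta` applies only when the endpoint `b` and the argument of `refl` both agree with the
      -- base point.
      guard (beq a' b' && beq a' x') (some (c', instFast₂ C b p))
    | _ => none

def inferSharpOut (q : Bool) (Δ Γ : List Tm) (a : Tm) : Option (Tm × Tm) :=
  -- `unshift` gives a meaningless result when `a` mentions a cohesive variable; shifting back and
  -- comparing detects this.
  guard (beq (shift Γ.length (unshift Γ.length a)) a) <|
  (E.infer q Δ [] (unshift Γ.length a)).bind fun r => (E.asSharp Δ [] r.2).bind fun A =>
  match q with
  | false => some (sharpOut (shift Γ.length r.1), shift Γ.length A)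
  | true => match r.1 with
    | sharpIn c => (E.check false Δ [] c A).bind fun _ =>
      some (shift Γ.length c, shift Γ.length A)
    | a' => some (sharpOut (shift Γ.length a'), shift Γ.length A)

def inferStep (q : Bool) (Δ Γ : List Tm) : Tm → Option (Tm × Tm)
  | var n => (Γ ++ Δ)[n]?.bind fun A => some (var n, shift (n + 1) A)
  | univ i => some (univ i, univ (i + 1))
  | pi A B =>
    (E.ty q Δ Γ A).bind fun r => (E.ty q Δ (A :: Γ) B).bind fun s =>
    some (pi r.1 s.1, univ (max r.2 s.2))
  | lam A b =>
    (E.ty q Δ Γ A).bind fun r => (E.infer q Δ (A :: Γ) b).bind fun s =>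
    some (lam r.1 s.1, pi A s.2)
  | app f a =>
    match q with
    | false => E.inferApp false Δ Γ f a
    | true => match f with
      | lam A b => E.inferBeta Δ Γ A b a
      | f => E.inferApp true Δ Γ f a
  | sig A B =>
    (E.ty q Δ Γ A).bind fun r => (E.ty q Δ (A :: Γ) B).bind fun s =>
    some (sig r.1 s.1, univ (max r.2 s.2))
  | pair a b =>
    (E.infer q Δ Γ a).bind fun r => (E.infer q Δ Γ b).bind fun s =>
    -- Inference can only offer the non-dependent type for a pair. Dependent pairs are checked
    -- against a given type, which is why proof terms carry ascriptions.
    some (pair r.1 s.1, sig r.2 (shift 1 s.2))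
  | indSig C g p => E.inferSigElim q Δ Γ C g p
  | unit => some (unit, univ 0)
  | Tm.star => some (Tm.star, unit)
  | indUnit C c t => E.inferUnitElim q Δ Γ C c t
  | nat => some (nat, univ 0)
  | zero => some (zero, nat)
  | succ n => (E.check q Δ Γ n nat).bind fun n' => some (succ n', nat)
  | indNat C c₀ cs t => E.inferNatElim q Δ Γ C c₀ cs t
  | Tm.id A a b =>
    (E.ty q Δ Γ A).bind fun r => (E.check q Δ Γ a A).bind fun a' =>
    (E.check q Δ Γ b A).bind fun b' => some (Tm.id r.1 a' b', univ r.2)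
  | Tm.refl a => (E.infer q Δ Γ a).bind fun r => some (Tm.refl r.1, Tm.id r.2 a a)
  | indId C c b p => E.inferIdElim q Δ Γ C c b p
  | sharp A => (E.ty q (Γ ++ Δ) [] A).bind fun r => some (sharp r.1, univ r.2)
  | sharpIn a =>
    (E.infer q (Γ ++ Δ) [] a).bind fun r =>
    some (E.mkSharpIn q Δ Γ r.1 r.2, sharp r.2)
  | sharpOut a => E.inferSharpOut q Δ Γ a
  | Tm.funext i => some (Tm.funext i, funextType i)

def checkStep (q : Bool) (Δ Γ : List Tm) (t T : Tm) : Option Tm :=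
  match t with
  | pair a b =>
    (E.asSig Δ Γ T).bind fun P => (E.check q Δ Γ a P.1).bind fun a' =>
    (E.check q Δ Γ b (instFast P.2 a)).bind fun b' => some (pair a' b')
  | lam A b =>
    (E.asPi Δ Γ T).bind fun P => (E.ty q Δ Γ A).bind fun r =>
    guard (E.conv Δ Γ A P.1) <| (E.check q Δ (A :: Γ) b P.2).bind fun b' =>
    some (lam r.1 b')
  | sharpIn a =>
    (E.asSharp Δ Γ T).bind fun A => (E.check q (Γ ++ Δ) [] a A).bind fun a' =>
    some (E.mkSharpIn q Δ Γ a' A)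
  | _ => (E.infer q Δ Γ t).bind fun r => guard (E.sub Δ Γ r.2 T) (some r.1)

def step : Engine where
  infer := inferStep E
  check := checkStep E

end Engine

/-- The type checker with a bound on its recursion depth. -/
def engine : ℕ → Engine
  | 0 => ⟨fun _ _ _ _ => none, fun _ _ _ _ _ => none⟩
  | n + 1 => (engine n).step

def checkClosed (n : ℕ) (t T : Tm) : Bool :=
  ((engine n).ty false [] [] T).isSome && ((engine n).check false [] [] t T).isSome

end

/-! ### Correctness of the efficient syntactic operations. -/

namespace Tm

theorem liftRen_shift (k c : ℕ) :
    liftRen (fun n => bif Nat.ble c n then n + k else n) =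
      fun n => bif Nat.ble (c + 1) n then n + k else n := by
  funext n
  cases n with
  | zero => rfl
  | succ n =>
    simp only [liftRen, Nat.ble]
    cases Nat.ble c n
    · rfl
    · simp only [cond_true]; lia

theorem shiftAt_eq (k : ℕ) (t : Tm) (c : ℕ) :
    shiftAt k t c = rename (fun n => bif Nat.ble c n then n + k else n) t := by
  induction t generalizing c with
  | var n =>
    simp only [shiftAt, rename]
    cases Nat.ble c n <;> rfl
  | _ =>
    simp only [shiftAt] at *
    simp only [rename, liftRen_shift, Nat.add_assoc, Nat.reduceAdd, *]

theorem shift_eq_wk (k : ℕ) (t : Tm) : shift k t = wk k t := by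
  cases k with
  | zero => exact (wk_zero t).symm
  | succ k => exact shiftAt_eq _ _ _

theorem liftSub_instAt (l : List Tm) (c : ℕ) :
    liftSub (fun n => bif Nat.ble c n then
        match l[n - c]? with
        | some u => shift c u
        | none => var (n - l.length)
      else var n) = fun n => bif Nat.ble (c + 1) n then
        match l[n - (c + 1)]? with
        | some u => shift (c + 1) u
        | none => var (n - l.length)
      else var n := by
  funext n
  cases n with
  | zero => rfl
  | succ n =>
    simp only [liftSub, Nat.ble, Nat.add_sub_add_right]
    cases Nat.ble c n with
    | false => rfl
    | true =>
      simp only [cond_true]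
      cases h : l[n - c]? with
      | some u => simp only [shift_eq_wk, wk_wk]
      | none =>
        have := List.getElem?_eq_none_iff.1 h
        simp only [wk, rename]
        congr 1; lia

theorem instAt_eq (l : List Tm) (t : Tm) (c : ℕ) :
    instAt l t c = subst (fun n => bif Nat.ble c n then
        match l[n - c]? with
        | some u => shift c u
        | none => var (n - l.length)
      else var n) t := by
  induction t generalizing c with
  | var n => rfl
  | _ =>
    simp only [instAt] at *
    simp only [subst, liftSub_instAt, Nat.add_assoc, Nat.reduceAdd, *]

theorem instFast_eq (t a : Tm) : instFast t a = inst t a := by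
  rw [instFast, instAt_eq, inst]
  congr 1; funext n; cases n <;> rfl

theorem instFast₂_eq (t a b : Tm) : instFast₂ t a b = inst₂ t a b := by
  rw [instFast₂, instAt_eq, inst₂]
  congr 1; funext n
  match n with
  | 0 => rfl
  | 1 => rfl
  | n + 2 => rfl

theorem reinstFast₂_eq (C c : Tm) : reinstFast₂ C c = reinst₂ C c := by
  rw [reinstFast₂, instAt_eq, shiftAt_eq, subst_rename, reinst₂]
  congr 1; funext n; cases n <;> rfl

theorem eq_of_beq_eq_true {t u : Tm} (h : beq t u = true) : t = u := by
  induction t generalizing u with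
  | var m => cases u with
    | var => exact congrArg _ (Nat.eq_of_beq_eq_true h)
    | _ => exact Bool.noConfusion h
  | univ m => cases u with
    | univ => exact congrArg _ (Nat.eq_of_beq_eq_true h)
    | _ => exact Bool.noConfusion h
  | pi A B h₁ h₂ => cases u with
    | pi =>
      obtain ⟨e₁, e₂⟩ := (Bool.and_eq_true_iff).1 h
      rw [h₁ e₁, h₂ e₂]
    | _ => exact Bool.noConfusion h
  | lam A B h₁ h₂ => cases u with
    | lam =>
      obtain ⟨e₁, e₂⟩ := (Bool.and_eq_true_iff).1 h
      rw [h₁ e₁, h₂ e₂]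
    | _ => exact Bool.noConfusion h
  | app A B h₁ h₂ => cases u with
    | app =>
      obtain ⟨e₁, e₂⟩ := (Bool.and_eq_true_iff).1 h
      rw [h₁ e₁, h₂ e₂]
    | _ => exact Bool.noConfusion h
  | sig A B h₁ h₂ => cases u with
    | sig =>
      obtain ⟨e₁, e₂⟩ := (Bool.and_eq_true_iff).1 h
      rw [h₁ e₁, h₂ e₂]
    | _ => exact Bool.noConfusion h
  | pair A B h₁ h₂ => cases u with
    | pair =>
      obtain ⟨e₁, e₂⟩ := (Bool.and_eq_true_iff).1 h
      rw [h₁ e₁, h₂ e₂]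
    | _ => exact Bool.noConfusion h
  | indSig A B C h₁ h₂ h₃ => cases u with
    | indSig =>
      obtain ⟨e₁, h⟩ := (Bool.and_eq_true_iff).1 h
      obtain ⟨e₂, e₃⟩ := (Bool.and_eq_true_iff).1 h
      rw [h₁ e₁, h₂ e₂, h₃ e₃]
    | _ => exact Bool.noConfusion h
  | unit => cases u with
    | unit => rfl
    | _ => exact Bool.noConfusion h
  | star => cases u with
    | star => rfl
    | _ => exact Bool.noConfusion h
  | indUnit A B C h₁ h₂ h₃ => cases u with
    | indUnit =>
      obtain ⟨e₁, h⟩ := (Bool.and_eq_true_iff).1 h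
      obtain ⟨e₂, e₃⟩ := (Bool.and_eq_true_iff).1 h
      rw [h₁ e₁, h₂ e₂, h₃ e₃]
    | _ => exact Bool.noConfusion h
  | nat => cases u with
    | nat => rfl
    | _ => exact Bool.noConfusion h
  | zero => cases u with
    | zero => rfl
    | _ => exact Bool.noConfusion h
  | succ A h₁ => cases u with
    | succ =>
      exact congrArg _ (h₁ h)
    | _ => exact Bool.noConfusion h
  | indNat A B C D h₁ h₂ h₃ h₄ => cases u with
    | indNat =>
      obtain ⟨e₁, h⟩ := (Bool.and_eq_true_iff).1 h
      obtain ⟨e₂, h⟩ := (Bool.and_eq_true_iff).1 h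
      obtain ⟨e₃, e₄⟩ := (Bool.and_eq_true_iff).1 h
      rw [h₁ e₁, h₂ e₂, h₃ e₃, h₄ e₄]
    | _ => exact Bool.noConfusion h
  | id A B C h₁ h₂ h₃ => cases u with
    | id =>
      obtain ⟨e₁, h⟩ := (Bool.and_eq_true_iff).1 h
      obtain ⟨e₂, e₃⟩ := (Bool.and_eq_true_iff).1 h
      rw [h₁ e₁, h₂ e₂, h₃ e₃]
    | _ => exact Bool.noConfusion h
  | refl A h₁ => cases u with
    | refl =>
      exact congrArg _ (h₁ h)
    | _ => exact Bool.noConfusion h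
  | indId A B C D h₁ h₂ h₃ h₄ => cases u with
    | indId =>
      obtain ⟨e₁, h⟩ := (Bool.and_eq_true_iff).1 h
      obtain ⟨e₂, h⟩ := (Bool.and_eq_true_iff).1 h
      obtain ⟨e₃, e₄⟩ := (Bool.and_eq_true_iff).1 h
      rw [h₁ e₁, h₂ e₂, h₃ e₃, h₄ e₄]
    | _ => exact Bool.noConfusion h
  | sharp A h₁ => cases u with
    | sharp =>
      exact congrArg _ (h₁ h)
    | _ => exact Bool.noConfusion h
  | sharpIn A h₁ => cases u with
    | sharpIn =>
      exact congrArg _ (h₁ h)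
    | _ => exact Bool.noConfusion h
  | sharpOut A h₁ => cases u with
    | sharpOut =>
      exact congrArg _ (h₁ h)
    | _ => exact Bool.noConfusion h
  | funext m => cases u with
    | funext => exact congrArg _ (Nat.eq_of_beq_eq_true h)
    | _ => exact Bool.noConfusion h

end Tm

open Tm Judgment

/-! ### Types, their equality, and soundness of the checker. -/

/-- `A` is a type. -/
def IsType (Δ Γ : List Tm) (A : Tm) : Prop := ∃ i, Derivable (tm Δ Γ A (Tm.univ i))

/-- `A` and `B` are equal types. -/
def TypeEq (Δ Γ : List Tm) (A B : Tm) : Prop := ∃ i, Derivable (eq Δ Γ A B (Tm.univ i))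

theorem IsType.ctx {Δ Γ A} (h : IsType Δ Γ A) : Derivable (Judgment.ctx Δ Γ) :=
  h.choose_spec.ctx_of_tm

theorem IsType.cons {Δ Γ A} (h : IsType Δ Γ A) : Derivable (Judgment.ctx Δ (A :: Γ)) :=
  .ctx_cohesive h.choose_spec

theorem IsType.refl {Δ Γ A} (h : IsType Δ Γ A) : TypeEq Δ Γ A A := ⟨_, .eq_refl h.choose_spec⟩

theorem TypeEq.symm {Δ Γ A B} (h : TypeEq Δ Γ A B) : TypeEq Δ Γ B A :=
  ⟨_, .eq_symm h.choose_spec⟩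

theorem TypeEq.trans {Δ Γ A B C} (h : TypeEq Δ Γ A B) (h' : TypeEq Δ Γ B C) :
    TypeEq Δ Γ A C := by
  obtain ⟨i, h⟩ := h
  obtain ⟨j, h'⟩ := h'
  exact ⟨max i j, .eq_trans (h.eq_cumul_le (le_max_left _ _)) (h'.eq_cumul_le (le_max_right _ _))⟩

theorem TypeEq.right {Δ Γ A B} (h : TypeEq Δ Γ A B) : IsType Δ Γ B :=
  ⟨_, h.choose_spec.tm_right⟩

theorem TypeEq.eq {Δ Γ A B t u} (h : TypeEq Δ Γ A B) (ht : Derivable (Judgment.eq Δ Γ t u A)) :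
    Derivable (Judgment.eq Δ Γ t u B) :=
  .eq_conv ht h.choose_spec

theorem TypeEq.isType_conv_ctx {Δ Γ A A' B} (e : TypeEq Δ Γ A A') (h : IsType Δ (A :: Γ) B) :
    IsType Δ (A' :: Γ) B :=
  ⟨_, h.choose_spec.tm_conv_ctx e.right.choose_spec e.choose_spec⟩

theorem IsType.pi_inv {Δ Γ A B} (h : IsType Δ Γ (Tm.pi A B)) :
    IsType Δ Γ A ∧ IsType Δ (A :: Γ) B :=
  let ⟨_, hA, hB⟩ := h.choose_spec.pi_inv
  ⟨⟨_, hA⟩, _, hB⟩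

theorem IsType.sig_inv {Δ Γ A B} (h : IsType Δ Γ (Tm.sig A B)) :
    IsType Δ Γ A ∧ IsType Δ (A :: Γ) B :=
  let ⟨_, hA, hB⟩ := h.choose_spec.sig_inv
  ⟨⟨_, hA⟩, _, hB⟩

theorem IsType.sharp_inv {Δ Γ A} (h : IsType Δ Γ (Tm.sharp A)) : IsType (Γ ++ Δ) [] A :=
  h.choose_spec.sharp_inv

theorem IsType.inst {Δ Γ A B a} (h : IsType Δ (A :: Γ) B) (ha : Derivable (Judgment.tm Δ Γ a A)) :
    IsType Δ Γ (inst B a) :=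
  ⟨_, h.choose_spec.tm_inst ha⟩

theorem IsType.inst_eq {Δ Γ A B a a'} (h : IsType Δ (A :: Γ) B)
    (e : Derivable (Judgment.eq Δ Γ a a' A)) : TypeEq Δ Γ (Tm.inst B a) (Tm.inst B a') :=
  ⟨_, Derivable.inst_congr (.eq_refl h.choose_spec) h.choose_spec e.tm_left e.tm_right e⟩

theorem IsType.pi_congr {Δ Γ A A' B} (e : TypeEq Δ Γ A A') (h : IsType Δ (A :: Γ) B) :
    TypeEq Δ Γ (Tm.pi A B) (Tm.pi A' B) := by
  obtain ⟨i, e⟩ := e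
  obtain ⟨j, h⟩ := h
  have e' := e.eq_cumul_le (le_max_left i j)
  exact ⟨_, .pi_congr e'.tm_left e' (.eq_refl (h.cumul_le (le_max_right i j)))⟩

theorem IsType.wk_one {Δ Γ A B} (h : IsType Δ Γ A) (hB : IsType Δ Γ B) :
    IsType Δ (B :: Γ) (wk 1 A) :=
  ⟨_, h.choose_spec.type_wk_one hB.cons⟩

theorem isType_of_tm {Δ Γ A t} (h : Derivable (Judgment.tm Δ Γ t A)) : IsType Δ Γ A :=
  h.exists_type

theorem isType_of_eq {Δ Γ A t u} (h : Derivable (Judgment.eq Δ Γ t u A)) : IsType Δ Γ A :=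
  h.tm_left.exists_type

/-- The context of the motive of path induction. -/
theorem IsType.based_path {Δ Γ A a} (hA : IsType Δ Γ A) (ha : Derivable (Judgment.tm Δ Γ a A)) :
    IsType Δ (A :: Γ) (Tm.id (wk 1 A) (wk 1 a) (Tm.var 0)) := by
  obtain ⟨i, h⟩ := hA.wk_one hA
  exact ⟨i, .id h (ha.tm_wk_one hA.cons) (.var hA.cons rfl)⟩

namespace Engine

/-- The results of `E` are correct. -/
structure Sound (E : Engine) : Prop where
  infer {q Δ Γ t t' A} : Derivable (ctx Δ Γ) → E.infer q Δ Γ t = some (t', A) →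
    Derivable (eq Δ Γ t t' A)
  check {q Δ Γ t t' A} : IsType Δ Γ A → E.check q Δ Γ t A = some t' →
    Derivable (eq Δ Γ t t' A)

variable {E : Engine} (hE : E.Sound)

include hE

theorem Sound.ty {q Δ Γ A A' i} (c : Derivable (ctx Δ Γ)) (h : E.ty q Δ Γ A = some (A', i)) :
    Derivable (eq Δ Γ A A' (Tm.univ i)) := by
  obtain ⟨⟨t, T⟩, h₁, h⟩ := Option.bind_eq_some_iff.1 h
  have e₁ := hE.infer c h₁
  dsimp only at h
  split at h
  · cases h; exact e₁
  · obtain ⟨⟨t', T'⟩, h₂, h⟩ := Option.bind_eq_some_iff.1 h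
    have e₂ := hE.infer c h₂
    dsimp only at h e₂
    split at h
    · split at h
      · cases h; exact .eq_conv e₁ e₂
      · cases h
    · cases h

theorem Sound.asPi {Δ Γ T A B} (hT : IsType Δ Γ T) (h : E.asPi Δ Γ T = some (A, B)) :
    TypeEq Δ Γ T (Tm.pi A B) := by
  unfold Engine.asPi at h
  split at h
  · cases h; exact hT.refl
  · obtain ⟨⟨t, i⟩, h₁, h⟩ := Option.bind_eq_some_iff.1 h
    have e := hE.ty hT.ctx h₁
    dsimp only at h
    split at h
    · cases h; exact ⟨_, e⟩
    · cases h

theorem Sound.asSig {Δ Γ T A B} (hT : IsType Δ Γ T) (h : E.asSig Δ Γ T = some (A, B)) :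
    TypeEq Δ Γ T (Tm.sig A B) := by
  unfold Engine.asSig at h
  split at h
  · cases h; exact hT.refl
  · obtain ⟨⟨t, i⟩, h₁, h⟩ := Option.bind_eq_some_iff.1 h
    have e := hE.ty hT.ctx h₁
    dsimp only at h
    split at h
    · cases h; exact ⟨_, e⟩
    · cases h

theorem Sound.asId {Δ Γ T A a b} (hT : IsType Δ Γ T) (h : E.asId Δ Γ T = some (A, a, b)) :
    TypeEq Δ Γ T (Tm.id A a b) := by
  unfold Engine.asId at h
  split at h
  · cases h; exact hT.refl
  · obtain ⟨⟨t, i⟩, h₁, h⟩ := Option.bind_eq_some_iff.1 h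
    have e := hE.ty hT.ctx h₁
    dsimp only at h
    split at h
    · cases h; exact ⟨_, e⟩
    · cases h

theorem Sound.asSharp {Δ Γ T A} (hT : IsType Δ Γ T) (h : E.asSharp Δ Γ T = some A) :
    TypeEq Δ Γ T (Tm.sharp A) := by
  unfold Engine.asSharp at h
  split at h
  · cases h; exact hT.refl
  · obtain ⟨⟨t, i⟩, h₁, h⟩ := Option.bind_eq_some_iff.1 h
    have e := hE.ty hT.ctx h₁
    dsimp only at h
    split at h
    · cases h; exact ⟨_, e⟩
    · cases h

omit hE in
theorem leSyn_sound {A B} (h : leSyn A B = true) {Δ Γ t u} (e : Derivable (eq Δ Γ t u A)) :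
    Derivable (eq Δ Γ t u B) := by
  unfold leSyn at h
  split at h
  · split at h
    · exact e.eq_cumul_le (Nat.le_of_ble_eq_true h)
    · cases h
  · rwa [eq_of_beq_eq_true h] at e

theorem Sound.subNormal {Δ Γ A B} (c : Derivable (ctx Δ Γ)) (h : E.subNormal Δ Γ A B = true)
    {t u} (e : Derivable (eq Δ Γ t u A)) : Derivable (eq Δ Γ t u B) := by
  unfold Engine.subNormal at h
  split at h
  · cases h
  · next r h₁ =>
    split at h
    · cases h
    · next s h₂ =>
      exact .eq_conv (leSyn_sound h (.eq_conv e (hE.ty c h₁))) (.eq_symm (hE.ty c h₂))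

theorem Sound.conv {Δ Γ A B} (hA : IsType Δ Γ A) (h : E.conv Δ Γ A B = true) :
    TypeEq Δ Γ A B := by
  unfold Engine.conv at h
  split at h
  · next e => rw [← eq_of_beq_eq_true e]; exact hA.refl
  · split at h
    · cases h
    · next r h₁ =>
      split at h
      · cases h
      · next s h₂ =>
        refine TypeEq.trans ⟨_, hE.ty hA.ctx h₁⟩ (TypeEq.symm ?_)
        rw [eq_of_beq_eq_true h]
        exact ⟨_, hE.ty hA.ctx h₂⟩

theorem Sound.convTm {Δ Γ a b A} (ha : Derivable (tm Δ Γ a A)) (h : E.convTm Δ Γ a b A = true) :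
    Derivable (eq Δ Γ a b A) := by
  have hA := isType_of_tm ha
  unfold Engine.convTm at h
  split at h
  · next e => rw [← eq_of_beq_eq_true e]; exact .eq_refl ha
  · split at h
    · cases h
    · next r h₁ =>
      split at h
      · cases h
      · next s h₂ =>
        refine .eq_trans (hE.check hA h₁) (.eq_symm ?_)
        rw [eq_of_beq_eq_true h]
        exact hE.check hA h₂

theorem Sound.sub {Δ Γ S T} (h : E.sub Δ Γ S T = true) {t u} (e : Derivable (eq Δ Γ t u S)) :
    Derivable (eq Δ Γ t u T) := by
  have c := e.ctx_of_eq
  unfold Engine.sub at h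
  split at h
  · next h' => exact leSyn_sound h' e
  · split at h
    · next A a b =>
      split at h
      · next A' a' b' =>
        split at h
        · next hA =>
          obtain ⟨i, hid⟩ := isType_of_eq e
          obtain ⟨j, hA', ha, hb⟩ := hid.id_inv
          rw [Bool.and_eq_true] at h
          rw [← eq_of_beq_eq_true hA]
          exact .eq_conv e (.id_congr (.eq_refl hA') (hE.convTm ha h.1) (hE.convTm hb h.2))
        · exact hE.subNormal c h e
      · exact hE.subNormal c h e
    · exact hE.subNormal c h e

theorem Sound.mkSharpIn {q Δ Γ a a' A} (c : Derivable (ctx Δ Γ))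
    (e : Derivable (eq (Γ ++ Δ) [] a a' A)) :
    Derivable (eq Δ Γ (Tm.sharpIn a) (E.mkSharpIn q Δ Γ a' A) (Tm.sharp A)) := by
  have e' := Derivable.sharpIn_congr c e
  unfold Engine.mkSharpIn
  split
  · exact e'
  · split
    · split
      · exact e'
      · next r h₁ =>
        split
        · next h₂ =>
          exact .eq_trans e' (.sharp_eta (hE.sub h₂ (.eq_refl (hE.infer c h₁).tm_left)).tm_left)
        · exact e'
    · exact e'

omit hE in
theorem guard_eq_some {α} {b : Bool} {x : Option α} {y} (h : guard b x = some y) :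
    b = true ∧ x = some y := by
  cases b
  · cases h
  · exact ⟨rfl, h⟩

theorem Sound.inferApp {q Δ Γ f a t A} (c : Derivable (ctx Δ Γ))
    (h : E.inferApp q Δ Γ f a = some (t, A)) : Derivable (eq Δ Γ (Tm.app f a) t A) := by
  obtain ⟨⟨f', T⟩, h₁, h⟩ := Option.bind_eq_some_iff.1 h
  obtain ⟨⟨P, B⟩, h₂, h⟩ := Option.bind_eq_some_iff.1 h
  obtain ⟨a', h₃, h⟩ := Option.bind_eq_some_iff.1 h
  have ef := hE.infer c h₁
  have eT := hE.asPi (isType_of_eq ef) h₂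
  obtain ⟨hP, hB⟩ := eT.right.pi_inv
  have ea := hE.check hP h₃
  have e := Derivable.app_congr (eT.eq ef) ea
  simp only [instFast_eq] at h
  split at h
  · cases h; exact e
  · split at h
    · obtain ⟨u, h₄, h⟩ := Option.bind_eq_some_iff.1 h
      cases h
      exact .eq_trans e (hE.check (isType_of_eq e) h₄)
    · cases h; exact e

theorem Sound.inferBeta {Δ Γ A b a t T} (c : Derivable (ctx Δ Γ))
    (h : E.inferBeta Δ Γ A b a = some (t, T)) :
    Derivable (eq Δ Γ (Tm.app (Tm.lam A b) a) t T) := by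
  obtain ⟨⟨A', i⟩, h₁, h⟩ := Option.bind_eq_some_iff.1 h
  obtain ⟨⟨b', B⟩, h₂, h⟩ := Option.bind_eq_some_iff.1 h
  obtain ⟨a', h₃, h⟩ := Option.bind_eq_some_iff.1 h
  have hA := (hE.ty c h₁).tm_left
  have hb := (hE.infer (.ctx_cohesive hA) h₂).tm_left
  have ea := hE.check ⟨_, hA⟩ h₃
  have hB := isType_of_tm hb
  have e := Derivable.eq_trans ((hB.inst_eq ea).eq
    (.app_congr (.eq_refl (.lam hA hb)) ea)) (.pi_beta hb ea.tm_right)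
  simp only [instFast_eq] at h
  split at h
  · cases h; exact e
  · obtain ⟨u, h₄, h⟩ := Option.bind_eq_some_iff.1 h
    cases h
    exact .eq_trans e (hE.check (isType_of_eq e) h₄)

theorem Sound.inferSigElim {q Δ Γ C g p t T} (c : Derivable (ctx Δ Γ))
    (h : E.inferSigElim q Δ Γ C g p = some (t, T)) :
    Derivable (eq Δ Γ (Tm.indSig C g p) t T) := by
  obtain ⟨⟨p', S⟩, h₁, h⟩ := Option.bind_eq_some_iff.1 h
  obtain ⟨⟨A, B⟩, h₂, h⟩ := Option.bind_eq_some_iff.1 h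
  have ep := hE.infer c h₁
  have eS := hE.asSig (isType_of_eq ep) h₂
  replace ep := eS.eq ep
  obtain ⟨hA, hB⟩ := eS.right.sig_inv
  simp only [instFast_eq, instFast₂_eq, reinstFast₂_eq] at h
  have hR : ∀ {D}, IsType Δ (Tm.sig A B :: Γ) D →
      IsType Δ (B :: A :: Γ) (reinst₂ D (Tm.pair (Tm.var 1) (Tm.var 0))) := fun hD =>
    ⟨_, hD.choose_spec.tm_subst (isSubst_reinst (.pair_var hB.cons))⟩
  split at h
  · obtain ⟨⟨C', i⟩, h₃, h⟩ := Option.bind_eq_some_iff.1 h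
    obtain ⟨g', h₄, h⟩ := Option.bind_eq_some_iff.1 h
    cases h
    have eC := hE.ty eS.right.cons h₃
    exact .indSig_congr eC (hE.check (hR ⟨_, eC.tm_left⟩) h₄) ep
  · split at h
    · next a b =>
      obtain ⟨⟨C', i⟩, h₃, h⟩ := Option.bind_eq_some_iff.1 h
      obtain ⟨g', h₄, h⟩ := Option.bind_eq_some_iff.1 h
      obtain ⟨a', h₅, h⟩ := Option.bind_eq_some_iff.1 h
      obtain ⟨b', h₆, h⟩ := Option.bind_eq_some_iff.1 h
      obtain ⟨u, h₇, h⟩ := Option.bind_eq_some_iff.1 h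
      cases h
      have hC := (hE.ty eS.right.cons h₃).tm_left
      have hg := (hE.check (hR ⟨_, hC⟩) h₄).tm_left
      have ha := (hE.check hA h₅).tm_left
      have hb := (hE.check (hB.inst ha) h₆).tm_left
      have e := Derivable.eq_trans (.indSig_congr (.eq_refl hC) (.eq_refl hg) ep)
        ((IsType.inst_eq ⟨_, hC⟩ (.eq_symm ep)).eq (.sig_beta hC hg ha hb))
      exact .eq_trans e (hE.check (isType_of_eq e) h₇)
    · cases h

theorem Sound.inferUnitElim {q Δ Γ C d t u T} (c : Derivable (ctx Δ Γ))
    (h : E.inferUnitElim q Δ Γ C d t = some (u, T)) :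
    Derivable (eq Δ Γ (Tm.indUnit C d t) u T) := by
  obtain ⟨t', h₁, h⟩ := Option.bind_eq_some_iff.1 h
  obtain ⟨⟨C', i⟩, h₂, h⟩ := Option.bind_eq_some_iff.1 h
  obtain ⟨d', h₃, h⟩ := Option.bind_eq_some_iff.1 h
  have hU : IsType Δ Γ Tm.unit := ⟨0, .unit c⟩
  have eC := hE.ty hU.cons h₂
  simp only [instFast_eq] at h h₃
  cases h
  exact .indUnit_congr eC (hE.check (IsType.inst ⟨_, eC.tm_left⟩ (.star c)) h₃) (hE.check hU h₁)

theorem Sound.inferNatElim {q Δ Γ C c₀ cs t u T} (c : Derivable (ctx Δ Γ))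
    (h : E.inferNatElim q Δ Γ C c₀ cs t = some (u, T)) :
    Derivable (eq Δ Γ (Tm.indNat C c₀ cs t) u T) := by
  obtain ⟨t', h₁, h⟩ := Option.bind_eq_some_iff.1 h
  obtain ⟨⟨C', i⟩, h₂, h⟩ := Option.bind_eq_some_iff.1 h
  obtain ⟨c₀', h₃, h⟩ := Option.bind_eq_some_iff.1 h
  obtain ⟨cs', h₄, h⟩ := Option.bind_eq_some_iff.1 h
  have hN : IsType Δ Γ Tm.nat := ⟨0, .nat c⟩
  have et := hE.check hN h₁
  have eC := hE.ty hN.cons h₂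
  have hC : IsType Δ (Tm.nat :: Γ) C := ⟨_, eC.tm_left⟩
  simp only [instFast_eq, instFast₂_eq, reinstFast₂_eq] at h h₃ h₄
  have e₀ := hE.check (hC.inst (.zero c)) h₃
  have es := hE.check ⟨_, eC.tm_left.tm_subst (isSubst_reinst (.succ_var hC.cons))⟩ h₄
  have e := Derivable.indNat_congr eC e₀ es et
  have e' := Derivable.indNat_congr (.eq_refl eC.tm_left) (.eq_refl e₀.tm_left)
    (.eq_refl es.tm_left) et
  split at h
  · cases h; exact e
  · split at h
    · cases h
      exact .eq_trans e' ((hC.inst_eq (.eq_symm et)).eq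
        (.eq_trans (.nat_beta_zero eC.tm_left e₀.tm_left es.tm_left) e₀))
    · next n =>
      obtain ⟨n', h₅, h⟩ := Option.bind_eq_some_iff.1 h
      obtain ⟨u, h₆, h⟩ := Option.bind_eq_some_iff.1 h
      cases h
      have hn := (hE.check hN h₅).tm_left
      exact .eq_trans e' (.eq_trans ((hC.inst_eq (.eq_symm et)).eq
        (.nat_beta_succ eC.tm_left e₀.tm_left es.tm_left hn)) (hE.check (isType_of_eq e) h₆))
    · cases h; exact e

theorem Sound.inferIdElim {q Δ Γ C d b p t T} (c : Derivable (ctx Δ Γ))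
    (h : E.inferIdElim q Δ Γ C d b p = some (t, T)) :
    Derivable (eq Δ Γ (Tm.indId C d b p) t T) := by
  obtain ⟨⟨p', S⟩, h₁, h⟩ := Option.bind_eq_some_iff.1 h
  obtain ⟨⟨A, a, b₀⟩, h₂, h⟩ := Option.bind_eq_some_iff.1 h
  obtain ⟨b', h₃, h⟩ := Option.bind_eq_some_iff.1 h
  obtain ⟨h₄, h⟩ := guard_eq_some h
  obtain ⟨⟨C', i⟩, h₅, h⟩ := Option.bind_eq_some_iff.1 h
  obtain ⟨d', h₆, h⟩ := Option.bind_eq_some_iff.1 h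
  have ep := hE.infer c h₁
  have eS := hE.asId (isType_of_eq ep) h₂
  replace ep := hE.sub h₄ (eS.eq ep)
  obtain ⟨j, hA, ha, -⟩ := eS.right.choose_spec.id_inv
  have hA' : IsType Δ Γ A := ⟨_, hA⟩
  have eb := hE.check hA' h₃
  simp only [instFast₂_eq, shift_eq_wk] at h h₅ h₆
  have eC := hE.ty (hA'.based_path ha).cons h₅
  have ed := hE.check ⟨_, eC.tm_left.tm_inst₂ ha (by rw [inst_id_wk]; exact .refl ha)⟩ h₆
  split at h
  · cases h
    exact .indId_congr ha eC ed eb ep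
  · split at h
    · obtain ⟨a', h₇, h⟩ := Option.bind_eq_some_iff.1 h
      obtain ⟨x', h₈, h⟩ := Option.bind_eq_some_iff.1 h
      obtain ⟨h₉, h⟩ := guard_eq_some h
      cases h
      rw [Bool.and_eq_true] at h₉
      -- From the comparison of normal forms, `b` and `x` are equal to `a`, hence `p` is equal to
      -- `refl a`. Both are replaced so that `id_beta` applies, and functionality of the motive
      -- moves the result back to the type at `b` and `p`.
      have eab := Derivable.eq_symm (hE.check hA' h₇)
      have eax := Derivable.eq_symm (hE.check hA' h₈)
      rw [← eq_of_beq_eq_true h₉.2] at eax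
      have exa := Derivable.eq_symm (.eq_trans (.eq_symm eab) eax)
      rw [← eq_of_beq_eq_true h₉.1] at eb
      have eba := Derivable.eq_trans eb eab
      have er := Derivable.eq_conv (.refl_congr exa)
        (.id_congr (.eq_refl hA) exa (.eq_trans exa (.eq_symm eba)))
      have epr := Derivable.eq_trans ep er
      refine .eq_trans (.indId_congr ha (.eq_refl eC.tm_left) (.eq_refl ed.tm_left) eba epr)
        (.eq_conv (.eq_trans (.id_beta ha eC.tm_left ed.tm_left) ed)
          (.eq_symm (eC.tm_left.tm_substEq (isSubstEq_double eba.tm_left ha eba ?_ ?_ ?_))))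
      · rw [inst_id_wk]; exact epr.tm_left
      · rw [inst_id_wk]; exact .refl ha
      · rw [inst_id_wk]; exact epr
    · cases h

theorem Sound.inferSharpOut {q Δ Γ a t T} (c : Derivable (ctx Δ Γ))
    (h : E.inferSharpOut q Δ Γ a = some (t, T)) :
    Derivable (eq Δ Γ (Tm.sharpOut a) t T) := by
  obtain ⟨h₀, h⟩ := guard_eq_some h
  obtain ⟨⟨u, S⟩, h₁, h⟩ := Option.bind_eq_some_iff.1 h
  obtain ⟨A, h₂, h⟩ := Option.bind_eq_some_iff.1 h
  have h₀ := eq_of_beq_eq_true h₀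
  simp only [shift_eq_wk] at h h₀
  have eu := hE.infer c.ctx_crispZone h₁
  have eS := hE.asSharp (isType_of_eq eu) h₂
  have e := Derivable.sharpOut_congr c (eS.eq eu)
  rw [h₀] at e
  split at h
  · cases h; exact e
  · split at h
    · obtain ⟨d, h₃, h⟩ := Option.bind_eq_some_iff.1 h
      cases h
      exact .eq_trans e (.sharp_beta c (hE.check eS.right.sharp_inv h₃).tm_left)
    · cases h; exact e

theorem Sound.inferStep {q Δ Γ t t' A} (c : Derivable (ctx Δ Γ))
    (h : E.inferStep q Δ Γ t = some (t', A)) : Derivable (eq Δ Γ t t' A) := by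
  cases t with
  | var n =>
    obtain ⟨B, h₁, h⟩ := Option.bind_eq_some_iff.1 h
    cases h
    rw [shift_eq_wk]
    exact .eq_refl (.var c h₁)
  | univ i => cases h; exact .eq_refl (.univ c)
  | pi A B =>
    obtain ⟨⟨A', i⟩, h₁, h⟩ := Option.bind_eq_some_iff.1 h
    obtain ⟨⟨B', j⟩, h₂, h⟩ := Option.bind_eq_some_iff.1 h
    cases h
    have eA := (hE.ty c h₁).eq_cumul_le (le_max_left i j)
    exact .pi_congr eA.tm_left eA
      ((hE.ty (.ctx_cohesive eA.tm_left) h₂).eq_cumul_le (le_max_right i j))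
  | sig A B =>
    obtain ⟨⟨A', i⟩, h₁, h⟩ := Option.bind_eq_some_iff.1 h
    obtain ⟨⟨B', j⟩, h₂, h⟩ := Option.bind_eq_some_iff.1 h
    cases h
    have eA := (hE.ty c h₁).eq_cumul_le (le_max_left i j)
    exact .sig_congr eA.tm_left eA
      ((hE.ty (.ctx_cohesive eA.tm_left) h₂).eq_cumul_le (le_max_right i j))
  | lam A b =>
    obtain ⟨⟨A', i⟩, h₁, h⟩ := Option.bind_eq_some_iff.1 h
    obtain ⟨⟨b', B⟩, h₂, h⟩ := Option.bind_eq_some_iff.1 h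
    cases h
    have eA := hE.ty c h₁
    exact .lam_congr eA.tm_left eA (hE.infer (.ctx_cohesive eA.tm_left) h₂)
  | app f a =>
    simp only [Engine.inferStep] at h
    split at h
    · exact hE.inferApp c h
    · split at h
      · exact hE.inferBeta c h
      · exact hE.inferApp c h
  | pair a b =>
    obtain ⟨⟨a', A⟩, h₁, h⟩ := Option.bind_eq_some_iff.1 h
    obtain ⟨⟨b', B⟩, h₂, h⟩ := Option.bind_eq_some_iff.1 h
    cases h
    have ea := hE.infer c h₁
    have eb := hE.infer c h₂
    rw [shift_eq_wk]
    exact .pair_congr ((isType_of_eq eb).wk_one (isType_of_eq ea)).choose_spec ea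
      (by rwa [inst_wk])
  | indSig C g p => exact hE.inferSigElim c h
  | unit => cases h; exact .eq_refl (.unit c)
  | star => cases h; exact .eq_refl (.star c)
  | indUnit C d t => exact hE.inferUnitElim c h
  | nat => cases h; exact .eq_refl (.nat c)
  | zero => cases h; exact .eq_refl (.zero c)
  | succ n =>
    obtain ⟨n', h₁, h⟩ := Option.bind_eq_some_iff.1 h
    cases h
    exact .succ_congr (hE.check ⟨0, .nat c⟩ h₁)
  | indNat C c₀ cs t => exact hE.inferNatElim c h
  | id A a b =>
    obtain ⟨⟨A', i⟩, h₁, h⟩ := Option.bind_eq_some_iff.1 h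
    obtain ⟨a', h₂, h⟩ := Option.bind_eq_some_iff.1 h
    obtain ⟨b', h₃, h⟩ := Option.bind_eq_some_iff.1 h
    cases h
    have eA := hE.ty c h₁
    exact .id_congr eA (hE.check ⟨_, eA.tm_left⟩ h₂) (hE.check ⟨_, eA.tm_left⟩ h₃)
  | refl a =>
    obtain ⟨⟨a', A⟩, h₁, h⟩ := Option.bind_eq_some_iff.1 h
    cases h
    exact .refl_congr (hE.infer c h₁)
  | indId C d b p => exact hE.inferIdElim c h
  | sharp A =>
    obtain ⟨⟨A', i⟩, h₁, h⟩ := Option.bind_eq_some_iff.1 h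
    cases h
    exact .sharp_congr c (hE.ty c.ctx_toCrisp h₁)
  | sharpIn a =>
    obtain ⟨⟨a', A⟩, h₁, h⟩ := Option.bind_eq_some_iff.1 h
    cases h
    exact hE.mkSharpIn c (hE.infer c.ctx_toCrisp h₁)
  | sharpOut a => exact hE.inferSharpOut c h
  | funext i => cases h; exact .eq_refl (.funext c)

theorem Sound.checkStep {q Δ Γ t t' T} (hT : IsType Δ Γ T)
    (h : E.checkStep q Δ Γ t T = some t') : Derivable (eq Δ Γ t t' T) := by
  have c := hT.ctx
  unfold Engine.checkStep at h
  split at h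
  · obtain ⟨⟨A, B⟩, h₁, h⟩ := Option.bind_eq_some_iff.1 h
    obtain ⟨a', h₂, h⟩ := Option.bind_eq_some_iff.1 h
    obtain ⟨b', h₃, h⟩ := Option.bind_eq_some_iff.1 h
    cases h
    have eT := hE.asSig hT h₁
    obtain ⟨hA, hB⟩ := eT.right.sig_inv
    have ea := hE.check hA h₂
    rw [instFast_eq] at h₃
    exact eT.symm.eq (.pair_congr hB.choose_spec ea (hE.check (hB.inst ea.tm_left) h₃))
  · obtain ⟨⟨A, B⟩, h₁, h⟩ := Option.bind_eq_some_iff.1 h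
    obtain ⟨⟨A', i⟩, h₂, h⟩ := Option.bind_eq_some_iff.1 h
    obtain ⟨h₃, h⟩ := guard_eq_some h
    obtain ⟨b', h₄, h⟩ := Option.bind_eq_some_iff.1 h
    cases h
    have eT := hE.asPi hT h₁
    obtain ⟨hA, hB⟩ := eT.right.pi_inv
    have eA := hE.ty c h₂
    have eAA := hE.conv ⟨_, eA.tm_left⟩ h₃
    have hB' := eAA.symm.isType_conv_ctx hB
    exact eT.symm.eq ((IsType.pi_congr eAA hB').eq (.lam_congr eA.tm_left eA (hE.check hB' h₄)))
  · obtain ⟨A, h₁, h⟩ := Option.bind_eq_some_iff.1 h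
    obtain ⟨a', h₂, h⟩ := Option.bind_eq_some_iff.1 h
    cases h
    have eT := hE.asSharp hT h₁
    exact eT.symm.eq (hE.mkSharpIn c (hE.check eT.right.sharp_inv h₂))
  · obtain ⟨⟨u, S⟩, h₁, h⟩ := Option.bind_eq_some_iff.1 h
    obtain ⟨h₂, h⟩ := guard_eq_some h
    cases h
    exact hE.sub h₂ (hE.infer c h₁)

theorem Sound.step : E.step.Sound where
  infer c h := hE.inferStep c h
  check hT h := hE.checkStep hT h

end Engine

theorem engine_sound (n : ℕ) : (engine n).Sound := by
  induction n with
  | zero => exact ⟨fun _ h => (nomatch h), fun _ h => (nomatch h)⟩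
  | succ n ih => exact ih.step

theorem derivable_of_checkClosed {n t T} (h : checkClosed n t T = true) :
    Derivable (tm [] [] t T) := by
  rw [checkClosed, Bool.and_eq_true, Option.isSome_iff_exists, Option.isSome_iff_exists] at h
  obtain ⟨⟨⟨T', i⟩, hT⟩, t', ht⟩ := h
  have hE := engine_sound n
  exact (hE.check ⟨_, (hE.ty .ctx_nil hT).tm_left⟩ ht).tm_left

/-! ### Terms with named variables -/

/-- Terms in a context of variable length: the argument is the number of variables, and a
variable is represented by its position in the context (a de Bruijn level). -/
abbrev HTm : Type := ℕ → Tm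

namespace HTm

/-- The scope of a bound variable. -/
def bind (b : HTm → HTm) : HTm := fun d => b (fun e => .var (e - (d + 1))) (d + 1)
def univ (i : ℕ) : HTm := fun _ => .univ i
def pi (A : HTm) (B : HTm → HTm) : HTm := fun d => .pi (A d) (bind B d)
def lam (A : HTm) (b : HTm → HTm) : HTm := fun d => .lam (A d) (bind b d)
def sig (A : HTm) (B : HTm → HTm) : HTm := fun d => .sig (A d) (bind B d)
def app (f a : HTm) : HTm := fun d => .app (f d) (a d)
def pair (a b : HTm) : HTm := fun d => .pair (a d) (b d)
def refl (a : HTm) : HTm := fun d => .refl (a d)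
def eq (A a b : HTm) : HTm := fun d => .id (A d) (a d) (b d)
def nat : HTm := fun _ => .nat
def zero : HTm := fun _ => .zero
def succ (n : HTm) : HTm := fun d => .succ (n d)
def sharp (A : HTm) : HTm := fun d => .sharp (A d)
def inn (a : HTm) : HTm := fun d => .sharpIn (a d)
def out (a : HTm) : HTm := fun d => .sharpOut (a d)
def funext (i : ℕ) : HTm := fun _ => .funext i
def indSig (C : HTm → HTm) (g : HTm → HTm → HTm) (p : HTm) : HTm :=
  fun d => .indSig (bind C d) (bind (fun x => bind (g x)) d) (p d)
def indNat (C : HTm → HTm) (z : HTm) (s : HTm → HTm → HTm) (n : HTm) : HTm :=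
  fun d => .indNat (bind C d) (z d) (bind (fun x => bind (s x)) d) (n d)
def indId (C : HTm → HTm → HTm) (c b p : HTm) : HTm :=
  fun d => .indId (bind (fun x => bind (C x)) d) (c d) (b d) (p d)
def apSharpIn (A x y p : HTm) : HTm := fun d => .apSharpIn (A d) (x d) (y d) (p d)
def sharpMap (A f : HTm) : HTm := fun d => .sharpMap (A d) (f d)
def isEquiv (A B f : HTm) : HTm := fun d => .isEquiv (A d) (B d) (f d)
def isTruncated (n A : HTm) : HTm := fun d => .isTruncated 0 (n d) (A d)

infixl:90 " ⬝ " => app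

def arrow (A B : HTm) : HTm := pi A fun _ => B

def prod (A B : HTm) : HTm := sig A fun _ => B

/-! ### Projections, operations on paths, and function extensionality in applied form. -/

/-- `a`, annotated with its type. -/
def ascribe (A a : HTm) : HTm := app (lam A fun x => x) a

/-- The first projection of `p : Σ (x : A), B x`. -/
def fst (A : HTm) (B : HTm → HTm) (p : HTm) : HTm :=
  indSig (fun _ => A) (fun x _ => x) (ascribe (sig A B) p)

/-- The second projection of `p : Σ (x : A), B x`. -/
def snd (A : HTm) (B : HTm → HTm) (p : HTm) : HTm :=
  indSig (fun z => B (fst A B z)) (fun _ y => y) (ascribe (sig A B) p)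

/-- For `p : a = b` and `s : a = c`, a proof of `b = c`. -/
def cancel (A a b c p s : HTm) : HTm :=
  app (indId (fun y _ => arrow (eq A a c) (eq A y c)) (lam (eq A a c) fun s => s) b p) s

/-- For `p : a = b` and `s : F b = c`, a proof of `F a = c`. -/
def apTrans (B : HTm) (F : HTm → HTm) (a b c p s : HTm) : HTm :=
  app (indId (fun y _ => arrow (eq B (F y) c) (eq B (F a) c)) (lam (eq B (F a) c) fun s => s)
    b p) s

/-- For `p : a = b`, a proof of `cancel p p = refl`. -/
def cancelSelf (A a b p : HTm) : HTm :=
  indId (fun y q => eq (eq A y y) (cancel A a y y q q) (refl y)) (refl (refl a)) b p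

/-- Pointwise equal functions in `𝒰₀` are equal, by function extensionality. -/
def funextApply : HTm :=
  lam (univ 0) fun A => lam (arrow A (univ 0)) fun B =>
  lam (pi A fun x => B ⬝ x) fun f => lam (pi A fun x => B ⬝ x) fun g =>
  lam (pi A fun x => eq (B ⬝ x) (f ⬝ x) (g ⬝ x)) fun h =>
    let M := arrow (pi A fun x => eq (B ⬝ x) (f ⬝ x) (g ⬝ x)) (eq (pi A fun x => B ⬝ x) f g)
    indSig (fun _ => M) (fun x _ => indSig (fun _ => M) (fun k _ => k) x)
      (funext 0 ⬝ A ⬝ B ⬝ f ⬝ g) ⬝ h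

/-- The type of `funextApply`. -/
def funextApplyTy : HTm :=
  pi (univ 0) fun A => pi (arrow A (univ 0)) fun B =>
  pi (pi A fun x => B ⬝ x) fun f => pi (pi A fun x => B ⬝ x) fun g =>
  arrow (pi A fun x => eq (B ⬝ x) (f ⬝ x) (g ⬝ x)) (eq (pi A fun x => B ⬝ x) f g)

/-! ### Stability of the identity types of codiscrete types. -/

/-- The codiscrete type `♯ (X_♯)` given by `X : ♯ 𝒰₀`. -/
def T (X : HTm) : HTm := sharp (out X)
/-- `♯ 𝒰₀` -/
def sharpU : HTm := sharp (univ 0)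

/-- The type expressing that the identity types of codiscrete types are `♯`-stable. -/
def stableTy : HTm :=
  pi sharpU fun X => pi (T X) fun z => pi (T X) fun z' =>
  arrow (sharp (eq (T X) z z')) (eq (T X) z z')

/-- The identity types of codiscrete types are `♯`-stable, by function extensionality: the two
functions `(y : ♯X) → (z = y) → ♯X` sending `(y, p)` to `y` and to `z` are equal, and any
`u : ♯ (z = z')` allows to evaluate them at `(z', u_♯)`. -/
def weakStable (fe : HTm) : HTm :=
  lam sharpU fun X => lam (T X) fun z => lam (T X) fun z' =>
  lam (sharp (eq (T X) z z')) fun u =>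
    let Ψ := fun y => arrow (eq (T X) z y) (T X)
    let Φ := pi (T X) Ψ
    let F₁ := lam (T X) fun y => lam (eq (T X) z y) fun _ => y
    let F₂ := lam (T X) fun y => lam (eq (T X) z y) fun _ => z
    -- Two uses of function extensionality give `F₂ = F₁`, from the constant `z` to the projection
    -- `y`; pointwise the required equality is the argument `p : z = y` itself.
    let q := fe ⬝ T X ⬝ (lam (T X) Ψ) ⬝ F₂ ⬝ F₁ ⬝ (lam (T X) fun y =>
      fe ⬝ eq (T X) z y ⬝ (lam (eq (T X) z y) fun _ => T X) ⬝
        (lam (eq (T X) z y) fun _ => z) ⬝ (lam (eq (T X) z y) fun _ => y) ⬝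
        (lam (eq (T X) z y) fun p => p))
    -- `u` may be eliminated here because it stands under `(-)^♯`. By `sharp_eta` the motive is `z =
    -- z` at `F₂` and `z = z'` at `F₁`.
    indId (fun f _ => eq (T X) z (inn (out (f ⬝ z' ⬝ out u)))) (refl z) (ascribe Φ F₁) q

/-- `weakStable`, normalized such that `refl^♯` is sent to `refl`. -/
def stable (s : HTm) : HTm :=
  lam sharpU fun X => lam (T X) fun z => lam (T X) fun z' =>
  lam (sharp (eq (T X) z z')) fun u =>
    cancel (T X) z z z' (s ⬝ X ⬝ z ⬝ z ⬝ inn (refl z)) (s ⬝ X ⬝ z ⬝ z' ⬝ u)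

/-- The type expressing that `r` sends `p^♯` to `p`. -/
def stableReflTy (r : HTm) : HTm :=
  pi sharpU fun X => pi (T X) fun z => pi (T X) fun z' => pi (eq (T X) z z') fun p =>
  eq (eq (T X) z z') (r ⬝ X ⬝ z ⬝ z' ⬝ inn p) p

/-- `stable s` sends `p^♯` to `p`. -/
def stableRefl (s : HTm) : HTm :=
  lam sharpU fun X => lam (T X) fun z => lam (T X) fun z' => lam (eq (T X) z z') fun p =>
  indId (fun y p => eq (eq (T X) z y) (stable s ⬝ X ⬝ z ⬝ y ⬝ inn p) p)
    (cancelSelf (T X) z z (s ⬝ X ⬝ z ⬝ z ⬝ inn (refl z))) z' p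

/-! ### The modality: elimination, and stability under identity types. -/

/-- `♯` is a modality. -/
def isModality (r ρ : HTm) : HTm :=
  pair
    (lam (univ 0) fun A => lam (arrow (sharp A) (univ 0)) fun B =>
      pair
        (lam (pi A fun a => sharp (B ⬝ inn a)) fun f => lam (sharp A) fun z =>
          inn (out (f ⬝ out z)))
        -- At `a^♯` the eliminator is `((f a)_♯)^♯`, which is judgmentally `f a`.
        (lam (pi A fun a => sharp (B ⬝ inn a)) fun f => lam A fun a => refl (f ⬝ a)))
    (lam (univ 0) fun A => lam (sharp A) fun z => lam (sharp A) fun z' =>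
      let P := eq (sharp A) z z'
      let r' := r ⬝ inn A ⬝ z ⬝ z'
      pair
        -- Stability for `♯ P` reduces `(r' w)^♯ = w` to a statement under `♯`. There `w` is
        -- `(w_♯)^♯`, and `ρ` identifies `r' w` with `w_♯`.
        (pair r' (lam (sharp P) fun w => r ⬝ inn P ⬝ inn (r' ⬝ w) ⬝ w ⬝
          inn (apSharpIn P (r' ⬝ w) (out w) (ρ ⬝ inn A ⬝ z ⬝ z' ⬝ out w))))
        (pair r' (lam P fun p => ρ ⬝ inn A ⬝ z ⬝ z' ⬝ p)))

/-! ### Identity types of `♯` by encoding and decoding. -/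

/-- `z = z' → ♯(z_♯ = z'_♯)` -/
def enc (X z z' q : HTm) : HTm :=
  indId (fun y _ => sharp (eq (out X) (out z) (out y))) (inn (refl (out z))) z' q

/-- `♯ (z_♯ = z'_♯) → z = z'` -/
def dec (r X z z' u : HTm) : HTm :=
  -- Under `(-)^♯`, applying `(-)^♯` to `u_♯` gives a path from `(z_♯)^♯` to `(z'_♯)^♯`; by `η`
  -- these endpoints are `z` and `z'`.
  r ⬝ X ⬝ z ⬝ z' ⬝ inn (apSharpIn (out X) (out z) (out z') (out u))

/-- `dec (enc q) = q` -/
def decEnc (r ρ X z z' q : HTm) : HTm :=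
  indId (fun y q => eq (eq (T X) z y) (dec r X z y (enc X z y q)) q)
    -- At `refl z` the encoded path is `(refl z_♯)^♯`, on which `ap` computes to `refl z` by `η`, so
    -- that `ρ` applies.
    (ρ ⬝ X ⬝ z ⬝ z ⬝ refl z) z' q

/-- `enc (ap p) = p^♯` -/
def encAp (A x y p : HTm) : HTm :=
  indId (fun y p => eq (sharp (eq A x y))
      (enc (inn A) (inn x) (inn y) (apSharpIn A x y p)) (inn p))
    (refl (inn (refl x))) y p

/-- `♯` preserves identity types. -/
def pathSharp (r ρ : HTm) : HTm :=
  lam (univ 0) fun A => lam A fun x => lam A fun y =>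
    let P := eq A x y
    let Q := eq (sharp A) (inn x) (inn y)
    let e := enc (inn A) (inn x) (inn y)
    let g := dec r (inn A) (inn x) (inn y)
    let g' := lam (sharp P) g
    pair (lam Q e) (pair
      (pair
        -- For `e (g u) = u` stability again allows work under `♯`, with `u_♯ : x = y`. There `ρ`
        -- turns `g u` into `ap u_♯`, which `encAp` sends to `(u_♯)^♯`, that is, to `u`.
        (pair g' (lam (sharp P) fun u => r ⬝ inn P ⬝ e (g u) ⬝ u ⬝
          inn (apTrans (sharp P) e (g u) (apSharpIn A x y (out u)) u
            (ρ ⬝ inn A ⬝ inn x ⬝ inn y ⬝ apSharpIn A x y (out u)) (encAp A x y (out u)))))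
        (pair g' (lam Q fun q => decEnc r ρ (inn A) (inn x) (inn y) q)))
      (lam P fun p => encAp A x y p))

/-- The term `L r ρ : S`, where `r : stableTy` and `ρ` is a proof that `r` sends `p^♯` to `p`. -/
def withStable (L : HTm → HTm → HTm) (S : HTm) : HTm :=
  -- The redexes act as local definitions: `L` is checked with `r` and `ρ` as variables, so that
  -- normalization there does not unfold the construction by function extensionality.
  (lam stableTy fun s =>
    (lam stableTy fun r => lam (stableReflTy r) fun ρ => ascribe S (L r ρ)) ⬝
      stable s ⬝ stableRefl s) ⬝
  ((lam funextApplyTy weakStable) ⬝ funextApply)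

/-! ### Pullbacks. -/

/-- Types `A`, `B`, `C` and maps `f : A → C` and `g : B → C`. -/
structure Cospan where
  A : HTm
  B : HTm
  C : HTm
  f : HTm
  g : HTm

namespace Cospan
variable (D : Cospan) (r ρ : HTm)

/-- `Σ (y : B), f x = g y` -/
def pb₂ (x : HTm) : HTm := sig D.B fun y => eq D.C (D.f ⬝ x) (D.g ⬝ y)
/-- The pullback. -/
def pb : HTm := sig D.A D.pb₂

/-- Elimination of the pullback. -/
def elim (M : HTm → HTm) (g : HTm → HTm → HTm → HTm) (v : HTm) : HTm :=
  indSig M (fun x w => indSig (fun w => M (pair x w)) (g x) (ascribe (D.pb₂ x) w))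
    (ascribe D.pb v)

def pr₁ : HTm → HTm := fst D.A D.pb₂
def pr₂ : HTm → HTm := D.elim (fun _ => D.B) fun _ y _ => y
def pr₃ : HTm → HTm := D.elim (fun v => eq D.C (D.f ⬝ D.pr₁ v) (D.g ⬝ D.pr₂ v)) fun _ _ p => p
/-- The image of the cospan under `♯`. -/
def sharp : Cospan := ⟨D.A.sharp, D.B.sharp, D.C.sharp, sharpMap D.A D.f, sharpMap D.B D.g⟩

/-- For `p : f a = g b`, the path from `♯ f a^♯` to `♯ g b^♯`. -/
def cmpPath (a b p : HTm) : HTm :=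
  -- The path passes through `r` instead of being a plain `ap`, so that `a`, `b` and `p` occur only
  -- under `(-)^♯`. They may then be the components of `w_♯` for a cohesive `w`.
  r ⬝ inn D.C ⬝ inn (D.f ⬝ a) ⬝ inn (D.g ⬝ b) ⬝ inn (apSharpIn D.C (D.f ⬝ a) (D.g ⬝ b) p)

/-- The comparison map, at `v^♯`. -/
def cmpBody (v : HTm) : HTm :=
  ascribe D.sharp.pb (pair (inn (D.pr₁ v)) (pair (inn (D.pr₂ v))
    (D.cmpPath r (D.pr₁ v) (D.pr₂ v) (D.pr₃ v))))

/-- The comparison map. -/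
def cmp : HTm := lam D.pb.sharp fun w => D.cmpBody r (out (ascribe D.pb.sharp w))

/-- For `q : ♯ f s = ♯ g t`, the element of `♯ (f s_♯ = g t_♯)`. -/
def encPath (s t q : HTm) : HTm := enc (inn D.C) (D.sharp.f ⬝ s) (D.sharp.g ⬝ t) q

/-- The path from `♯ f s` to `♯ g t` given by `m : ♯ (f s_♯ = g t_♯)`. -/
def decPath (s t m : HTm) : HTm := dec r (inn D.C) (D.sharp.f ⬝ s) (D.sharp.g ⬝ t) m

/-- The triple `(s_♯, t_♯, m_♯)^♯` -/
def triple (s t m : HTm) : HTm := inn (pair (out s) (pair (out t) (out m)))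

/-- The inverse of the comparison map. -/
def inv : HTm := lam D.sharp.pb fun v => D.sharp.elim (fun _ => D.pb.sharp)
  (fun s t q => ascribe D.pb.sharp (triple s t (D.encPath s t q))) v

/-- The computation rule of the comparison map `c`, as a type or as a term. -/
def cmpRule (c : HTm) (S : (A : HTm) → (HTm → HTm) → HTm) (E : HTm → HTm → HTm → HTm) : HTm :=
  S D.A.sharp fun s => S D.B.sharp fun t =>
  S (HTm.sharp (eq D.C (D.f ⬝ out s) (D.g ⬝ out t))) fun m =>
    E D.sharp.pb (c ⬝ triple s t m) (pair s (pair t (D.decPath r s t m)))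

/-- The computation rule of the inverse `i` of the comparison map, as a type or as a term. -/
def invRule (i : HTm) (S : (A : HTm) → (HTm → HTm) → HTm) (E : HTm → HTm → HTm → HTm) : HTm :=
  S D.sharp.A fun s => S D.sharp.B fun t =>
  S (eq D.sharp.C (D.sharp.f ⬝ s) (D.sharp.g ⬝ t)) fun q =>
    E D.pb.sharp (i ⬝ pair s (pair t q)) (triple s t (D.encPath s t q))

/-- `ap_{(-)^♯} p`, for `p : f a = g b` -/
def apC (a b p : HTm) : HTm := apSharpIn D.C (D.f ⬝ a) (D.g ⬝ b) p

/-- `decPath (p^♯) = ap p` -/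
def decPathIn (a b p : HTm) : HTm := ρ ⬝ inn D.C ⬝ inn (D.f ⬝ a) ⬝ inn (D.g ⬝ b) ⬝ D.apC a b p

/-- `c (i v) = v` -/
def cmpInv (c i hc hi : HTm) : HTm :=
  let Q := D.sharp.pb
  lam Q fun v => indSig (fun v => eq Q (c ⬝ (i ⬝ v)) v)
    (fun s w => indSig (fun w => eq Q (c ⬝ (i ⬝ (pair s w))) (pair s w))
      (fun t q =>
        let u := pair s (pair t q)
        -- The chain is `c (i (s, t, q)) = c (s_♯, t_♯, (enc q)_♯)^♯ = (s, t, dec (enc q)) = (s, t,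
        -- q)`.
        apTrans Q (fun k => c ⬝ k) (i ⬝ u) (triple s t (D.encPath s t q)) u (hi ⬝ s ⬝ t ⬝ q)
        (apTrans Q (fun k => k) (c ⬝ triple s t (D.encPath s t q))
          (pair s (pair t (D.decPath r s t (D.encPath s t q)))) u
          (hc ⬝ s ⬝ t ⬝ D.encPath s t q)
        (apTrans Q (fun k => pair s (pair t k)) (D.decPath r s t (D.encPath s t q)) q u
          (decEnc r ρ (inn D.C) (D.sharp.f ⬝ s) (D.sharp.g ⬝ t) q) (refl (ascribe Q u))))) w) v

/-- `i (c v^♯) = v^♯` -/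
def invCmpIn (c i hc hi : HTm) : HTm :=
  let R := D.pb.sharp
  lam D.pb fun v => indSig (fun v => eq R (i ⬝ (c ⬝ inn v)) (inn v))
    (fun a w => indSig (fun w => eq R (i ⬝ (c ⬝ inn (pair a w))) (inn (pair a w)))
      (fun b p =>
        let s := inn a
        let t := inn b
        let u := inn (pair a (pair b p))
        let k := D.decPath r s t (inn p)
        -- After the rules for `c` and `i` the path component is `enc (dec (p^♯))`. Here `dec (p^♯)
        -- = ap p` by `ρ`, and `enc (ap p) = p^♯` by `encAp`.
        apTrans R (fun k => i ⬝ k) (c ⬝ u) (pair s (pair t k)) u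
          (hc ⬝ s ⬝ t ⬝ inn p)
        (apTrans R (fun k => k) (i ⬝ pair s (pair t k)) (triple s t (D.encPath s t k)) u
          (hi ⬝ s ⬝ t ⬝ k)
        (apTrans R (fun k => triple s t (D.encPath s t k)) k (D.apC a b p) u (D.decPathIn ρ a b p)
        (apTrans R (fun m => triple s t m) (D.encPath s t (D.apC a b p)) (inn p) u
          (encAp D.C (D.f ⬝ a) (D.g ⬝ b) p) (refl (ascribe R u)))))) w) v

/-- `i (c w) = w` -/
def invCmp (c i hc hi : HTm) : HTm :=
  lam D.pb.sharp fun w =>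
    -- The equation lives in a codiscrete type, so `r` extends it from elements `v^♯` to all `w`.
    r ⬝ inn D.pb ⬝ (i ⬝ (c ⬝ w)) ⬝ w ⬝ inn (D.invCmpIn r ρ c i hc hi ⬝ out w)

/-- `c ((a, b, p)^♯) = (a^♯, b^♯, ap_{(-)^♯} p)` -/
def cmpApIn (c hc : HTm) : HTm :=
  lam D.A fun a => lam D.B fun b => lam (eq D.C (D.f ⬝ a) (D.g ⬝ b)) fun p =>
    let Q := D.sharp.pb
    let u := pair (inn a) (pair (inn b) (D.apC a b p))
    let k := D.decPath r (inn a) (inn b) (inn p)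
    apTrans Q (fun k => k) (c ⬝ inn (pair a (pair b p))) (pair (inn a) (pair (inn b) k)) u
      (hc ⬝ inn a ⬝ inn b ⬝ inn p)
    (apTrans Q (fun k => pair (inn a) (pair (inn b) k)) k (D.apC a b p) u
      (D.decPathIn ρ a b p) (refl (ascribe Q u)))

/-- The type of a map satisfying `cmpApIn` that is an equivalence. -/
def isEquivCmp : HTm :=
  sig (arrow D.pb.sharp D.sharp.pb) fun c => prod
    (pi D.A fun a => pi D.B fun b => pi (eq D.C (D.f ⬝ a) (D.g ⬝ b)) fun p =>
      eq D.sharp.pb (c ⬝ inn (pair a (pair b p)))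
        (pair (inn a) (pair (inn b) (D.apC a b p))))
    (isEquiv D.pb.sharp D.sharp.pb c)

/-- Abstraction over all cospans in `𝒰₀`. -/
def lams (b : Cospan → HTm) : HTm :=
  lam (univ 0) fun A => lam (univ 0) fun B => lam (univ 0) fun C =>
  lam (arrow A C) fun f => lam (arrow B C) fun g => b ⟨A, B, C, f, g⟩

end Cospan

/-- `♯` preserves pullbacks. -/
def sharpPullback (r ρ : HTm) : HTm :=
  Cospan.lams fun D =>
    -- The argument treats `c` and `i` as variables with their computation rules as hypotheses,
    -- which keeps the types small. The actual maps satisfy these rules by `refl`.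
    (lam (arrow D.pb.sharp D.sharp.pb) fun c => lam (arrow D.sharp.pb D.pb.sharp) fun i =>
      lam (D.cmpRule r c pi eq) fun hc => lam (D.invRule i pi eq) fun hi =>
      ascribe D.isEquivCmp (pair c (pair (D.cmpApIn r ρ c hc)
        (pair (pair i (D.cmpInv r ρ c i hc hi)) (pair i (D.invCmp r ρ c i hc hi)))))) ⬝
    D.cmp r ⬝ D.inv ⬝
    D.cmpRule r (D.cmp r) lam (fun Q _ u => refl (ascribe Q u)) ⬝
    D.invRule D.inv lam (fun R _ u => refl (ascribe R u))

/-! ### Truncatedness: retracts, and preservation by `♯`. -/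

/-- For `a : A`, the type `Π (x : A), a = x`. -/
def contrPaths (A : HTm) : HTm → HTm := fun a => pi A fun x => eq A a x
/-- The center of the contractible type `A`. -/
def contrCenter (A k : HTm) : HTm := fst A (contrPaths A) k
/-- The contraction of the contractible type `A`. -/
def contrPath (A k : HTm) : HTm := snd A (contrPaths A) k

/-- The type expressing that retracts of `(n - 2)`-types are `(n - 2)`-types. -/
def retractTy (n : HTm) : HTm :=
  pi (univ 0) fun S => pi (univ 0) fun T => pi (arrow S T) fun s => pi (arrow T S) fun t =>
  arrow (pi S fun x => eq S (t ⬝ (s ⬝ x)) x) (arrow (isTruncated n T) (isTruncated n S))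

/-- Retracts of `(n - 2)`-types are `(n - 2)`-types. -/
def retract : HTm :=
  lam nat fun n => indNat retractTy
    (lam (univ 0) fun S => lam (univ 0) fun T => lam (arrow S T) fun s => lam (arrow T S) fun t =>
      lam (pi S fun x => eq S (t ⬝ (s ⬝ x)) x) fun h => lam (isTruncated zero T) fun k =>
      pair (t ⬝ contrCenter T k) (lam S fun x =>
        apTrans S (fun y => t ⬝ y) (contrCenter T k) (s ⬝ x) x (contrPath T k ⬝ (s ⬝ x)) (h ⬝ x)))
    (fun n ih =>
      lam (univ 0) fun S => lam (univ 0) fun T => lam (arrow S T) fun s => lam (arrow T S) fun t =>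
      lam (pi S fun x => eq S (t ⬝ (s ⬝ x)) x) fun h => lam (isTruncated (succ n) T) fun k =>
      lam S fun x => lam S fun y =>
        let ap := fun y p => indId (fun y _ => eq T (s ⬝ x) (s ⬝ y)) (refl (s ⬝ x)) y p
        -- The retraction on paths is `q ↦ (h x)⁻¹ · ap t q · h y`. On `refl` its composite with `ap
        -- s` is `(h x)⁻¹ · h x`, which `cancelSelf` contracts.
        let back := fun y q =>
          cancel S (t ⬝ (s ⬝ x)) x y (h ⬝ x)
            (apTrans S (fun w => t ⬝ w) (s ⬝ x) (s ⬝ y) y q (h ⬝ y))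
        ih ⬝ eq S x y ⬝ eq T (s ⬝ x) (s ⬝ y) ⬝ (lam (eq S x y) (ap y)) ⬝
          (lam (eq T (s ⬝ x) (s ⬝ y)) (back y)) ⬝
          (lam (eq S x y) fun p => indId (fun y p => eq (eq S x y) (back y (ap y p)) p)
            (cancelSelf S (t ⬝ (s ⬝ x)) x (h ⬝ x)) y p) ⬝
          (k ⬝ (s ⬝ x) ⬝ (s ⬝ y)))
    n

/-- The type expressing that `♯ X` is an `(n - 2)`-type if `X` is so crisply. -/
def sharpTruncTy (n : HTm) : HTm :=
  pi sharpU fun X => arrow (sharp (isTruncated n (out X))) (isTruncated n (T X))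

/-- `♯` preserves crisp `(n - 2)`-types. -/
def sharpTrunc (r ρ R : HTm) : HTm :=
  lam nat fun n => indNat sharpTruncTy
    (lam sharpU fun X => lam (sharp (isTruncated zero (out X))) fun u =>
      pair (inn (contrCenter (out X) (out u)))
        -- The contraction is available only under `♯`, as a path from the center to `z_♯`; `r`
        -- turns its image into a path in `♯(X_♯)`.
        (lam (T X) fun z => r ⬝ X ⬝ inn (contrCenter (out X) (out u)) ⬝ z ⬝
          inn (apSharpIn (out X) (contrCenter (out X) (out u)) (out z)
            (contrPath (out X) (out u) ⬝ out z))))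
    (fun n ih => lam sharpU fun X => lam (sharp (isTruncated (succ n) (out X))) fun u =>
      lam (T X) fun z => lam (T X) fun z' =>
        -- `P` is formed from `z_♯` and `z'_♯`, so the induction hypothesis receives it only as `P^♯
        -- : ♯𝒰`.
        let P := eq (out X) (out z) (out z')
        R ⬝ n ⬝ eq (T X) z z' ⬝ sharp P ⬝ (lam (eq (T X) z z') (enc X z z')) ⬝
          (lam (sharp P) (dec r X z z')) ⬝
          (lam (eq (T X) z z') (decEnc r ρ X z z')) ⬝
          (ih ⬝ inn P ⬝ inn (out u ⬝ out z ⬝ out z')))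
    n

/-- `♯` preserves `(n - 2)`-types. -/
def sharpTruncated (r ρ : HTm) : HTm :=
  (lam (pi nat retractTy) fun R => lam nat fun n => lam (univ 0) fun A =>
    -- Cohesive `A` and `t` become usable in the crisp version as `A^♯` and `t^♯`.
    lam (isTruncated n A) fun t => sharpTrunc r ρ R ⬝ n ⬝ inn A ⬝ inn t) ⬝ retract

end HTm

/-! ### The main theorem -/

/-- Evaluation of the checker confirms that the statement is a type and that the term inhabits it.
The number is only a bound on the recursion depth; any sufficient one would do. The next three
theorems are obtained likewise. -/
theorem derivable_isModality_zero :
    Derivable (.tm [] [] (HTm.withStable HTm.isModality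
      (fun _ => Tm.isModality 0 (Tm.sharpOp 0) (Tm.sharpUnit 0)) 0)
      (Tm.isModality 0 (Tm.sharpOp 0) (Tm.sharpUnit 0))) :=
  derivable_of_checkClosed (n := 400) (by decide +kernel)

theorem derivable_sharpPullback_zero :
    Derivable (.tm [] [] (HTm.withStable HTm.sharpPullback (fun _ => Tm.sharpPullback 0) 0)
      (Tm.sharpPullback 0)) :=
  derivable_of_checkClosed (n := 400) (by decide +kernel)

theorem derivable_pathSharp_zero :
    Derivable (.tm [] [] (HTm.withStable HTm.pathSharp (fun _ => Tm.pathSharp 0) 0)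
      (Tm.pathSharp 0)) :=
  derivable_of_checkClosed (n := 400) (by decide +kernel)

theorem derivable_sharpTruncated_zero :
    Derivable (.tm [] [] (HTm.withStable HTm.sharpTruncated (fun _ => Tm.sharpTruncated 0) 0)
      (Tm.sharpTruncated 0)) :=
  derivable_of_checkClosed (n := 400) (by decide +kernel)

/-- Raising turns `univ 0` into `univ (0 + i)`. Stating the side condition with `0 + i` makes it
hold by computation. -/
theorem inhabited_of_zero {T : ℕ → Tm} {t : Tm} (h : Derivable (.tm [] [] t (T 0))) (i : ℕ)
    (hT : (T 0).raise i = T (0 + i)) : Inhabited (T i) := by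
  have h' := h.raise i
  rw [Judgment.raise, hT, Nat.zero_add] at h'
  exact ⟨_, h'⟩

end SpatialTT

theorem mainTheorem9 (i : ℕ) :
    SpatialTT.Inhabited (SpatialTT.Tm.isModality i (SpatialTT.Tm.sharpOp i)
        (SpatialTT.Tm.sharpUnit i)) ∧
      SpatialTT.Inhabited (SpatialTT.Tm.sharpPullback i) ∧
      SpatialTT.Inhabited (SpatialTT.Tm.pathSharp i) ∧
      SpatialTT.Inhabited (SpatialTT.Tm.sharpTruncated i) :=
  ⟨SpatialTT.inhabited_of_zero (T := fun i => SpatialTT.Tm.isModality i (SpatialTT.Tm.sharpOp i)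
      (SpatialTT.Tm.sharpUnit i)) SpatialTT.derivable_isModality_zero i rfl,
    SpatialTT.inhabited_of_zero SpatialTT.derivable_sharpPullback_zero i rfl,
    SpatialTT.inhabited_of_zero SpatialTT.derivable_pathSharp_zero i rfl,
    SpatialTT.inhabited_of_zero SpatialTT.derivable_sharpTruncated_zero i rfl⟩
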